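/- A \emph{fusion ring} with finite basis $\{b_i\}_{i\in I}$ is given by structure constants $N_{i,j}^k\in\mathbb Z_{\ge 0}$, $b_ib_j=\sum_k N_{i,j}^k b_k$, a distinguished index $1\in I$ and a map $i\mapsto i^*$ on $I$ such that the product is associative, $b_1$ is neutral, $N_{i,k}^1=N_{k,i}^1=\delta_{i^*,k}$, and $N_{i,j}^k=N_{i^*,k}^j=N_{k,j^*}^i$. A table $(\lambda_{i,s})_{i\in I,\,s\in S}$ of complex numbers is an \emph{eigentable} of a commutative fusion ring if there is a basis $(v_s)_{s\in S}$ of $\mathbb C^I$ with $M_iv_s=\lambda_{i,s}v_s$ for all $i,s$, where $M_i=(N_{i,j}^k)_{k,j}$. Let $\zeta_n=\exp(2\pi \mathrm{i}/n)$, and let $q\ge 2$ be an integer. Let $T_q$ be the following table, where each row (resp. column) group is indexed by a parameter $c$ (resp. $k$) running over the displayed set (empty if the upper bound is $0$). If $q$ is even: $$\begin{array}{|c||c|c|c|c|}\hline c\backslash k&\{1\}&\{1\}&\{1,\dots,\frac{q-2}2\}&\{1,\dots,\frac q2\}\\\hline\hline \{1\}&1&1&1&1\\ \{1,\dots,\frac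 q2\}&q-1&-1&0&-\zeta_{q+1}^{kc}-\zeta_{q+1}^{-kc}\\ \{1\}&q&0&1&-1\\ \{1,\dots,\frac{q-2}2\}&q+1&1&\zeta_{q-1}^{kc}+\zeta_{q-1}^{-kc}&0\\\hline\end{array}$$ If $q\equiv-1 \bmod 4$: $$\begin{array}{|c||c|c|c|c|c|}\hline c\backslash k&\{1\}&\{1,2\}&\{1,\dots,\frac{q-3}4\}&\{1,\dots,\frac{q-3}4\}&\{\frac{q+1}4\}\\\hline\hline \{1\}&1&1&1&1&1\\ \{1,2\}&\frac{q-1}2&\frac{-1+\mathrm{i}(-1)^{k+c}\sqrt q}2&0&(-1)^{k+1}&(-1)^{k+1}\\ \{1,\dots,\frac{q-3}4\}&q-1&-1&0&-\zeta_{q+1}^{2kc}-\zeta_{q+1}^{-2kc}&-2(-1)^c\\ \{1\}&q&0&1&-1&-1\\ \{1,\dots,\frac{q-3}4\}&q+1&1&\zeta_{q-1}^{2kc}+\zeta_{q-1}^{-2kc}&0&0\\\hline\end{array}$$ If $q\equiv 1 \bmod 4$: $$\begin{array}{|c||c|c|c|c|c|}\hline c\backslash k&\{1\}&\{1,2\}&\{1,\dots,\frac{q-5}4\}&\{\frac{q-1}4\}&\{1,\dots,\frac{q-1}4\}\\\hline\hline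 \{1\}&1&1&1&1&1\\ \{1,2\}&\frac{q+1}2&\frac{1+(-1)^{k+c}\sqrt q}2&(-1)^k&(-1)^k&0\\ \{1,\dots,\frac{q-1}4\}&q-1&-1&0&0&-\zeta_{q+1}^{2kc}-\zeta_{q+1}^{-2kc}\\ \{1\}&q&0&1&1&-1\\ \{1,\dots,\frac{q-5}4\}&q+1&1&\zeta_{q-1}^{2kc}+\zeta_{q-1}^{-2kc}&2(-1)^c&0\\\hline\end{array}$$ (When $q$ is a prime power, $T_q$ is the character table of $\mathrm{PSL}(2,q)$.) \textbf{Proposition.} For every integer $q\ge 2$ there is exactly one fusion ring with basis indexed by the rows of $T_q$ whose eigentable is $T_q$; call it the interpolated fusion ring $\mathcal R_q$. It passes the one spectrum criterion, that is, there are no basis indices $i_0,i_1,\dots,i_9$ of $\mathcal R_q$ for which all of the following hold: \begin{align*} &N_{i_4,i_1}^{i_6},\ N_{i_5,i_4}^{i_2},\ N_{i_5,i_6}^{i_3},\ N_{i_7,i_9}^{i_1},\ N_{i_2,i_7}^{i_8},\ N_{i_8,i_9}^{i_3}\neq 0,\\ &\sum_k N_{i_4,i_7}^kN_{i_5^*,i_8}^kN_{i_6,i_9^*}^k=1,\\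 &N_{i_4,i_7}^{i_0}=N_{i_5^*,i_8}^{i_0}=N_{i_6,i_9^*}^{i_0}=1,\\ &N_{i_2,i_1}^{i_3}=0,\\ &\sum_kN_{i_5,i_4}^kN_{i_8,i_7^*}^k=1\ \text{ or }\ \sum_kN_{i_2,i_4^*}^kN_{i_8,i_0^*}^k=1\ \text{ or }\ \sum_kN_{i_5^*,i_2}^kN_{i_0,i_7^*}^k=1,\\ &\sum_kN_{i_5,i_0}^kN_{i_3,i_9^*}^k=1\ \text{ or }\ \sum_kN_{i_8,i_0^*}^kN_{i_3,i_6^*}^k=1\ \text{ or }\ \sum_kN_{i_5^*,i_8}^kN_{i_6,i_9^*}^k=1,\\ &\sum_kN_{i_4,i_7}^kN_{i_6,i_9^*}^k=1\ \text{ or }\ \sum_kN_{i_0,i_7^*}^kN_{i_6,i_1^*}^k=1\ \text{ or }\ \sum_kN_{i_4^*,i_0}^kN_{i_1,i_9^*}^k=1. \end{align*} -/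

import Mathlib

/-- A fusion ring whose basis is indexed by the finite type `ι`: nonnegative integer structure
constants `N i j k` (the coefficient of `b k` in `b i * b j`), a neutral basis element and a duality
on the basis, subject to associativity, neutrality, duality and Frobenius reciprocity. -/
structure FusionRing (ι : Type*) [Fintype ι] [DecidableEq ι] where
  N : ι → ι → ι → ℕ
  one : ι
  dual : ι → ι
  assoc : ∀ i j k l, ∑ m, N i j m * N m k l = ∑ m, N j k m * N i m l
  one_mul : ∀ i k, N one i k = if k = i then 1 else 0
  mul_one : ∀ i k, N i one k = if k = i then 1 else 0
  dual_right : ∀ i k, N i k one = if k = dual i then 1 else 0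
  dual_left : ∀ i k, N k i one = if k = dual i then 1 else 0
  frobenius_left : ∀ i j k, N i j k = N (dual i) k j
  frobenius_right : ∀ i j k, N i j k = N k (dual j) i

namespace FusionRing

variable {ι : Type*} [Fintype ι] [DecidableEq ι] (F : FusionRing ι)

/-- The fusion ring is commutative. -/
def IsCommutative : Prop := ∀ i j k, F.N i j k = F.N j i k

/-- The fusion matrix of the basis element `i`: left multiplication by `b i`, with entry `N i j k` in
row `k` and column `j`. -/
def fusionMatrix (i : ι) : Matrix ι ι ℂ := Matrix.of fun k j => (F.N i j k : ℂ)

/-- The table `T` (rows indexed by the basis, columns by `κ`) is an eigentable of the commutative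
fusion ring `F`: in some basis `v` of `ℂ ^ ι` indexed by `κ`, all fusion matrices are simultaneously
diagonal, the one of `i` being `diag (T i s)`. -/
def IsEigentable {κ : Type*} (T : ι → κ → ℂ) : Prop :=
  F.IsCommutative ∧
    ∃ v : Module.Basis κ ℂ (ι → ℂ), ∀ i s, (F.fusionMatrix i).mulVec (v s) = T i s • v s

/-- The sum `∑ k, N a b k * N c d k`, used in the last three conditions of the one spectrum
criterion. -/
def pairSum (a b c d : ι) : ℕ := ∑ k, F.N a b k * F.N c d k

/-- The system of conditions of the one spectrum criterion, for the indices `i₀, …, i₉`. -/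
def OneSpectrumSystem (i₀ i₁ i₂ i₃ i₄ i₅ i₆ i₇ i₈ i₉ : ι) : Prop :=
  (F.N i₄ i₁ i₆ ≠ 0 ∧ F.N i₅ i₄ i₂ ≠ 0 ∧ F.N i₅ i₆ i₃ ≠ 0 ∧
    F.N i₇ i₉ i₁ ≠ 0 ∧ F.N i₂ i₇ i₈ ≠ 0 ∧ F.N i₈ i₉ i₃ ≠ 0) ∧
  (∑ k, F.N i₄ i₇ k * F.N (F.dual i₅) i₈ k * F.N i₆ (F.dual i₉) k = 1) ∧
  (F.N i₄ i₇ i₀ = 1 ∧ F.N (F.dual i₅) i₈ i₀ = 1 ∧ F.N i₆ (F.dual i₉) i₀ = 1) ∧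
  F.N i₂ i₁ i₃ = 0 ∧
  (F.pairSum i₅ i₄ i₈ (F.dual i₇) = 1 ∨
    F.pairSum i₂ (F.dual i₄) i₈ (F.dual i₀) = 1 ∨
    F.pairSum (F.dual i₅) i₂ i₀ (F.dual i₇) = 1) ∧
  (F.pairSum i₅ i₀ i₃ (F.dual i₉) = 1 ∨
    F.pairSum i₈ (F.dual i₀) i₃ (F.dual i₆) = 1 ∨
    F.pairSum (F.dual i₅) i₈ i₆ (F.dual i₉) = 1) ∧
  (F.pairSum i₄ i₇ i₆ (F.dual i₉) = 1 ∨
    F.pairSum i₀ (F.dual i₇) i₆ (F.dual i₁) = 1 ∨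
    F.pairSum (F.dual i₄) i₀ i₁ (F.dual i₉) = 1)

/-- The fusion ring passes the one spectrum criterion: no ten indices satisfy the system. -/
def PassesOneSpectrumCriterion : Prop :=
  ∀ i₀ i₁ i₂ i₃ i₄ i₅ i₆ i₇ i₈ i₉ : ι, ¬ F.OneSpectrumSystem i₀ i₁ i₂ i₃ i₄ i₅ i₆ i₇ i₈ i₉

end FusionRing

/-- A finite formal table of complex numbers. -/
structure FormalTable where
  Row : Type
  Col : Type
  [fintypeRow : Fintype Row]
  [decidableEqRow : DecidableEq Row]
  [fintypeCol : Fintype Col]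
  entry : Row → Col → ℂ

attribute [instance] FormalTable.fintypeRow FormalTable.decidableEqRow FormalTable.fintypeCol

namespace InterpolatedPSL2

/-- The root of unity `ζ_n = exp (2 π i / n)`. -/
noncomputable def zeta (n : ℕ) : ℂ := Complex.exp (2 * Real.pi * Complex.I / n)

/-- `ζ_n ^ m + ζ_n ^ (-m)`. -/
noncomputable def zetaSum (n m : ℕ) : ℂ := zeta n ^ m + (zeta n ^ m)⁻¹

/-! The rows and columns of each table come in groups, in the order of the table; a group is indexed
by its parameter (`c` for rows, `k` for columns). -/

/-! ### `q` even -/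

/-- Rows of degrees `1`, `q - 1`, `q`, `q + 1`. -/
abbrev EvenRow (q : ℕ) : Type :=
  Unit ⊕ Finset.Icc 1 (q / 2) ⊕ Unit ⊕ Finset.Icc 1 ((q - 2) / 2)

/-- Columns of class sizes `1`, `q² - 1`, `q (q + 1)`, `q (q - 1)`. -/
abbrev EvenCol (q : ℕ) : Type :=
  Unit ⊕ Unit ⊕ Finset.Icc 1 ((q - 2) / 2) ⊕ Finset.Icc 1 (q / 2)

noncomputable def evenEntry (q : ℕ) : EvenRow q → EvenCol q → ℂ
  -- degree `1`
  | .inl _, _ => 1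
  -- degree `q - 1`
  | .inr (.inl _), .inl _ => q - 1
  | .inr (.inl _), .inr (.inl _) => -1
  | .inr (.inl _), .inr (.inr (.inl _)) => 0
  | .inr (.inl c), .inr (.inr (.inr k)) => -zetaSum (q + 1) (k * c)
  -- degree `q`
  | .inr (.inr (.inl _)), .inl _ => q
  | .inr (.inr (.inl _)), .inr (.inl _) => 0
  | .inr (.inr (.inl _)), .inr (.inr (.inl _)) => 1
  | .inr (.inr (.inl _)), .inr (.inr (.inr _)) => -1
  -- degree `q + 1`
  | .inr (.inr (.inr _)), .inl _ => q + 1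
  | .inr (.inr (.inr _)), .inr (.inl _) => 1
  | .inr (.inr (.inr c)), .inr (.inr (.inl k)) => zetaSum (q - 1) (k * c)
  | .inr (.inr (.inr _)), .inr (.inr (.inr _)) => 0

noncomputable def evenTable (q : ℕ) : FormalTable where
  Row := EvenRow q
  Col := EvenCol q
  entry := evenEntry q

/-! ### `q ≡ -1 mod 4` -/

/-- Rows of degrees `1`, `(q - 1) / 2`, `q - 1`, `q`, `q + 1`. -/
abbrev ThreeRow (q : ℕ) : Type :=
  Unit ⊕ Finset.Icc 1 2 ⊕ Finset.Icc 1 ((q - 3) / 4) ⊕ Unit ⊕ Finset.Icc 1 ((q - 3) / 4)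

/-- Columns of class sizes `1`, `(q² - 1) / 2`, `q (q + 1)`, `q (q - 1)`, `q (q - 1) / 2`. -/
abbrev ThreeCol (q : ℕ) : Type :=
  Unit ⊕ Finset.Icc 1 2 ⊕ Finset.Icc 1 ((q - 3) / 4) ⊕ Finset.Icc 1 ((q - 3) / 4) ⊕ Unit

/-- In the last column the class parameter is `k = (q + 1) / 4`. -/
noncomputable def threeEntry (q : ℕ) : ThreeRow q → ThreeCol q → ℂ
  -- degree `1`
  | .inl _, _ => 1
  -- degree `(q - 1) / 2`
  | .inr (.inl _), .inl _ => (q - 1) / 2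
  | .inr (.inl c), .inr (.inl k) =>
      (-1 + Complex.I * (-1) ^ ((k : ℕ) + (c : ℕ)) * (Real.sqrt q : ℂ)) / 2
  | .inr (.inl _), .inr (.inr (.inl _)) => 0
  | .inr (.inl _), .inr (.inr (.inr (.inl k))) => (-1) ^ ((k : ℕ) + 1)
  | .inr (.inl _), .inr (.inr (.inr (.inr _))) => (-1) ^ ((q + 1) / 4 + 1)
  -- degree `q - 1`
  | .inr (.inr (.inl _)), .inl _ => q - 1
  | .inr (.inr (.inl _)), .inr (.inl _) => -1
  | .inr (.inr (.inl _)), .inr (.inr (.inl _)) => 0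
  | .inr (.inr (.inl c)), .inr (.inr (.inr (.inl k))) => -zetaSum (q + 1) (2 * k * c)
  | .inr (.inr (.inl c)), .inr (.inr (.inr (.inr _))) => -2 * (-1) ^ (c : ℕ)
  -- degree `q`
  | .inr (.inr (.inr (.inl _))), .inl _ => q
  | .inr (.inr (.inr (.inl _))), .inr (.inl _) => 0
  | .inr (.inr (.inr (.inl _))), .inr (.inr (.inl _)) => 1
  | .inr (.inr (.inr (.inl _))), .inr (.inr (.inr (.inl _))) => -1
  | .inr (.inr (.inr (.inl _))), .inr (.inr (.inr (.inr _))) => -1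
  -- degree `q + 1`
  | .inr (.inr (.inr (.inr _))), .inl _ => q + 1
  | .inr (.inr (.inr (.inr _))), .inr (.inl _) => 1
  | .inr (.inr (.inr (.inr c))), .inr (.inr (.inl k)) => zetaSum (q - 1) (2 * k * c)
  | .inr (.inr (.inr (.inr _))), .inr (.inr (.inr (.inl _))) => 0
  | .inr (.inr (.inr (.inr _))), .inr (.inr (.inr (.inr _))) => 0

noncomputable def threeTable (q : ℕ) : FormalTable where
  Row := ThreeRow q
  Col := ThreeCol q
  entry := threeEntry q

/-! ### `q ≡ 1 mod 4` -/

/-- Rows of degrees `1`, `(q + 1) / 2`, `q - 1`, `q`, `q + 1`. -/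
abbrev OneRow (q : ℕ) : Type :=
  Unit ⊕ Finset.Icc 1 2 ⊕ Finset.Icc 1 ((q - 1) / 4) ⊕ Unit ⊕ Finset.Icc 1 ((q - 5) / 4)

/-- Columns of class sizes `1`, `(q² - 1) / 2`, `q (q + 1)`, `q (q + 1) / 2`, `q (q - 1)`. -/
abbrev OneCol (q : ℕ) : Type :=
  Unit ⊕ Finset.Icc 1 2 ⊕ Finset.Icc 1 ((q - 5) / 4) ⊕ Unit ⊕ Finset.Icc 1 ((q - 1) / 4)

/-- In the fourth column the class parameter is `k = (q - 1) / 4`. -/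
noncomputable def oneEntry (q : ℕ) : OneRow q → OneCol q → ℂ
  -- degree `1`
  | .inl _, _ => 1
  -- degree `(q + 1) / 2`
  | .inr (.inl _), .inl _ => (q + 1) / 2
  | .inr (.inl c), .inr (.inl k) =>
      (1 + (-1) ^ ((k : ℕ) + (c : ℕ)) * (Real.sqrt q : ℂ)) / 2
  | .inr (.inl _), .inr (.inr (.inl k)) => (-1) ^ (k : ℕ)
  | .inr (.inl _), .inr (.inr (.inr (.inl _))) => (-1) ^ ((q - 1) / 4)
  | .inr (.inl _), .inr (.inr (.inr (.inr _))) => 0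
  -- degree `q - 1`
  | .inr (.inr (.inl _)), .inl _ => q - 1
  | .inr (.inr (.inl _)), .inr (.inl _) => -1
  | .inr (.inr (.inl _)), .inr (.inr (.inl _)) => 0
  | .inr (.inr (.inl _)), .inr (.inr (.inr (.inl _))) => 0
  | .inr (.inr (.inl c)), .inr (.inr (.inr (.inr k))) => -zetaSum (q + 1) (2 * k * c)
  -- degree `q`
  | .inr (.inr (.inr (.inl _))), .inl _ => q
  | .inr (.inr (.inr (.inl _))), .inr (.inl _) => 0
  | .inr (.inr (.inr (.inl _))), .inr (.inr (.inl _)) => 1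
  | .inr (.inr (.inr (.inl _))), .inr (.inr (.inr (.inl _))) => 1
  | .inr (.inr (.inr (.inl _))), .inr (.inr (.inr (.inr _))) => -1
  -- degree `q + 1`
  | .inr (.inr (.inr (.inr _))), .inl _ => q + 1
  | .inr (.inr (.inr (.inr _))), .inr (.inl _) => 1
  | .inr (.inr (.inr (.inr c))), .inr (.inr (.inl k)) => zetaSum (q - 1) (2 * k * c)
  | .inr (.inr (.inr (.inr c))), .inr (.inr (.inr (.inl _))) => 2 * (-1) ^ (c : ℕ)
  | .inr (.inr (.inr (.inr _))), .inr (.inr (.inr (.inr _))) => 0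

noncomputable def oneTable (q : ℕ) : FormalTable where
  Row := OneRow q
  Col := OneCol q
  entry := oneEntry q

/-- The generic character table of `PSL(2, q)`, interpolated to every integer `q ≥ 2`. -/
noncomputable def table (q : ℕ) : FormalTable :=
  if q % 2 = 0 then evenTable q else if q % 4 = 3 then threeTable q else oneTable q

/-- `R` is the interpolated fusion ring `R_q`: the fusion ring, with basis the rows of the
interpolated table, whose eigentable is that table. -/
def IsInterpolatedFusionRing (q : ℕ) (R : FusionRing (table q).Row) : Prop :=
  R.IsEigentable (table q).entry

end InterpolatedPSL2

/-! The table is treated as a character table without a group. Weights on the columns that imitate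
the inverse centralizer orders of PSL(2,q) turn the weighted sum of a product of three rows into a
"multiplicity of the trivial character". If these sums are nonnegative integers M i j k, if M i j 1
is the indicator of j = i*, and if there are as many rows as columns, then the rows are orthonormal,
hence so are the columns. Consequently the rows multiply with coefficients M i j k*, associativity
is inherited from multiplication of functions, and any fusion ring with this eigentable has these
coefficients. This is `TripleData`; it gives existence and uniqueness at once.

The sums are computed generically in q. The rows of degrees q - 1 and q + 1 extend to families of
virtual characters with an arbitrary integer parameter. Together with the Steinberg row, the rows of
half degree and the Gelfand-Graev functions, these obey product rules that are polynomial identities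
and cosine product formulas (`evenDisc_mul_evenDisc` and its relatives). A triple product thus
reduces to means of single functions, which are sums of roots of unity. The result depends only on
how many of x ± y ± z are divisible by the relevant modulus; that number is at most one on the rows
of degree q - 1 (`signCount_le_one`), so no multiplicity is negative.

For the criterion, `OneSpectrumSystem.ne_one` shows that i₄, …, i₉ are nontrivial. The triple sum
runs over common constituents of three products, with pairs (i₄, i₇), (i₅*, i₈), (i₆, i₉*), and it
must equal 1. For q even, every product of nontrivial rows contains all rows of degree q + 1, so for
q ≥ 6 the sum is at least 2. For q ≡ 3 mod 4 the only exception is the square of a row of degree (q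
- 1)/2. Such a square contains all rows of degree q - 1, and then the sum is 0 or, for q ≥ 19, at
least 2. For q ≡ 1 mod 4 and q ≥ 9 the sum can be 1, but only if one pair consists of equal and
another of different rows of degree (q + 1)/2; the Steinberg row is then forced among i₁, i₂, i₃,
which contradicts N i₂ i₁ i₃ = 0. The remaining values q = 2, 3, 4, 5, 7, 11, 15 are settled by a
search on bit masks evaluated in the kernel. -/

namespace FusionRing

/-! ### Fusion rings, eigentables and trivial indices in the system -/

variable {ι κ : Type*} [Fintype ι] [DecidableEq ι]

/-- A neutral element is unique, and the dual of i is the only index k for which b i * b k contains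
the neutral element; so both are determined by the structure constants. -/
theorem ext_of_N {R R' : FusionRing ι} (h : ∀ i j k, R.N i j k = R'.N i j k) : R = R' := by
  have hN : R.N = R'.N := by
    funext i j k
    exact h i j k
  have h1 : R.one = R'.one := by
    have h2 := R.one_mul R'.one R.one
    rw [hN, R'.mul_one, if_pos rfl] at h2
    by_contra hne
    rw [if_neg hne] at h2
    exact one_ne_zero h2
  have hd : R.dual = R'.dual := by
    funext i
    have h2 := R.dual_right i (R.dual i)
    rw [hN, h1, R'.dual_right, if_pos rfl] at h2
    by_contra hne
    rw [if_neg hne] at h2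
    exact zero_ne_one h2
  cases R
  cases R'
  simp only at hN h1 hd
  subst hN h1 hd
  rfl

/-- The rows of an eigentable multiply like the basis elements. -/
theorem IsEigentable.mul_eq {R : FusionRing ι} {T : ι → κ → ℂ} (h : R.IsEigentable T)
    (i j : ι) (s : κ) : T i s * T j s = ∑ k, (R.N i j k : ℂ) * T k s := by
  obtain ⟨-, v, hv⟩ := h
  -- Associativity says that left multiplication is a homomorphism; evaluating both sides of this
  -- identity on the common eigenvector `v s` gives the claim.
  have hmul : R.fusionMatrix i * R.fusionMatrix j = ∑ k, (R.N i j k : ℂ) • R.fusionMatrix k := by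
    ext l n
    simp only [Matrix.mul_apply, fusionMatrix, Matrix.of_apply, Matrix.sum_apply,
      Matrix.smul_apply, smul_eq_mul]
    have := R.assoc i j n l
    calc (∑ x, (R.N i x l : ℂ) * R.N j n x) = ((∑ m, R.N j n m * R.N i m l : ℕ) : ℂ) := by
          push_cast
          exact Finset.sum_congr rfl fun x _ => mul_comm _ _
      _ = _ := by rw [← this]; push_cast; rfl
  have h1 : (R.fusionMatrix i * R.fusionMatrix j).mulVec (v s) = (T i s * T j s) • v s := by
    rw [← Matrix.mulVec_mulVec, hv, Matrix.mulVec_smul, hv, smul_smul, mul_comm]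
  rw [hmul, Matrix.sum_mulVec] at h1
  simp only [Matrix.smul_mulVec, hv, smul_smul] at h1
  rw [← Finset.sum_smul] at h1
  exact (smul_left_injective ℂ (v.ne_zero s) h1).symm

variable {R : FusionRing ι}

theorem eq_of_one_mul_ne {i k : ι} (h : R.N R.one i k ≠ 0) : k = i := by
  rw [R.one_mul] at h
  by_contra hne
  exact h (if_neg hne)

theorem eq_of_mul_one_ne {i k : ι} (h : R.N i R.one k ≠ 0) : k = i := by
  rw [R.mul_one] at h
  by_contra hne
  exact h (if_neg hne)

theorem eq_dual_of_ne {i k : ι} (h : R.N i k R.one ≠ 0) : k = R.dual i := by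
  rw [R.dual_right] at h
  by_contra hne
  exact h (if_neg hne)

/-- The neutral element is none of the last six indices of the system. -/
theorem OneSpectrumSystem.ne_one {i₀ i₁ i₂ i₃ i₄ i₅ i₆ i₇ i₈ i₉ : ι}
    (h : R.OneSpectrumSystem i₀ i₁ i₂ i₃ i₄ i₅ i₆ i₇ i₈ i₉) :
    i₄ ≠ R.one ∧ i₅ ≠ R.one ∧ i₆ ≠ R.one ∧ i₇ ≠ R.one ∧ i₈ ≠ R.one ∧ i₉ ≠ R.one := by
  obtain ⟨⟨h1, h2, h3, h4, h5, h6⟩, -, -, h0, -⟩ := h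
  -- If one of these indices is trivial, two of the conditions N ≠ 0 become equalities of indices,
  -- and a third one becomes N i₂ i₁ i₃ ≠ 0, against `h0`.
  refine ⟨?_, ?_, ?_, ?_, ?_, ?_⟩ <;> rintro rfl
  · rw [eq_of_one_mul_ne h1, ← eq_of_mul_one_ne h2] at h3
    exact h3 h0
  · rw [← eq_of_one_mul_ne h2, ← eq_of_one_mul_ne h3] at h1
    exact h1 h0
  · rw [R.frobenius_right, ← eq_of_mul_one_ne h3, ← eq_dual_of_ne h1] at h2
    exact h2 h0
  · rw [← eq_of_one_mul_ne h4, eq_of_mul_one_ne h5] at h6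
    exact h6 h0
  · rw [eq_dual_of_ne h5, ← eq_of_one_mul_ne h6, ← R.frobenius_left] at h4
    exact h4 h0
  · rw [← eq_of_mul_one_ne h4, ← eq_of_mul_one_ne h6] at h5
    exact h5 h0

end FusionRing

/-! ### From weighted triple sums to the unique fusion ring -/

/-- Weights on the columns of a table for which the triple products of rows have total weight
`M i j k`, these numbers being those of a fusion ring with all rows real up to the duality. -/
structure TripleData {ι κ : Type*} [Fintype ι] [DecidableEq ι] [Fintype κ]
    (T : ι → κ → ℂ) (M : ι → ι → ι → ℕ) (one : ι) (dual : ι → ι) where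
  weight : κ → ℂ
  card_eq : Fintype.card ι = Fintype.card κ
  row_one : ∀ s, T one s = 1
  triple : ∀ i j k, ∑ s, weight s * (T i s * T j s * T k s) = M i j k
  pairing : ∀ i j, M i j one = if j = dual i then 1 else 0
  dual_triple : ∀ i j k, M (dual i) (dual j) (dual k) = M i j k

namespace TripleData

variable {ι κ : Type*} [Fintype ι] [DecidableEq ι] [Fintype κ]
  {T : ι → κ → ℂ} {M : ι → ι → ι → ℕ} {one : ι} {dual : ι → ι} (d : TripleData T M one dual)

include d

theorem comm (i j k : ι) : M i j k = M j i k := by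
  have := d.triple i j k
  simp only [mul_comm (T i _) (T j _), d.triple] at this
  exact_mod_cast this.symm

theorem comm_right (i j k : ι) : M i j k = M i k j := by
  have := d.triple i j k
  simp only [mul_right_comm (T i _) (T j _), d.triple] at this
  exact_mod_cast this.symm

theorem dual_dual (i : ι) : dual (dual i) = i := by
  have h := d.pairing (dual i) i
  rw [d.comm, d.pairing, if_pos rfl] at h
  by_contra hne
  rw [if_neg (Ne.symm hne)] at h
  exact one_ne_zero h

theorem dual_inj {i j : ι} : dual i = dual j ↔ i = j :=
  ⟨fun h => by rw [← d.dual_dual i, h, d.dual_dual], fun h => by rw [h]⟩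

theorem orthogonal (i j : ι) :
    ∑ s, d.weight s * (T i s * T (dual j) s) = if i = j then 1 else 0 := by
  have := d.triple i (dual j) one
  simp only [d.row_one, mul_one, d.pairing, d.dual_inj] at this
  rw [this]
  simp [eq_comm]

/-- Row orthogonality says that one matrix is a right inverse of another. Since there are as many
rows as columns, it is also a left inverse, which is column orthogonality. -/
theorem orthogonal_columns [DecidableEq κ] (s t : κ) :
    ∑ j, d.weight s * T (dual j) s * T j t = if s = t then 1 else 0 := by
  let A : Matrix ι κ ℂ := Matrix.of fun i s => T i s
  let B : Matrix κ ι ℂ := Matrix.of fun s j => d.weight s * T (dual j) s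
  have hAB : A * B = 1 := by
    ext i j
    rw [Matrix.mul_apply, Matrix.one_apply, ← d.orthogonal]
    exact Finset.sum_congr rfl fun s _ => by simp only [A, B, Matrix.of_apply]; ring
  have hBA : B * A = 1 := (Matrix.mul_eq_one_comm_of_card_eq _ _ ℂ d.card_eq).1 hAB
  have := congrFun (congrFun hBA s) t
  rwa [Matrix.mul_apply, Matrix.one_apply] at this

/-- Writing M as a weighted sum over columns s, column orthogonality kills every s ≠ t. -/
theorem mul_eq (i j : ι) (t : κ) : T i t * T j t = ∑ k, (M i j (dual k) : ℂ) * T k t := by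
  classical
  simp only [← d.triple, Finset.sum_mul]
  rw [Finset.sum_comm]
  have : ∀ s, ∑ k, d.weight s * (T i s * T j s * T (dual k) s) * T k t
      = if s = t then T i s * T j s else 0 := fun s => by
    have := d.orthogonal_columns s t
    calc _ = T i s * T j s * ∑ k, d.weight s * T (dual k) s * T k t := by
          rw [Finset.mul_sum]
          exact Finset.sum_congr rfl fun k _ => by ring
      _ = _ := by rw [this]; simp
  simp [this]

/-- If the rows multiply with coefficients `N`, then these are the numbers `M`. -/
theorem eq_of_mul_eq {N : ι → ι → ι → ℕ}
    (h : ∀ i j s, T i s * T j s = ∑ k, (N i j k : ℂ) * T k s) (i j k : ι) :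
    N i j k = M i j (dual k) := by
  have h1 := d.triple i j (dual k)
  simp only [h, Finset.sum_mul, Finset.mul_sum] at h1
  rw [Finset.sum_comm] at h1
  have : ∀ l, ∑ s, d.weight s * ((N i j l : ℂ) * T l s * T (dual k) s)
      = if l = k then (N i j l : ℂ) else 0 := fun l => by
    calc _ = (N i j l : ℂ) * ∑ s, d.weight s * (T l s * T (dual k) s) := by
          rw [Finset.mul_sum]
          exact Finset.sum_congr rfl fun s _ => by ring
      _ = _ := by rw [d.orthogonal]; simp
  simp only [this, Finset.sum_ite_eq', Finset.mem_univ, if_true] at h1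
  exact_mod_cast h1

/-- The right side is symmetric in i, j, k; this is the source of associativity. -/
theorem sum_mul_triple (i j k l : ι) :
    ((∑ m, M i j (dual m) * M m k (dual l) : ℕ) : ℂ)
      = ∑ s, d.weight s * (T i s * T j s * T k s * T (dual l) s) := by
  push_cast
  simp only [d.mul_eq i j, ← d.triple _ k, Finset.mul_sum, Finset.sum_mul]
  rw [Finset.sum_comm]
  exact Finset.sum_congr rfl fun s _ => Finset.sum_congr rfl fun m _ => by ring

/-- Invariance of M under duality, applied to (1*, 1, 1), equates M 1* 1 1 = 1 with the indicator of
1* = 1. -/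
theorem dual_one : dual one = one := by
  have h1 := d.dual_triple (dual one) one one
  rw [d.comm (dual one), d.pairing, if_pos rfl, d.dual_dual, d.comm, d.comm_right, d.pairing,
    d.dual_dual] at h1
  by_contra hne
  rw [if_neg hne] at h1
  exact zero_ne_one h1

theorem one_triple (i j : ι) : M one i j = if j = dual i then 1 else 0 := by
  rw [← d.pairing, d.comm, d.comm_right]

/-- The fusion ring with structure constants `M i j k*`. -/
def toFusionRing : FusionRing ι where
  N i j k := M i j (dual k)
  one := one
  dual := dual
  assoc i j k l := by
    have h1 := d.sum_mul_triple i j k l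
    have h2 := d.sum_mul_triple j k i l
    have h3 : ∑ m, M j k (dual m) * M i m (dual l) = ∑ m, M j k (dual m) * M m i (dual l) :=
      Finset.sum_congr rfl fun m _ => by rw [d.comm i m]
    rw [h3]
    have : ((∑ m, M i j (dual m) * M m k (dual l) : ℕ) : ℂ)
        = ((∑ m, M j k (dual m) * M m i (dual l) : ℕ) : ℂ) := by
      rw [h1, h2]
      exact Finset.sum_congr rfl fun s _ => by ring
    exact_mod_cast this
  one_mul i k := by
    rw [d.one_triple]
    simp only [d.dual_inj]
  mul_one i k := by
    rw [d.comm, d.one_triple]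
    simp only [d.dual_inj]
  dual_right i k := by rw [d.dual_one, d.pairing]
  dual_left i k := by rw [d.dual_one, d.comm, d.pairing]
  frobenius_left i j k := by
    rw [← d.dual_triple, d.dual_dual, d.comm_right]
  frobenius_right i j k := by
    rw [← d.dual_triple i j, d.dual_dual, d.comm_right, d.comm, d.comm_right, d.comm,
      d.comm_right, d.comm]

/-- The eigenvectors are the columns read at dual rows. `mul_eq` is the eigenvector equation, and
column orthogonality makes them independent; their number is the dimension. -/
theorem isEigentable : d.toFusionRing.IsEigentable T := by
  classical
  refine ⟨fun i j k => d.comm _ _ _, ?_⟩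
  let v : κ → ι → ℂ := fun s j => T (dual j) s
  have hli : LinearIndependent ℂ v := by
    rw [Fintype.linearIndependent_iff]
    intro c hc t
    have h1 : ∀ s, ∑ j, d.weight t * T j t * T (dual j) s = if t = s then 1 else 0 := fun s => by
      rw [← d.orthogonal_columns t s]
      exact Finset.sum_nbij' dual dual (by simp) (by simp) (by simp [d.dual_dual])
        (by simp [d.dual_dual]) (by simp [d.dual_dual])
    have h2 : ∑ j, d.weight t * T j t * (∑ s, c s • v s) j = 0 := by
      rw [hc]
      simp
    simp only [Finset.sum_apply, Pi.smul_apply, smul_eq_mul, Finset.mul_sum] at h2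
    rw [Finset.sum_comm] at h2
    have h3 : ∀ s, ∑ j, d.weight t * T j t * (c s * v s j) = if t = s then c s else 0 := fun s => by
      calc _ = c s * ∑ j, d.weight t * T j t * T (dual j) s := by
            rw [Finset.mul_sum]
            exact Finset.sum_congr rfl fun j _ => by ring
        _ = _ := by rw [h1]; simp
    simpa [h3] using h2
  have hspan : ⊤ ≤ Submodule.span ℂ (Set.range v) := by
    rw [hli.span_eq_top_of_card_eq_finrank' (by simp [d.card_eq])]
  refine ⟨Module.Basis.mk hli hspan, fun i s => ?_⟩
  rw [Module.Basis.mk_apply]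
  funext k
  simp only [Matrix.mulVec, dotProduct, FusionRing.fusionMatrix, Matrix.of_apply, Pi.smul_apply,
    smul_eq_mul, v, d.mul_eq i (dual k) s]
  -- The structure constant is M i j k* while `mul_eq` carries a dual on the summation index;
  -- reindexing by duality matches the two.
  refine Finset.sum_nbij' dual dual (by simp) (by simp) (by simp [d.dual_dual])
    (by simp [d.dual_dual]) fun j _ => ?_
  change (M i j (dual k) : ℂ) * _ = _
  rw [d.dual_dual, d.comm_right]

/-- A fusion ring with the same eigentable has structure constants `M i j k*`. -/
theorem N_eq {R : FusionRing ι} (h : R.IsEigentable T) (i j k : ι) : R.N i j k = M i j (dual k) :=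
  d.eq_of_mul_eq h.mul_eq i j k

theorem eq_toFusionRing {R : FusionRing ι} (h : R.IsEigentable T) : R = d.toFusionRing :=
  FusionRing.ext_of_N fun i j k => d.N_eq h i j k

theorem existsUnique : ∃! R : FusionRing ι, R.IsEigentable T :=
  ⟨d.toFusionRing, d.isEigentable, fun _ h => d.eq_toFusionRing h⟩

end TripleData

/-! ### Sums of roots of unity and divisibility counts -/

namespace InterpolatedPSL2

/-- `ζ_n ^ t + ζ_n ^ (-t)` for an integer `t`. -/
noncomputable def zs (n : ℕ) (t : ℤ) : ℂ := zeta n ^ t + zeta n ^ (-t)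

theorem zeta_ne_zero (n : ℕ) : zeta n ≠ 0 := Complex.exp_ne_zero _

theorem isPrimitiveRoot_zeta {n : ℕ} (hn : n ≠ 0) : IsPrimitiveRoot (zeta n) n :=
  Complex.isPrimitiveRoot_exp n hn

theorem zetaSum_eq (n m : ℕ) : zetaSum n m = zs n m := by
  simp [zetaSum, zs]

/-- The product formula for cosines; it is the only trigonometric input to the product rules below.
-/
theorem zs_mul (n : ℕ) (a b : ℤ) : zs n a * zs n b = zs n (a + b) + zs n (a - b) := by
  have h := zeta_ne_zero n
  simp only [zs, neg_add, sub_eq_add_neg, zpow_add₀ h]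
  ring_nf

theorem zeta_two_mul {n : ℕ} : zeta (2 * n) ^ 2 = zeta n := by
  rw [zeta, zeta, ← Complex.exp_nat_mul]
  congr 1
  push_cast
  rw [mul_div_assoc', mul_div_mul_left _ _ two_ne_zero]

theorem zs_two_mul (n : ℕ) (t : ℤ) : zs (2 * n) (2 * t) = zs n t := by
  rw [zs, zs, ← zeta_two_mul (n := n)]
  simp only [← mul_neg, zpow_mul]
  norm_cast

/-- The two geometric sums telescope. -/
theorem sub_one_mul_sum (w : ℂ) (hw : w ≠ 0) (r : ℕ) :
    (w - 1) * ∑ k ∈ Finset.Icc 1 r, (w ^ k + (w ^ k)⁻¹) = w ^ (r + 1) - w + 1 - (w ^ r)⁻¹ := by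
  induction r with
  | zero => simp
  | succ r ih =>
    rw [Finset.sum_Icc_succ_top (by omega), mul_add, ih]
    field_simp
    ring

theorem zs_natCast_mul (n k : ℕ) (x : ℤ) :
    zs n (k * x) = (zeta n ^ x) ^ k + ((zeta n ^ x) ^ k)⁻¹ := by
  rw [zs, mul_comm, zpow_neg, zpow_mul, zpow_natCast]

theorem zs_of_dvd {n : ℕ} (hn : n ≠ 0) {x : ℤ} (h : (n : ℤ) ∣ x) : zs n x = 2 := by
  rw [zs, ((isPrimitiveRoot_zeta hn).zpow_eq_one_iff_dvd x).2 h,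
    ((isPrimitiveRoot_zeta hn).zpow_eq_one_iff_dvd (-x)).2 (by simpa using h)]
  norm_num

/-- The exponents ±k with 1 ≤ k ≤ r are all nonzero residues modulo 2 r + 1, so the sum is a full
character sum without its term 1. -/
theorem sum_zs_odd (r : ℕ) (x : ℤ) :
    ∑ k ∈ Finset.Icc 1 r, zs (2 * r + 1) (k * x)
      = (2 * r + 1) * (if ((2 * r + 1 : ℕ) : ℤ) ∣ x then 1 else 0) - 1 := by
  have hn : 2 * r + 1 ≠ 0 := by omega
  split_ifs with h
  · simp only [zs_of_dvd hn (h.mul_left _)]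
    simp
    ring
  · set w := zeta (2 * r + 1) ^ x with hw
    have h1 : w ≠ 1 := fun h' => h (((isPrimitiveRoot_zeta hn).zpow_eq_one_iff_dvd x).1 h')
    have h0 : w ≠ 0 := zpow_ne_zero _ (zeta_ne_zero _)
    have hp : w ^ (r + 1) * w ^ r = 1 := by
      rw [← pow_add, hw, ← zpow_natCast, zpow_comm, zpow_natCast,
        show r + 1 + r = 2 * r + 1 by ring, (isPrimitiveRoot_zeta hn).pow_eq_one, one_zpow]
    simp only [zs_natCast_mul, ← hw]
    apply mul_left_cancel₀ (sub_ne_zero.2 h1)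
    rw [sub_one_mul_sum w h0, eq_inv_of_mul_eq_one_left hp]
    ring

theorem zeta_zpow_half (r : ℕ) (x : ℤ) : (zeta (2 * (r + 1)) ^ x) ^ (r + 1) = (-1) ^ x := by
  have hn : 2 * (r + 1) ≠ 0 := by omega
  have h : zeta (2 * (r + 1)) ^ (r + 1) = -1 :=
    ((isPrimitiveRoot_zeta hn).pow (by omega) (mul_comm _ _)).eq_neg_one_of_two_right
  rw [← zpow_natCast, zpow_comm, zpow_natCast, h]

theorem zs_half (r : ℕ) (x : ℤ) : zs (2 * (r + 1)) (((r + 1 : ℕ) : ℤ) * x) = 2 * (-1) ^ x := by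
  rw [zs_natCast_mul, zeta_zpow_half, ← inv_zpow]
  norm_num
  ring

theorem zs_mul_half (r : ℕ) (x : ℤ) :
    zs (2 * (r + 1)) (x * ((r + 1 : ℕ) : ℤ)) = 2 * (-1) ^ x := by
  rw [mul_comm x, zs_half]

/-- Here ±k with 1 ≤ k ≤ r also leaves out the residue r + 1, its own negative, whose term is
(-1)^x. -/
theorem sum_zs_even (r : ℕ) (x : ℤ) :
    ∑ k ∈ Finset.Icc 1 r, zs (2 * (r + 1)) (k * x)
      = 2 * (r + 1) * (if ((2 * (r + 1) : ℕ) : ℤ) ∣ x then 1 else 0) - 1 - (-1) ^ x := by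
  have hn : 2 * (r + 1) ≠ 0 := by omega
  split_ifs with h
  · simp only [zs_of_dvd hn (h.mul_left _)]
    have : Even x := by
      obtain ⟨y, rfl⟩ := h
      simp
    rw [this.neg_one_zpow]
    simp
    ring
  · rw [← zeta_zpow_half r x]
    set w := zeta (2 * (r + 1)) ^ x with hw
    have h1 : w ≠ 1 := fun h' => h (((isPrimitiveRoot_zeta hn).zpow_eq_one_iff_dvd x).1 h')
    have h0 : w ≠ 0 := zpow_ne_zero _ (zeta_ne_zero _)
    have hp : w ^ (r + 2) * w ^ r = 1 := by
      rw [← pow_add, hw, ← zpow_natCast, zpow_comm, zpow_natCast,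
        show r + 2 + r = 2 * (r + 1) by ring, (isPrimitiveRoot_zeta hn).pow_eq_one, one_zpow]
    simp only [zs_natCast_mul, ← hw]
    apply mul_left_cancel₀ (sub_ne_zero.2 h1)
    rw [sub_one_mul_sum w h0, ← eq_inv_of_mul_eq_one_left hp]
    ring

/-- `1` if `n` divides `x`, and `0` otherwise. -/
def divInd (n : ℕ) (x : ℤ) : ℕ := if (n : ℤ) ∣ x then 1 else 0

/-- The number of `n ∣ x ± y ± z`. -/
def signCount (n : ℕ) (x y z : ℤ) : ℕ :=
  divInd n (x + y + z) + divInd n (x + y - z) + divInd n (x - y + z) + divInd n (x - y - z)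

end InterpolatedPSL2

namespace InterpolatedPSL2

theorem divInd_of_dvd {n : ℕ} {x : ℤ} (h : (n : ℤ) ∣ x) : divInd n x = 1 := if_pos h

theorem divInd_of_not_dvd {n : ℕ} {x : ℤ} (h : ¬ (n : ℤ) ∣ x) : divInd n x = 0 := if_neg h

theorem divInd_congr {n : ℕ} {x y : ℤ} (h : (n : ℤ) ∣ x ↔ (n : ℤ) ∣ y) :
    divInd n x = divInd n y := by
  simp only [divInd, h]

theorem divInd_zero (n : ℕ) : divInd n 0 = 1 := divInd_of_dvd (dvd_zero _)

theorem divInd_eq_zero {n : ℕ} {x : ℤ} (h0 : 0 < x) (h1 : x < n) : divInd n x = 0 :=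
  divInd_of_not_dvd fun h => absurd (Int.le_of_dvd h0 h) (by omega)

theorem divInd_sub {n : ℕ} {x y : ℤ} (h1 : x - y < n) (h2 : y - x < n) :
    divInd n (x - y) = if x = y then 1 else 0 := by
  split_ifs with h
  · rw [h, sub_self, divInd_zero]
  · refine divInd_of_not_dvd fun hd => ?_
    rcases lt_or_gt_of_ne h with h3 | h3
    · exact absurd (Int.le_of_dvd (by omega) (dvd_neg.2 hd)) (by omega)
    · exact absurd (Int.le_of_dvd (by omega) hd) (by omega)

/-- If both a and b were divisible by n, then so would be t, which lies strictly between 0 and n. -/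
theorem divInd_add_le {n : ℕ} {a b t : ℤ} (hd : a - b = t ∨ b - a = t ∨ a + b = t)
    (h0 : 0 < t) (h1 : t < n) : divInd n a + divInd n b ≤ 1 := by
  by_cases ha : (n : ℤ) ∣ a
  · have hb : ¬ (n : ℤ) ∣ b := fun hb => by
      have ht : (n : ℤ) ∣ t := by
        rcases hd with rfl | rfl | rfl
        · exact dvd_sub ha hb
        · exact dvd_sub hb ha
        · exact dvd_add ha hb
      exact absurd (Int.le_of_dvd h0 ht) (by omega)
    rw [divInd_of_not_dvd hb, divInd]
    split_ifs <;> simp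
  · rw [divInd_of_not_dvd ha, divInd]
    split_ifs <;> simp

/-- For `0 < x, y, z < n / 2` at most one of the numbers `x ± y ± z` is divisible by `n`. -/
theorem signCount_le_one {n : ℕ} {x y z : ℤ} (hx : 0 < x) (hy : 0 < y) (hz : 0 < z)
    (hx' : 2 * x < n) (hy' : 2 * y < n) (hz' : 2 * z < n) : signCount n x y z ≤ 1 := by
  have h1 := divInd_add_le (n := n) (a := x + y + z) (b := x + y - z) (t := 2 * z)
    (by omega) (by omega) hz'
  have h2 := divInd_add_le (n := n) (a := x + y + z) (b := x - y + z) (t := 2 * y)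
    (by omega) (by omega) hy'
  have h3 := divInd_add_le (n := n) (a := x + y + z) (b := x - y - z) (t := 2 * x)
    (by omega) (by omega) hx'
  have h4 := divInd_add_le (n := n) (a := x + y - z) (b := x - y + z) (t := 2 * x)
    (by omega) (by omega) hx'
  have h5 := divInd_add_le (n := n) (a := x + y - z) (b := x - y - z) (t := 2 * y)
    (by omega) (by omega) hy'
  have h6 := divInd_add_le (n := n) (a := x - y + z) (b := x - y - z) (t := 2 * z)
    (by omega) (by omega) hz'
  simp only [signCount]
  omega

end InterpolatedPSL2

/-! ### The case of even q -/

namespace InterpolatedPSL2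

section Even

variable {q : ℕ}

/-- The class function with the given values on the groups of columns. -/
def evenFun (q : ℕ) (a b : ℂ) (f g : ℕ → ℂ) : EvenCol q → ℂ
  | .inl _ => a
  | .inr (.inl _) => b
  | .inr (.inr (.inl k)) => f k
  | .inr (.inr (.inr k)) => g k

theorem evenFun_mul (a b a' b' : ℂ) (f g f' g' : ℕ → ℂ) :
    evenFun q a b f g * evenFun q a' b' f' g' = evenFun q (a * a') (b * b') (f * f') (g * g') := by
  funext s
  rcases s with _ | _ | _ | _ <;> rfl

theorem evenFun_add (a b a' b' : ℂ) (f g f' g' : ℕ → ℂ) :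
    evenFun q a b f g + evenFun q a' b' f' g' = evenFun q (a + a') (b + b') (f + f') (g + g') := by
  funext s
  rcases s with _ | _ | _ | _ <;> rfl

theorem evenFun_sub (a b a' b' : ℂ) (f g f' g' : ℕ → ℂ) :
    evenFun q a b f g - evenFun q a' b' f' g' = evenFun q (a - a') (b - b') (f - f') (g - g') := by
  funext s
  rcases s with _ | _ | _ | _ <;> rfl

theorem evenFun_one : (1 : EvenCol q → ℂ) = evenFun q 1 1 1 1 := by
  funext s
  rcases s with _ | _ | _ | _ <;> rfl

/-- Inverse orders of the centralizers. -/
noncomputable def evenWeight (q : ℕ) : EvenCol q → ℂ :=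
  evenFun q (1 / (q * (q ^ 2 - 1))) (1 / q) (fun _ => 1 / (q - 1)) fun _ => 1 / (q + 1)

/-- The multiplicity of the trivial character. -/
noncomputable def evenMean (f : EvenCol q → ℂ) : ℂ := ∑ s, evenWeight q s * f s

theorem evenMean_add (f g : EvenCol q → ℂ) : evenMean (f + g) = evenMean f + evenMean g := by
  simp [evenMean, mul_add, Finset.sum_add_distrib]

theorem evenMean_sub (f g : EvenCol q → ℂ) : evenMean (f - g) = evenMean f - evenMean g := by
  simp [evenMean, mul_sub, Finset.sum_sub_distrib]

theorem evenMean_evenFun (a b : ℂ) (f g : ℕ → ℂ) :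
    evenMean (evenFun q a b f g) = a / (q * (q ^ 2 - 1)) + b / q
      + (∑ k ∈ Finset.Icc 1 ((q - 2) / 2), f k) / (q - 1)
      + (∑ k ∈ Finset.Icc 1 (q / 2), g k) / (q + 1) := by
  rw [← Finset.sum_coe_sort (Finset.Icc 1 ((q - 2) / 2)) f,
    ← Finset.sum_coe_sort (Finset.Icc 1 (q / 2)) g]
  simp only [evenMean, Fintype.sum_sum_type, evenWeight, evenFun, Finset.univ_unique,
    Finset.sum_const, Finset.card_singleton, one_smul, ← Finset.mul_sum]
  ring

/-- The virtual character of degree `q - 1` with parameter `x`. -/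
noncomputable def evenDisc (q : ℕ) (x : ℤ) : EvenCol q → ℂ :=
  evenFun q (q - 1) (-1) 0 fun k => -zs (q + 1) (k * x)

/-- The virtual character of degree `q + 1` with parameter `x`. -/
noncomputable def evenPrin (q : ℕ) (x : ℤ) : EvenCol q → ℂ :=
  evenFun q (q + 1) 1 (fun k => zs (q - 1) (k * x)) 0

/-- The Steinberg character. -/
noncomputable def evenSt (q : ℕ) : EvenCol q → ℂ := evenFun q q 0 1 (-1)

/-- The Gelfand-Graev character. -/
noncomputable def evenReg (q : ℕ) : EvenCol q → ℂ := evenFun q (q ^ 2 - 1) (-1) 0 0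

/-- Allowing every integer parameter keeps the rule uniform: x ± y may leave the range of the rows.
The degenerate members are `evenDisc q 0`, which is Steinberg minus trivial, and `evenPrin q 0`,
which is Steinberg plus trivial. -/
theorem evenDisc_mul_evenDisc (x y : ℤ) :
    evenDisc q x * evenDisc q y = evenReg q - evenDisc q (x + y) - evenDisc q (x - y) := by
  simp only [evenDisc, evenReg, evenFun_mul, evenFun_sub]
  congr 1
  · ring
  · ring
  · simp
  · funext k
    simp [zs_mul, mul_add, mul_sub]

theorem evenPrin_mul_evenPrin (x y : ℤ) :
    evenPrin q x * evenPrin q y = evenReg q + evenPrin q (x + y) + evenPrin q (x - y) := by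
  simp only [evenPrin, evenReg, evenFun_mul, evenFun_add]
  congr 1
  · ring
  · ring
  · funext k
    simp [zs_mul, mul_add, mul_sub]
  · simp

theorem evenDisc_mul_evenPrin (x y : ℤ) : evenDisc q x * evenPrin q y = evenReg q := by
  simp only [evenDisc, evenPrin, evenReg, evenFun_mul]
  congr 1
  · ring
  · ring
  · simp
  · simp

theorem evenSt_mul_evenDisc (x : ℤ) : evenSt q * evenDisc q x = evenReg q - evenDisc q x := by
  simp only [evenDisc, evenSt, evenReg, evenFun_mul, evenFun_sub]
  congr 1
  · ring
  · ring
  · simp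
  · funext k
    simp

theorem evenSt_mul_evenPrin (x : ℤ) : evenSt q * evenPrin q x = evenReg q + evenPrin q x := by
  simp only [evenPrin, evenSt, evenReg, evenFun_mul, evenFun_add]
  congr 1
  · ring
  · ring
  · simp
  · simp

theorem evenSt_mul_evenSt : evenSt q * evenSt q = evenReg q + 1 := by
  simp only [evenSt, evenReg, evenFun_mul, evenFun_add, evenFun_one]
  congr 1
  · ring
  · ring
  · simp
  · simp

theorem evenPrin_mul_evenDisc (x y : ℤ) : evenPrin q x * evenDisc q y = evenReg q := by
  rw [mul_comm, evenDisc_mul_evenPrin]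

theorem evenDisc_mul_evenSt (x : ℤ) : evenDisc q x * evenSt q = evenReg q - evenDisc q x := by
  rw [mul_comm, evenSt_mul_evenDisc]

theorem evenPrin_mul_evenSt (x : ℤ) : evenPrin q x * evenSt q = evenReg q + evenPrin q x := by
  rw [mul_comm, evenSt_mul_evenPrin]

theorem even_ne_zero (hq : 2 ≤ q) : (q : ℂ) ≠ 0 ∧ (q : ℂ) + 1 ≠ 0 ∧ (q : ℂ) - 1 ≠ 0 ∧
    (q : ℂ) ^ 2 - 1 ≠ 0 := by
  have h1 : (q : ℂ) ≠ 0 := by exact_mod_cast (by omega : q ≠ 0)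
  have h2 : (q : ℂ) + 1 ≠ 0 := by exact_mod_cast (by omega : q + 1 ≠ 0)
  have h3 : (q : ℂ) - 1 ≠ 0 := sub_ne_zero.2 (by exact_mod_cast (by omega : q ≠ 1))
  refine ⟨h1, h2, h3, ?_⟩
  rw [show (q : ℂ) ^ 2 - 1 = (q + 1) * (q - 1) by ring]
  exact mul_ne_zero h2 h3

/-- `evenReg` vanishes on both groups of semisimple columns, so only the values a and b enter. This
makes its multiplicity in each row independent of the parameter. -/
theorem evenMean_evenReg_mul (hq : 2 ≤ q) (a b : ℂ) (f g : ℕ → ℂ) :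
    evenMean (evenReg q * evenFun q a b f g) = (a - b) / q := by
  obtain ⟨h1, -, -, h2⟩ := even_ne_zero hq
  rw [evenReg, evenFun_mul, evenMean_evenFun]
  simp
  field_simp
  ring

theorem evenMean_evenReg_mul_evenDisc (hq : 2 ≤ q) (x : ℤ) :
    evenMean (evenReg q * evenDisc q x) = 1 := by
  rw [evenDisc, evenMean_evenReg_mul hq]
  field_simp [(even_ne_zero hq).1]
  ring

theorem evenMean_evenReg_mul_evenPrin (hq : 2 ≤ q) (x : ℤ) :
    evenMean (evenReg q * evenPrin q x) = 1 := by
  rw [evenPrin, evenMean_evenReg_mul hq]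
  field_simp [(even_ne_zero hq).1]
  ring

theorem evenMean_evenReg_mul_evenSt (hq : 2 ≤ q) : evenMean (evenReg q * evenSt q) = 1 := by
  rw [evenSt, evenMean_evenReg_mul hq]
  field_simp [(even_ne_zero hq).1]
  ring

theorem evenMean_evenReg (hq : 2 ≤ q) : evenMean (evenReg q) = 0 := by
  rw [← mul_one (evenReg q), evenFun_one, evenMean_evenReg_mul hq]
  simp

theorem natCast_half (h2 : q % 2 = 0) : ((q / 2 : ℕ) : ℂ) = q / 2 := by
  obtain ⟨u, rfl⟩ := Nat.dvd_of_mod_eq_zero h2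
  simp

theorem natCast_half_sub (hq : 2 ≤ q) (h2 : q % 2 = 0) : (((q - 2) / 2 : ℕ) : ℂ) = (q - 2) / 2 := by
  obtain ⟨u, rfl⟩ := Nat.dvd_of_mod_eq_zero h2
  obtain ⟨v, rfl⟩ : ∃ v, u = v + 1 := ⟨u - 1, by omega⟩
  rw [show (2 * (v + 1) - 2) / 2 = v by omega]
  push_cast
  ring

theorem evenMean_one (hq : 2 ≤ q) (h2 : q % 2 = 0) : evenMean (1 : EvenCol q → ℂ) = 1 := by
  obtain ⟨h3, h4, h5, h6⟩ := even_ne_zero hq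
  rw [evenFun_one, evenMean_evenFun]
  simp [natCast_half h2, natCast_half_sub hq h2]
  rw [show (q : ℂ) ^ 2 - 1 = (q + 1) * (q - 1) by ring]
  field_simp
  ring

theorem evenMean_evenSt (hq : 2 ≤ q) (h2 : q % 2 = 0) : evenMean (evenSt q) = 0 := by
  obtain ⟨h3, h4, h5, h6⟩ := even_ne_zero hq
  rw [evenSt, evenMean_evenFun]
  simp [natCast_half h2, natCast_half_sub hq h2]
  rw [show (q : ℂ) ^ 2 - 1 = (q + 1) * (q - 1) by ring]
  field_simp
  ring

/-- The trivial character occurs only for parameters divisible by q + 1, where the function is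
Steinberg minus trivial; hence the sign. -/
theorem evenMean_evenDisc (hq : 2 ≤ q) (h2 : q % 2 = 0) (x : ℤ) :
    evenMean (evenDisc q x) = -divInd (q + 1) x := by
  obtain ⟨h3, h4, h5, h6⟩ := even_ne_zero hq
  have h7 : ∑ k ∈ Finset.Icc 1 (q / 2), zs (q + 1) (k * x)
      = ((q : ℂ) + 1) * divInd (q + 1) x - 1 := by
    obtain ⟨u, rfl⟩ := Nat.dvd_of_mod_eq_zero h2
    rw [show 2 * u / 2 = u by omega, sum_zs_odd, divInd]
    push_cast
    rfl
  rw [evenDisc, evenMean_evenFun]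
  simp [h7]
  rw [show (q : ℂ) ^ 2 - 1 = (q + 1) * (q - 1) by ring]
  field_simp
  ring

theorem evenMean_evenPrin (hq : 2 ≤ q) (h2 : q % 2 = 0) (x : ℤ) :
    evenMean (evenPrin q x) = divInd (q - 1) x := by
  obtain ⟨h3, h4, h5, h6⟩ := even_ne_zero hq
  have h7 : ∑ k ∈ Finset.Icc 1 ((q - 2) / 2), zs (q - 1) (k * x)
      = ((q : ℂ) - 1) * divInd (q - 1) x - 1 := by
    obtain ⟨u, rfl⟩ := Nat.dvd_of_mod_eq_zero h2
    obtain ⟨v, rfl⟩ : ∃ v, u = v + 1 := ⟨u - 1, by omega⟩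
    rw [show (2 * (v + 1) - 2) / 2 = v by omega, show 2 * (v + 1) - 1 = 2 * v + 1 by omega,
      sum_zs_odd, divInd]
    push_cast
    ring
  rw [evenPrin, evenMean_evenFun]
  simp [h7]
  rw [show (q : ℂ) ^ 2 - 1 = (q + 1) * (q - 1) by ring]
  field_simp
  ring

/-- The multiplicity of the trivial character in a product of three rows. -/
def evenTriple (q : ℕ) : EvenRow q → EvenRow q → EvenRow q → ℕ
  | .inl _, j, k => if j = k then 1 else 0
  | i, .inl _, k => if i = k then 1 else 0
  | i, j, .inl _ => if i = j then 1 else 0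
  | .inr (.inl x), .inr (.inl y), .inr (.inl z) => 1 - signCount (q + 1) x y z
  | .inr (.inr (.inl _)), .inr (.inl x), .inr (.inl y) => if x = y then 0 else 1
  | .inr (.inl x), .inr (.inr (.inl _)), .inr (.inl y) => if x = y then 0 else 1
  | .inr (.inl x), .inr (.inl y), .inr (.inr (.inl _)) => if x = y then 0 else 1
  | .inr (.inr (.inr x)), .inr (.inr (.inr y)), .inr (.inr (.inr z)) =>
    1 + signCount (q - 1) x y z
  | .inr (.inr (.inl _)), .inr (.inr (.inr x)), .inr (.inr (.inr y)) => if x = y then 2 else 1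
  | .inr (.inr (.inr x)), .inr (.inr (.inl _)), .inr (.inr (.inr y)) => if x = y then 2 else 1
  | .inr (.inr (.inr x)), .inr (.inr (.inr y)), .inr (.inr (.inl _)) => if x = y then 2 else 1
  | _, _, _ => 1

theorem evenEntry_one (u : Unit) : evenEntry q (.inl u) = 1 := by
  funext s
  rcases s with _ | _ | _ | _ <;> rfl

theorem evenEntry_disc (x : Finset.Icc 1 (q / 2)) :
    evenEntry q (.inr (.inl x)) = evenDisc q (x : ℕ) := by
  funext s
  rcases s with _ | _ | _ | _ <;> simp [evenEntry, evenDisc, evenFun, zetaSum_eq]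

theorem evenEntry_st (u : Unit) : evenEntry q (.inr (.inr (.inl u))) = evenSt q := by
  funext s
  rcases s with _ | _ | _ | _ <;> simp [evenEntry, evenSt, evenFun]

theorem evenEntry_prin (x : Finset.Icc 1 ((q - 2) / 2)) :
    evenEntry q (.inr (.inr (.inr x))) = evenPrin q (x : ℕ) := by
  funext s
  rcases s with _ | _ | _ | _ <;> simp [evenEntry, evenPrin, evenFun, zetaSum_eq]

/-- The product rules reduce each triple product to a combination of known means. For parameters in
the range of the rows, the divisibility indicators that remain become equalities of parameters, or
the four terms of `signCount`. -/
theorem evenMean_triple (hq : 2 ≤ q) (h2 : q % 2 = 0) (i j k : EvenRow q) :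
    evenMean (evenEntry q i * evenEntry q j * evenEntry q k) = evenTriple q i j k := by
  have hD : ∀ x : Finset.Icc 1 (q / 2), 0 < (x : ℕ) ∧ 2 * (x : ℕ) < q + 1 := fun x => by
    have := Finset.mem_Icc.1 x.2
    omega
  have hP : ∀ x : Finset.Icc 1 ((q - 2) / 2), 0 < (x : ℕ) ∧ 2 * (x : ℕ) < q - 1 := fun x => by
    have := Finset.mem_Icc.1 x.2
    omega
  have hD0 : ∀ x : Finset.Icc 1 (q / 2), divInd (q + 1) (x : ℕ) = 0 := fun x => by
    have := hD x
    apply divInd_eq_zero <;> push_cast <;> omega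
  have hP0 : ∀ x : Finset.Icc 1 ((q - 2) / 2), divInd (q - 1) (x : ℕ) = 0 := fun x => by
    have := hP x
    apply divInd_eq_zero <;> omega
  have hDa : ∀ x y : Finset.Icc 1 (q / 2), divInd (q + 1) ((x : ℕ) + (y : ℕ)) = 0 := fun x y => by
    have := hD x
    have := hD y
    apply divInd_eq_zero <;> push_cast <;> omega
  have hPa : ∀ x y : Finset.Icc 1 ((q - 2) / 2), divInd (q - 1) ((x : ℕ) + (y : ℕ)) = 0 :=
    fun x y => by
      have := hP x
      have := hP y
      apply divInd_eq_zero <;> omega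
  have hDs : ∀ x y : Finset.Icc 1 (q / 2), divInd (q + 1) ((x : ℕ) - (y : ℕ))
      = if x = y then 1 else 0 := fun x y => by
    have := hD x
    have := hD y
    rw [divInd_sub (by push_cast; omega) (by push_cast; omega)]
    simp only [Nat.cast_inj, Subtype.ext_iff]
  have hPs : ∀ x y : Finset.Icc 1 ((q - 2) / 2), divInd (q - 1) ((x : ℕ) - (y : ℕ))
      = if x = y then 1 else 0 := fun x y => by
    have := hP x
    have := hP y
    rw [divInd_sub (by omega) (by omega)]
    simp only [Nat.cast_inj, Subtype.ext_iff]
  -- The subtraction in `evenTriple` is truncated; `signCount_le_one` ensures that nothing is lost,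
  -- that is, that the multiplicity is nonnegative.
  have hDc : ∀ x y z : Finset.Icc 1 (q / 2), ((1 - signCount (q + 1) (x : ℕ) (y : ℕ) (z : ℕ) : ℕ) : ℂ)
      = 1 - signCount (q + 1) (x : ℕ) (y : ℕ) (z : ℕ) :=
    fun x y z => by
      have := hD x
      have := hD y
      have := hD z
      rw [Nat.cast_sub, Nat.cast_one]
      apply signCount_le_one <;> push_cast <;> omega
  have t1 := evenMean_one hq h2
  have t2 := evenMean_evenSt hq h2
  have t3 := evenMean_evenReg hq
  have t4 := evenMean_evenDisc hq h2
  have t5 := evenMean_evenPrin hq h2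
  have t6 := evenMean_evenReg_mul_evenDisc hq
  have t7 := evenMean_evenReg_mul_evenPrin hq
  have t8 := evenMean_evenReg_mul_evenSt hq
  rcases i with _ | x | _ | x <;> rcases j with _ | y | _ | y <;> rcases k with _ | z | _ | z <;>
    simp only [evenEntry_one, evenEntry_disc, evenEntry_st, evenEntry_prin, one_mul, mul_one,
      evenDisc_mul_evenDisc, evenPrin_mul_evenPrin, evenDisc_mul_evenPrin, evenPrin_mul_evenDisc,
      evenDisc_mul_evenSt, evenSt_mul_evenDisc, evenPrin_mul_evenSt, evenSt_mul_evenPrin,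
      evenSt_mul_evenSt, add_mul, sub_mul, evenMean_add, evenMean_sub, t1, t2, t3, t4, t5, t6, t7,
      t8, evenTriple, hD0, hP0, hDa, hPa, hDs, hPs, hDc,
      reduceCtorEq, Sum.inl.injEq, Sum.inr.injEq, if_true, if_false, Nat.cast_ite, Nat.cast_add,
      Nat.cast_one, Nat.cast_zero, neg_zero, add_zero, sub_zero, sub_neg_eq_add, zero_add,
      sub_self] <;>
    (try split_ifs) <;> (try subst_vars) <;> first | rfl | (norm_num; done) |
      (simp only [signCount]; push_cast; ring)

noncomputable def evenData (hq : 2 ≤ q) (h2 : q % 2 = 0) :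
    TripleData (evenEntry q) (evenTriple q) (.inl ()) id where
  weight := evenWeight q
  card_eq := by
    simp only [Fintype.card_sum, Fintype.card_unit]
    omega
  row_one s := congrFun (evenEntry_one ()) s
  triple := evenMean_triple hq h2
  pairing i j := by
    rcases i with _ | _ | _ | _ <;> rcases j with _ | _ | _ | _ <;> simp [evenTriple, eq_comm]
  dual_triple _ _ _ := rfl

/-- The Gelfand-Graev part of the product contains the row of degree q + 1, and no correction term
removes it. -/
theorem evenTriple_prin_pos {i j : EvenRow q} (hi : i ≠ .inl ()) (hj : j ≠ .inl ())
    (x : Finset.Icc 1 ((q - 2) / 2)) : 1 ≤ evenTriple q i j (.inr (.inr (.inr x))) := by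
  rcases i with _ | _ | _ | _ <;> rcases j with _ | _ | _ | _ <;>
    first
      | exact absurd rfl hi
      | exact absurd rfl hj
      | (simp only [evenTriple]; (try split_ifs) <;> simp)

theorem even_passes (hq : 6 ≤ q) (h2 : q % 2 = 0) {R : FusionRing (EvenRow q)}
    (hR : R.IsEigentable (evenEntry q)) : R.PassesOneSpectrumCriterion := by
  have d := evenData (by omega) h2
  rw [d.eq_toFusionRing hR]
  intro i₀ i₁ i₂ i₃ i₄ i₅ i₆ i₇ i₈ i₉ h
  obtain ⟨h4, h5, h6, h7, h8, h9⟩ := h.ne_one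
  have hs := h.2.1
  have hx : ∀ x : Finset.Icc 1 ((q - 2) / 2), 1 ≤ d.toFusionRing.N i₄ i₇ (.inr (.inr (.inr x))) *
      d.toFusionRing.N i₅ i₈ (.inr (.inr (.inr x))) *
      d.toFusionRing.N i₆ i₉ (.inr (.inr (.inr x))) := fun x =>
    Nat.mul_pos (Nat.mul_pos (evenTriple_prin_pos h4 h7 x) (evenTriple_prin_pos h5 h8 x))
      (evenTriple_prin_pos h6 h9 x)
  -- Two rows of degree q + 1 exist exactly because q ≥ 6; both contribute to the sum that should be
  -- 1.
  have h1 := hx ⟨1, by simp; omega⟩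
  have h2 := hx ⟨2, by simp; omega⟩
  have h3 := Finset.sum_le_sum_of_subset (f := fun k => d.toFusionRing.N i₄ i₇ k *
      d.toFusionRing.N i₅ i₈ k * d.toFusionRing.N i₆ i₉ k)
    (Finset.subset_univ {(.inr (.inr (.inr ⟨1, by simp; omega⟩)) : EvenRow q),
      .inr (.inr (.inr ⟨2, by simp; omega⟩))})
  rw [Finset.sum_pair (by simp)] at h3
  exact absurd (hs ▸ h3) (by omega)

end Even

end InterpolatedPSL2

/-! ### The case q ≡ 3 mod 4: class functions and their means -/

namespace InterpolatedPSL2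

/-- Shifts by k times half the period in the two directions agree, so the product formula for t and
that shift gives twice the shifted value. Multiplication by the sign (-1)^k therefore acts on the
parameter as a shift by half a period. -/
theorem zs_add_half (r k : ℕ) (t : ℤ) :
    zs (2 * (r + 1)) (t + k * ((r + 1 : ℕ) : ℤ)) = (-1) ^ k * zs (2 * (r + 1)) t := by
  have h := zs_mul (2 * (r + 1)) t (k * ((r + 1 : ℕ) : ℤ))
  have h2 : zs (2 * (r + 1)) (t - k * ((r + 1 : ℕ) : ℤ))
      = zs (2 * (r + 1)) (t + k * ((r + 1 : ℕ) : ℤ)) := by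
    simp only [zs]
    have h3 := zeta_ne_zero (2 * (r + 1))
    have h4 : zeta (2 * (r + 1)) ^ (-(k * ((r + 1 : ℕ) : ℤ)))
        = zeta (2 * (r + 1)) ^ (k * ((r + 1 : ℕ) : ℤ)) := by
      have h5 : (zeta (2 * (r + 1)) ^ (k : ℤ)) ^ (r + 1) = (-1) ^ (k : ℤ) := zeta_zpow_half r k
      rw [zpow_neg, zpow_mul, zpow_natCast _ (r + 1), h5, ← inv_zpow]
      norm_num
    rw [neg_sub, neg_add, sub_eq_add_neg, sub_eq_add_neg, zpow_add₀ h3, zpow_add₀ h3, zpow_add₀ h3,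
      zpow_add₀ h3, h4]
    ring
  rw [h2, zs_mul_half, zpow_natCast] at h
  linear_combination -h / 2

theorem sqrt_natCast_sq (q : ℕ) : ((Real.sqrt q : ℝ) : ℂ) ^ 2 = q := by
  rw [← Complex.ofReal_pow, Real.sq_sqrt (Nat.cast_nonneg q), Complex.ofReal_natCast]

theorem neg_one_pow_add_ite (a b : Finset.Icc 1 2) :
    (1 + (-1 : ℂ) ^ ((a : ℕ) + (b : ℕ))) / 2 = if a = b then 1 else 0 := by
  obtain ⟨a, ha⟩ := a
  obtain ⟨b, hb⟩ := b
  rw [Finset.mem_Icc] at ha hb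
  obtain rfl | rfl : a = 1 ∨ a = 2 := by omega
  all_goals
    obtain rfl | rfl : b = 1 ∨ b = 2 := by omega
    all_goals norm_num

section Three

variable {q : ℕ}

/-- The class function with the given values on the groups of columns. -/
def threeFun (q : ℕ) (a : ℂ) (b f g : ℕ → ℂ) : ThreeCol q → ℂ
  | .inl _ => a
  | .inr (.inl k) => b k
  | .inr (.inr (.inl k)) => f k
  | .inr (.inr (.inr (.inl k))) => g k
  | .inr (.inr (.inr (.inr _))) => g ((q + 1) / 4)

theorem threeFun_mul (a a' : ℂ) (b f g b' f' g' : ℕ → ℂ) :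
    threeFun q a b f g * threeFun q a' b' f' g'
      = threeFun q (a * a') (b * b') (f * f') (g * g') := by
  funext s
  rcases s with _ | _ | _ | _ | _ <;> rfl

theorem threeFun_add (a a' : ℂ) (b f g b' f' g' : ℕ → ℂ) :
    threeFun q a b f g + threeFun q a' b' f' g'
      = threeFun q (a + a') (b + b') (f + f') (g + g') := by
  funext s
  rcases s with _ | _ | _ | _ | _ <;> rfl

theorem threeFun_sub (a a' : ℂ) (b f g b' f' g' : ℕ → ℂ) :
    threeFun q a b f g - threeFun q a' b' f' g'
      = threeFun q (a - a') (b - b') (f - f') (g - g') := by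
  funext s
  rcases s with _ | _ | _ | _ | _ <;> rfl

theorem threeFun_one : (1 : ThreeCol q → ℂ) = threeFun q 1 1 1 1 := by
  funext s
  rcases s with _ | _ | _ | _ | _ <;> rfl

/-- Inverse orders of the centralizers. -/
noncomputable def threeWeight (q : ℕ) : ThreeCol q → ℂ
  | .inl _ => 2 / (q * (q ^ 2 - 1))
  | .inr (.inl _) => 1 / q
  | .inr (.inr (.inl _)) => 2 / (q - 1)
  | .inr (.inr (.inr (.inl _))) => 2 / (q + 1)
  | .inr (.inr (.inr (.inr _))) => 1 / (q + 1)

/-- The multiplicity of the trivial character. -/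
noncomputable def threeMean (f : ThreeCol q → ℂ) : ℂ := ∑ s, threeWeight q s * f s

theorem threeMean_add (f g : ThreeCol q → ℂ) : threeMean (f + g) = threeMean f + threeMean g := by
  simp [threeMean, mul_add, Finset.sum_add_distrib]

theorem threeMean_sub (f g : ThreeCol q → ℂ) : threeMean (f - g) = threeMean f - threeMean g := by
  simp [threeMean, mul_sub, Finset.sum_sub_distrib]

/-- The parameter (q + 1)/4 is its own negative modulo (q + 1)/2, so its column has half the weight
of the others in its family. The bracket over q + 1 is then a sum over all nonzero residues when g
is even and periodic. -/
theorem threeMean_threeFun (a : ℂ) (b f g : ℕ → ℂ) :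
    threeMean (threeFun q a b f g) = 2 * a / (q * (q ^ 2 - 1)) + (b 1 + b 2) / q
      + 2 * (∑ k ∈ Finset.Icc 1 ((q - 3) / 4), f k) / (q - 1)
      + (2 * (∑ k ∈ Finset.Icc 1 ((q - 3) / 4), g k) + g ((q + 1) / 4)) / (q + 1) := by
  have h : b 1 + b 2 = ∑ k ∈ Finset.Icc 1 2, b k := by
    rw [Finset.sum_Icc_succ_top (by omega), Finset.Icc_self, Finset.sum_singleton]
  rw [h, ← Finset.sum_coe_sort (Finset.Icc 1 2) b,
    ← Finset.sum_coe_sort (Finset.Icc 1 ((q - 3) / 4)) f,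
    ← Finset.sum_coe_sort (Finset.Icc 1 ((q - 3) / 4)) g]
  simp only [threeMean, Fintype.sum_sum_type, threeWeight, threeFun, Finset.univ_unique,
    Finset.sum_const, Finset.card_singleton, one_smul, ← Finset.mul_sum]
  ring

/-- The virtual character of degree `q - 1` with parameter `x`. -/
noncomputable def threeDisc (q : ℕ) (x : ℤ) : ThreeCol q → ℂ :=
  threeFun q (q - 1) (-1) 0 fun k => -zs ((q + 1) / 2) (k * x)

/-- The virtual character of degree `q + 1` with parameter `x`. -/
noncomputable def threePrin (q : ℕ) (x : ℤ) : ThreeCol q → ℂ :=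
  threeFun q (q + 1) 1 (fun k => zs ((q - 1) / 2) (k * x)) 0

/-- The Steinberg character. -/
noncomputable def threeSt (q : ℕ) : ThreeCol q → ℂ := threeFun q q 0 1 (-1)

/-- The sum of the two Gelfand-Graev characters. -/
noncomputable def threeReg (q : ℕ) : ThreeCol q → ℂ := threeFun q (q ^ 2 - 1) (-1) 0 0

/-- The values of the characters of degree `(q - 1) / 2` on unipotent elements. -/
noncomputable def threeGauss (q c k : ℕ) : ℂ :=
  (-1 + Complex.I * (-1) ^ (k + c) * (Real.sqrt q : ℂ)) / 2

/-- The characters of degree `(q - 1) / 2`. -/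
noncomputable def threeHalf (q c : ℕ) : ThreeCol q → ℂ :=
  threeFun q ((q - 1) / 2) (threeGauss q c) 0 fun k => (-1) ^ (k + 1)

/-- The Gelfand-Graev characters. -/
noncomputable def threeHalfReg (q c : ℕ) : ThreeCol q → ℂ :=
  threeFun q ((q ^ 2 - 1) / 2) (threeGauss q c) 0 0

theorem threeDisc_mul_threeDisc (x y : ℤ) :
    threeDisc q x * threeDisc q y = threeReg q - threeDisc q (x + y) - threeDisc q (x - y) := by
  simp only [threeDisc, threeReg, threeFun_mul, threeFun_sub]
  congr 1
  · ring
  · ring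
  · simp
  · funext k
    simp [zs_mul, mul_add, mul_sub]

theorem threePrin_mul_threePrin (x y : ℤ) :
    threePrin q x * threePrin q y = threeReg q + threePrin q (x + y) + threePrin q (x - y) := by
  simp only [threePrin, threeReg, threeFun_mul, threeFun_add]
  congr 1
  · ring
  · ring
  · funext k
    simp [zs_mul, mul_add, mul_sub]
  · simp

theorem threeDisc_mul_threePrin (x y : ℤ) : threeDisc q x * threePrin q y = threeReg q := by
  simp only [threeDisc, threePrin, threeReg, threeFun_mul]
  congr 1
  · ring
  · ring
  · simp
  · simp

theorem threeSt_mul_threeDisc (x : ℤ) : threeSt q * threeDisc q x = threeReg q - threeDisc q x := by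
  simp only [threeDisc, threeSt, threeReg, threeFun_mul, threeFun_sub]
  congr 1
  · ring
  · ring
  · simp
  · funext k
    simp

theorem threeSt_mul_threePrin (x : ℤ) : threeSt q * threePrin q x = threeReg q + threePrin q x := by
  simp only [threePrin, threeSt, threeReg, threeFun_mul, threeFun_add]
  congr 1
  · ring
  · ring
  · simp
  · simp

theorem threeSt_mul_threeSt : threeSt q * threeSt q = threeReg q + 1 := by
  simp only [threeSt, threeReg, threeFun_mul, threeFun_add, threeFun_one]
  congr 1
  · ring
  · ring
  · simp
  · simp

theorem threePrin_mul_threeDisc (x y : ℤ) : threePrin q x * threeDisc q y = threeReg q := by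
  rw [mul_comm, threeDisc_mul_threePrin]

theorem threeDisc_mul_threeSt (x : ℤ) : threeDisc q x * threeSt q = threeReg q - threeDisc q x := by
  rw [mul_comm, threeSt_mul_threeDisc]

theorem threePrin_mul_threeSt (x : ℤ) : threePrin q x * threeSt q = threeReg q + threePrin q x := by
  rw [mul_comm, threeSt_mul_threePrin]

/-- On the last columns the row of half degree is a sign, which shifts the parameter by half a
period. On unipotent columns the factor -1 exchanges the two Gauss values up to a constant, whence c
+ 1; only the parity of this index matters. -/
theorem threeHalf_mul_threeDisc (h4 : q % 4 = 3) (c : ℕ) (x : ℤ) :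
    threeHalf q c * threeDisc q x
      = threeHalfReg q (c + 1) - threeDisc q (x + ((q + 1) / 4 : ℕ)) := by
  simp only [threeHalf, threeDisc, threeHalfReg, threeFun_mul, threeFun_sub]
  congr 1
  · ring
  · funext k
    simp only [threeGauss, Pi.mul_apply, Pi.neg_apply, Pi.one_apply, Pi.sub_apply, ← add_assoc,
      pow_succ]
    ring
  · simp
  · obtain ⟨r, rfl⟩ : ∃ r, q = 4 * r + 3 := ⟨q / 4, by omega⟩
    funext k
    rw [show (4 * r + 3 + 1) / 2 = 2 * (r + 1) by omega,
      show (4 * r + 3 + 1) / 4 = r + 1 by omega]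
    simp only [Pi.mul_apply, Pi.sub_apply, Pi.zero_apply]
    rw [mul_add (k : ℤ), zs_add_half, pow_succ]
    ring

theorem threeHalf_mul_threePrin (c : ℕ) (x : ℤ) :
    threeHalf q c * threePrin q x = threeHalfReg q c := by
  simp only [threeHalf, threePrin, threeHalfReg, threeFun_mul]
  congr 1
  · ring
  · simp
  · simp
  · simp

theorem threeHalf_mul_threeSt (c : ℕ) :
    threeHalf q c * threeSt q = threeHalfReg q c - threeHalf q c := by
  simp only [threeHalf, threeSt, threeHalfReg, threeFun_mul, threeFun_sub]
  congr 1
  · ring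
  · simp
  · simp
  · funext k
    simp

theorem threeDisc_mul_threeHalf (h4 : q % 4 = 3) (c : ℕ) (x : ℤ) :
    threeDisc q x * threeHalf q c
      = threeHalfReg q (c + 1) - threeDisc q (x + ((q + 1) / 4 : ℕ)) := by
  rw [mul_comm, threeHalf_mul_threeDisc h4]

theorem threePrin_mul_threeHalf (c : ℕ) (x : ℤ) :
    threePrin q x * threeHalf q c = threeHalfReg q c := by
  rw [mul_comm, threeHalf_mul_threePrin]

theorem threeSt_mul_threeHalf (c : ℕ) :
    threeSt q * threeHalf q c = threeHalfReg q c - threeHalf q c := by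
  rw [mul_comm, threeHalf_mul_threeSt]

theorem threeMean_threeReg_mul (hq : 2 ≤ q) (a : ℂ) (b f g : ℕ → ℂ) :
    threeMean (threeReg q * threeFun q a b f g) = (2 * a - b 1 - b 2) / q := by
  obtain ⟨h1, -, -, h2⟩ := even_ne_zero hq
  rw [threeReg, threeFun_mul, threeMean_threeFun]
  simp
  field_simp
  ring

theorem threeMean_threeReg_mul_threeDisc (hq : 2 ≤ q) (x : ℤ) :
    threeMean (threeReg q * threeDisc q x) = 2 := by
  rw [threeDisc, threeMean_threeReg_mul hq]
  simp only [Pi.neg_apply, Pi.one_apply]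
  field_simp [(even_ne_zero hq).1]
  ring

theorem threeMean_threeReg_mul_threePrin (hq : 2 ≤ q) (x : ℤ) :
    threeMean (threeReg q * threePrin q x) = 2 := by
  rw [threePrin, threeMean_threeReg_mul hq]
  simp only [Pi.one_apply]
  field_simp [(even_ne_zero hq).1]
  ring

theorem threeMean_threeReg_mul_threeSt (hq : 2 ≤ q) :
    threeMean (threeReg q * threeSt q) = 2 := by
  rw [threeSt, threeMean_threeReg_mul hq]
  simp only [Pi.zero_apply]
  field_simp [(even_ne_zero hq).1]
  ring

theorem threeMean_threeReg_mul_threeHalf (hq : 2 ≤ q) (c : ℕ) :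
    threeMean (threeReg q * threeHalf q c) = 1 := by
  rw [threeHalf, threeMean_threeReg_mul hq]
  simp only [threeGauss, pow_add]
  field_simp [(even_ne_zero hq).1]
  ring

theorem threeMean_threeReg (hq : 2 ≤ q) : threeMean (threeReg q) = 0 := by
  rw [← mul_one (threeReg q), threeFun_one, threeMean_threeReg_mul hq]
  simp only [Pi.one_apply]
  ring

theorem threeMean_threeHalfReg_mul (hq : 2 ≤ q) (c : ℕ) (a : ℂ) (b f g : ℕ → ℂ) :
    threeMean (threeHalfReg q c * threeFun q a b f g)
      = (a + threeGauss q c 1 * b 1 + threeGauss q c 2 * b 2) / q := by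
  obtain ⟨h1, -, -, h2⟩ := even_ne_zero hq
  rw [threeHalfReg, threeFun_mul, threeMean_threeFun]
  simp
  field_simp
  ring

theorem threeMean_threeHalfReg_mul_threeDisc (hq : 2 ≤ q) (c : ℕ) (x : ℤ) :
    threeMean (threeHalfReg q c * threeDisc q x) = 1 := by
  rw [threeDisc, threeMean_threeHalfReg_mul hq]
  simp only [threeGauss, Pi.neg_apply, Pi.one_apply, pow_add]
  field_simp [(even_ne_zero hq).1]
  ring

theorem threeMean_threeHalfReg_mul_threePrin (hq : 2 ≤ q) (c : ℕ) (x : ℤ) :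
    threeMean (threeHalfReg q c * threePrin q x) = 1 := by
  rw [threePrin, threeMean_threeHalfReg_mul hq]
  simp only [threeGauss, Pi.one_apply, pow_add]
  field_simp [(even_ne_zero hq).1]
  ring

theorem threeMean_threeHalfReg_mul_threeSt (hq : 2 ≤ q) (c : ℕ) :
    threeMean (threeHalfReg q c * threeSt q) = 1 := by
  rw [threeSt, threeMean_threeHalfReg_mul hq]
  simp only [Pi.zero_apply]
  field_simp [(even_ne_zero hq).1]
  ring

theorem threeMean_threeHalfReg (hq : 2 ≤ q) (c : ℕ) : threeMean (threeHalfReg q c) = 0 := by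
  rw [← mul_one (threeHalfReg q c), threeFun_one, threeMean_threeHalfReg_mul hq]
  simp only [threeGauss, Pi.one_apply, pow_add]
  ring

/-- The two unipotent columns carry opposite signs of √q, so odd powers of √q cancel; the square of
i √q contributes -q. -/
theorem threeGauss_mul (q a b : ℕ) :
    threeGauss q a 1 * threeGauss q b 1 + threeGauss q a 2 * threeGauss q b 2
      = (1 - (-1) ^ (a + b) * q) / 2 := by
  have hs := sqrt_natCast_sq q
  simp only [threeGauss, pow_add]
  linear_combination (-1) ^ a * (-1) ^ b * Complex.I ^ 2 / 2 * hs
    + (-1) ^ a * (-1) ^ b * q / 2 * Complex.I_sq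

theorem threeGauss_mul_mul (q a b c : ℕ) :
    threeGauss q a 1 * threeGauss q b 1 * threeGauss q c 1
        + threeGauss q a 2 * threeGauss q b 2 * threeGauss q c 2
      = (-1 + ((-1) ^ (a + b) + (-1) ^ (a + c) + (-1) ^ (b + c)) * q) / 4 := by
  have hs := sqrt_natCast_sq q
  simp only [threeGauss, pow_add]
  linear_combination -((-1) ^ a * (-1) ^ b + (-1) ^ a * (-1) ^ c + (-1) ^ b * (-1) ^ c)
      * Complex.I ^ 2 / 4 * hs
    - ((-1) ^ a * (-1) ^ b + (-1) ^ a * (-1) ^ c + (-1) ^ b * (-1) ^ c) * q / 4 * Complex.I_sq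

/-- Nonzero exactly for indices of different parity: the rows of half degree are complex conjugates
of each other, so pairing without conjugation with one detects the other. -/
theorem threeMean_threeHalfReg_mul_threeHalf (hq : 2 ≤ q) (c c' : ℕ) :
    threeMean (threeHalfReg q c * threeHalf q c') = (1 - (-1) ^ (c + c')) / 2 := by
  rw [threeHalf, threeMean_threeHalfReg_mul hq, add_assoc, threeGauss_mul]
  field_simp [(even_ne_zero hq).1]
  ring

theorem two_mul_sum_neg_one_pow (r : ℕ) :
    2 * ∑ k ∈ Finset.Icc 1 r, (-1 : ℂ) ^ (k + 1) + (-1) ^ r = 1 := by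
  induction r with
  | zero => simp
  | succ r ih =>
    rw [Finset.sum_Icc_succ_top (by omega)]
    simp only [pow_succ] at ih ⊢
    linear_combination ih

theorem natCast_threeQuarter (h4 : q % 4 = 3) : (((q - 3) / 4 : ℕ) : ℂ) = (q - 3) / 4 := by
  obtain ⟨r, rfl⟩ : ∃ r, q = 4 * r + 3 := ⟨q / 4, by omega⟩
  rw [show (4 * r + 3 - 3) / 4 = r by omega]
  push_cast
  ring

theorem three_two_le (h4 : q % 4 = 3) : 2 ≤ q := by omega

theorem threeMean_one (h4 : q % 4 = 3) : threeMean (1 : ThreeCol q → ℂ) = 1 := by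
  obtain ⟨h1, h2, h3, h5⟩ := even_ne_zero (three_two_le h4)
  rw [threeFun_one, threeMean_threeFun]
  simp [natCast_threeQuarter h4]
  rw [show (q : ℂ) ^ 2 - 1 = (q + 1) * (q - 1) by ring]
  field_simp
  ring

theorem threeMean_threeSt (h4 : q % 4 = 3) : threeMean (threeSt q) = 0 := by
  obtain ⟨h1, h2, h3, h5⟩ := even_ne_zero (three_two_le h4)
  rw [threeSt, threeMean_threeFun]
  simp [natCast_threeQuarter h4]
  rw [show (q : ℂ) ^ 2 - 1 = (q + 1) * (q - 1) by ring]
  field_simp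
  ring

theorem threeMean_threeDisc (h4 : q % 4 = 3) (x : ℤ) :
    threeMean (threeDisc q x) = -divInd ((q + 1) / 2) x := by
  obtain ⟨h1, h2, h3, h5⟩ := even_ne_zero (three_two_le h4)
  -- The terms (-1)^x of this sum, taken twice, cancel against the value `h8` in the column of
  -- parameter (q + 1)/4.
  have h7 : ∑ k ∈ Finset.Icc 1 ((q - 3) / 4), zs ((q + 1) / 2) (k * x)
      = ((q : ℂ) + 1) / 2 * divInd ((q + 1) / 2) x - 1 - (-1) ^ x := by
    obtain ⟨r, rfl⟩ : ∃ r, q = 4 * r + 3 := ⟨q / 4, by omega⟩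
    rw [show (4 * r + 3 - 3) / 4 = r by omega, show (4 * r + 3 + 1) / 2 = 2 * (r + 1) by omega,
      sum_zs_even, divInd]
    push_cast
    ring
  have h8 : zs ((q + 1) / 2) (((q + 1) / 4 : ℕ) * x) = 2 * (-1) ^ x := by
    obtain ⟨r, rfl⟩ : ∃ r, q = 4 * r + 3 := ⟨q / 4, by omega⟩
    rw [show (4 * r + 3 + 1) / 2 = 2 * (r + 1) by omega, show (4 * r + 3 + 1) / 4 = r + 1 by omega,
      zs_half]
  rw [threeDisc, threeMean_threeFun]
  simp only [Finset.sum_neg_distrib, h7, h8, Pi.zero_apply, Pi.neg_apply, Pi.one_apply,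
    Finset.sum_const_zero]
  rw [show (q : ℂ) ^ 2 - 1 = (q + 1) * (q - 1) by ring]
  field_simp
  ring

theorem threeMean_threePrin (h4 : q % 4 = 3) (x : ℤ) :
    threeMean (threePrin q x) = divInd ((q - 1) / 2) x := by
  obtain ⟨h1, h2, h3, h5⟩ := even_ne_zero (three_two_le h4)
  have h7 : ∑ k ∈ Finset.Icc 1 ((q - 3) / 4), zs ((q - 1) / 2) (k * x)
      = ((q : ℂ) - 1) / 2 * divInd ((q - 1) / 2) x - 1 := by
    obtain ⟨r, rfl⟩ : ∃ r, q = 4 * r + 3 := ⟨q / 4, by omega⟩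
    rw [show (4 * r + 3 - 3) / 4 = r by omega, show (4 * r + 3 - 1) / 2 = 2 * r + 1 by omega,
      sum_zs_odd, divInd]
    push_cast
    ring
  rw [threePrin, threeMean_threeFun]
  simp only [h7, Pi.zero_apply, Pi.one_apply, Finset.sum_const_zero]
  rw [show (q : ℂ) ^ 2 - 1 = (q + 1) * (q - 1) by ring]
  field_simp
  ring

theorem two_mul_sum_neg_one_pow_three (h4 : q % 4 = 3) :
    2 * (∑ k ∈ Finset.Icc 1 ((q - 3) / 4), (-1 : ℂ) ^ (k + 1)) + (-1) ^ ((q + 1) / 4 + 1) = 1 := by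
  rw [show (q + 1) / 4 + 1 = (q - 3) / 4 + 2 by omega, pow_add, neg_one_sq, mul_one,
    two_mul_sum_neg_one_pow]

theorem threeMean_threeHalf (h4 : q % 4 = 3) (c : ℕ) : threeMean (threeHalf q c) = 0 := by
  obtain ⟨h1, h2, h3, h5⟩ := even_ne_zero (three_two_le h4)
  rw [threeHalf, threeMean_threeFun, two_mul_sum_neg_one_pow_three h4]
  simp only [threeGauss, pow_add, Pi.zero_apply, Finset.sum_const_zero]
  rw [show (q : ℂ) ^ 2 - 1 = (q + 1) * (q - 1) by ring]
  field_simp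
  ring

theorem threeMean_threeHalf_mul_threeHalf (h4 : q % 4 = 3) (c c' : ℕ) :
    threeMean (threeHalf q c * threeHalf q c') = (1 - (-1) ^ (c + c')) / 2 := by
  obtain ⟨h1, h2, h3, h5⟩ := even_ne_zero (three_two_le h4)
  have h7 : ∀ k : ℕ, (-1 : ℂ) ^ (k + 1) * (-1) ^ (k + 1) = 1 := fun k => by
    rw [← mul_pow]
    norm_num
  rw [threeHalf, threeHalf, threeFun_mul, threeMean_threeFun]
  simp only [Pi.mul_apply, h7, threeGauss_mul, Pi.zero_apply, Finset.sum_const_zero,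
    mul_zero, Finset.sum_const, Nat.card_Icc, nsmul_eq_mul, Nat.add_sub_cancel,
    natCast_threeQuarter h4]
  rw [show (q : ℂ) ^ 2 - 1 = (q + 1) * (q - 1) by ring]
  field_simp
  ring

theorem threeMean_threeHalf_mul_threeHalf_mul_threeHalf (h4 : q % 4 = 3) (a b c : ℕ) :
    threeMean (threeHalf q a * threeHalf q b * threeHalf q c)
      = (1 + (-1) ^ (a + b) + (-1) ^ (a + c) + (-1) ^ (b + c)) / 4 := by
  obtain ⟨h1, h2, h3, h5⟩ := even_ne_zero (three_two_le h4)
  have h7 : ∀ k : ℕ, (-1 : ℂ) ^ (k + 1) * (-1) ^ (k + 1) * (-1) ^ (k + 1) = (-1) ^ (k + 1) :=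
    fun k => by
      rw [← mul_pow]
      norm_num
  rw [threeHalf, threeHalf, threeHalf, threeFun_mul, threeFun_mul, threeMean_threeFun]
  simp only [Pi.mul_apply, h7, two_mul_sum_neg_one_pow_three h4, Pi.zero_apply,
    Finset.sum_const_zero, mul_zero, threeGauss_mul_mul]
  rw [show (q : ℂ) ^ 2 - 1 = (q + 1) * (q - 1) by ring]
  field_simp
  ring

end Three

end InterpolatedPSL2

/-! ### The case q ≡ 3 mod 4: the triple multiplicities -/

namespace InterpolatedPSL2

section Three

variable {q : ℕ}

/-- Complex conjugation of the rows. -/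
def threeDual (q : ℕ) : ThreeRow q → ThreeRow q
  | .inr (.inl a) => .inr (.inl ⟨3 - a, by have := Finset.mem_Icc.1 a.2; simp; omega⟩)
  | i => i

/-- The multiplicity of the trivial character in a product of three rows. -/
def threeTriple (q : ℕ) : ThreeRow q → ThreeRow q → ThreeRow q → ℕ
  | .inl _, .inr (.inl a), .inr (.inl b) => if a = b then 0 else 1
  | .inr (.inl a), .inl _, .inr (.inl b) => if a = b then 0 else 1
  | .inr (.inl a), .inr (.inl b), .inl _ => if a = b then 0 else 1
  | .inl _, j, k => if j = k then 1 else 0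
  | i, .inl _, k => if i = k then 1 else 0
  | i, j, .inl _ => if i = j then 1 else 0
  | .inr (.inl a), .inr (.inl b), .inr (.inl c) => if a = b ∧ a = c then 1 else 0
  | .inr (.inl a), .inr (.inl b), .inr (.inr (.inl _)) => if a = b then 1 else 0
  | .inr (.inl a), .inr (.inr (.inl _)), .inr (.inl b) => if a = b then 1 else 0
  | .inr (.inr (.inl _)), .inr (.inl a), .inr (.inl b) => if a = b then 1 else 0
  | .inr (.inl _), .inr (.inl _), .inr (.inr (.inr (.inl _))) => 0
  | .inr (.inl _), .inr (.inr (.inr (.inl _))), .inr (.inl _) => 0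
  | .inr (.inr (.inr (.inl _))), .inr (.inl _), .inr (.inl _) => 0
  | .inr (.inl a), .inr (.inl b), .inr (.inr (.inr (.inr _))) => if a = b then 0 else 1
  | .inr (.inl a), .inr (.inr (.inr (.inr _))), .inr (.inl b) => if a = b then 0 else 1
  | .inr (.inr (.inr (.inr _))), .inr (.inl a), .inr (.inl b) => if a = b then 0 else 1
  | .inr (.inl _), .inr (.inr (.inl x)), .inr (.inr (.inl y)) =>
    if (x : ℕ) + (y : ℕ) = (q + 1) / 4 then 0 else 1
  | .inr (.inr (.inl x)), .inr (.inl _), .inr (.inr (.inl y)) =>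
    if (x : ℕ) + (y : ℕ) = (q + 1) / 4 then 0 else 1
  | .inr (.inr (.inl x)), .inr (.inr (.inl y)), .inr (.inl _) =>
    if (x : ℕ) + (y : ℕ) = (q + 1) / 4 then 0 else 1
  | .inr (.inl _), _, _ => 1
  | _, .inr (.inl _), _ => 1
  | _, _, .inr (.inl _) => 1
  | .inr (.inr (.inl x)), .inr (.inr (.inl y)), .inr (.inr (.inl z)) =>
    2 - signCount ((q + 1) / 2) x y z
  | .inr (.inr (.inr (.inl _))), .inr (.inr (.inl x)), .inr (.inr (.inl y)) => if x = y then 1 else 2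
  | .inr (.inr (.inl x)), .inr (.inr (.inr (.inl _))), .inr (.inr (.inl y)) => if x = y then 1 else 2
  | .inr (.inr (.inl x)), .inr (.inr (.inl y)), .inr (.inr (.inr (.inl _))) => if x = y then 1 else 2
  | .inr (.inr (.inr (.inr x))), .inr (.inr (.inr (.inr y))), .inr (.inr (.inr (.inr z))) =>
    2 + signCount ((q - 1) / 2) x y z
  | .inr (.inr (.inr (.inl _))), .inr (.inr (.inr (.inr x))), .inr (.inr (.inr (.inr y))) =>
    if x = y then 3 else 2
  | .inr (.inr (.inr (.inr x))), .inr (.inr (.inr (.inl _))), .inr (.inr (.inr (.inr y))) =>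
    if x = y then 3 else 2
  | .inr (.inr (.inr (.inr x))), .inr (.inr (.inr (.inr y))), .inr (.inr (.inr (.inl _))) =>
    if x = y then 3 else 2
  | _, _, _ => 2

theorem threeEntry_one (u : Unit) : threeEntry q (.inl u) = 1 := by
  funext s
  rcases s with _ | _ | _ | _ | _ <;> rfl

theorem threeEntry_half (a : Finset.Icc 1 2) : threeEntry q (.inr (.inl a)) = threeHalf q a := by
  funext s
  rcases s with _ | _ | _ | _ | _ <;> simp [threeEntry, threeHalf, threeFun, threeGauss]

theorem zetaSum_two_mul_mul {n : ℕ} (h : n % 2 = 0) (k c : ℕ) :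
    zetaSum n (2 * k * c) = zs (n / 2) (k * c) := by
  obtain ⟨m, rfl⟩ := Nat.dvd_of_mod_eq_zero h
  rw [zetaSum_eq, show 2 * m / 2 = m by omega, ← zs_two_mul m]
  push_cast
  rw [mul_assoc]

/-- The separate last column is the value of the cosine family at k = n/4, half the period n/2; this
lets one formula cover both groups of columns. -/
theorem neg_one_pow_eq_zs {n : ℕ} (h : n % 4 = 0) (hn : n ≠ 0) (c : ℕ) :
    zs (n / 2) ((n / 4 : ℕ) * c) = 2 * (-1) ^ c := by
  obtain ⟨r, rfl⟩ : ∃ r, n = 4 * (r + 1) := ⟨n / 4 - 1, by omega⟩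
  rw [show 4 * (r + 1) / 2 = 2 * (r + 1) by omega, show 4 * (r + 1) / 4 = r + 1 by omega, zs_half,
    zpow_natCast]

theorem threeEntry_disc (h4 : q % 4 = 3) (x : Finset.Icc 1 ((q - 3) / 4)) :
    threeEntry q (.inr (.inr (.inl x))) = threeDisc q (x : ℕ) := by
  funext s
  rcases s with _ | _ | _ | _ | _ <;> simp [threeEntry, threeDisc, threeFun]
  · rw [zetaSum_two_mul_mul (by omega)]
  · have := neg_one_pow_eq_zs (n := q + 1) (by omega) (by omega) x
    push_cast at this
    rw [this]

theorem threeEntry_st (u : Unit) : threeEntry q (.inr (.inr (.inr (.inl u)))) = threeSt q := by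
  funext s
  rcases s with _ | _ | _ | _ | _ <;> simp [threeEntry, threeSt, threeFun]

theorem threeEntry_prin (h4 : q % 4 = 3) (x : Finset.Icc 1 ((q - 3) / 4)) :
    threeEntry q (.inr (.inr (.inr (.inr x)))) = threePrin q (x : ℕ) := by
  funext s
  rcases s with _ | _ | _ | _ | _ <;> simp [threeEntry, threePrin, threeFun]
  rw [zetaSum_two_mul_mul (by omega)]

/-- Two factors of half degree shift the parameter by half a period each, hence by a full period in
total. -/
theorem threeMean_threeHalf_mul_threeHalf_mul_threeDisc (h4 : q % 4 = 3) (a b : ℕ) (x : ℤ) :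
    threeMean (threeHalf q a * threeHalf q b * threeDisc q x)
      = (1 - (-1) ^ (a + (b + 1))) / 2
        - divInd ((q + 1) / 2) (x + ((q + 1) / 4 : ℕ) + ((q + 1) / 4 : ℕ)) := by
  have hq := three_two_le h4
  rw [mul_assoc, threeHalf_mul_threeDisc h4, mul_sub, mul_comm _ (threeHalfReg q _),
    threeHalf_mul_threeDisc h4, threeMean_sub, threeMean_sub, threeMean_threeHalfReg_mul_threeHalf hq,
    threeMean_threeHalfReg hq, threeMean_threeDisc h4, add_comm (b + 1)]
  ring

theorem threeMean_threeHalf_mul_threeHalf_mul_threePrin (hq : 2 ≤ q) (a b : ℕ) (x : ℤ) :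
    threeMean (threeHalf q a * threeHalf q b * threePrin q x) = (1 - (-1) ^ (a + b)) / 2 := by
  rw [mul_assoc, threeHalf_mul_threePrin, mul_comm, threeMean_threeHalfReg_mul_threeHalf hq,
    add_comm]

theorem threeMean_threeHalf_mul_threeHalf_mul_threeSt (h4 : q % 4 = 3) (a b : ℕ) :
    threeMean (threeHalf q a * threeHalf q b * threeSt q) = 0 := by
  rw [mul_assoc, threeHalf_mul_threeSt, mul_sub, mul_comm _ (threeHalfReg q _), threeMean_sub,
    threeMean_threeHalfReg_mul_threeHalf (three_two_le h4), threeMean_threeHalf_mul_threeHalf h4,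
    add_comm, sub_self]

theorem neg_one_pow_add_ite' (a b : Finset.Icc 1 2) :
    (1 - (-1 : ℂ) ^ ((a : ℕ) + (b : ℕ))) / 2 = if a = b then 0 else 1 := by
  have := neg_one_pow_add_ite a b
  split_ifs at this ⊢ <;> linear_combination -this

theorem neg_one_pow_three_ite (a b c : Finset.Icc 1 2) :
    (1 + (-1 : ℂ) ^ ((a : ℕ) + (b : ℕ)) + (-1) ^ ((a : ℕ) + (c : ℕ)) + (-1) ^ ((b : ℕ) + (c : ℕ))) / 4
      = if a = b ∧ a = c then 1 else 0 := by
  obtain ⟨a, ha⟩ := a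
  obtain ⟨b, hb⟩ := b
  obtain ⟨c, hc⟩ := c
  rw [Finset.mem_Icc] at ha hb hc
  obtain rfl | rfl : a = 1 ∨ a = 2 := by omega
  all_goals
    obtain rfl | rfl : b = 1 ∨ b = 2 := by omega
    all_goals
      obtain rfl | rfl : c = 1 ∨ c = 2 := by omega
      all_goals norm_num

/-- Parity of the sum of two halves, with one of them replaced by its dual. -/
theorem neg_one_pow_succ_ite (a b : Finset.Icc 1 2) :
    (1 - (-1 : ℂ) ^ ((a : ℕ) + 1 + (b : ℕ))) / 2 = if a = b then 1 else 0 := by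
  rw [← neg_one_pow_add_ite, add_right_comm, pow_succ]
  ring

theorem neg_one_pow_succ_ite' (a b : Finset.Icc 1 2) :
    (1 - (-1 : ℂ) ^ ((a : ℕ) + ((b : ℕ) + 1))) / 2 = if a = b then 1 else 0 := by
  rw [← neg_one_pow_add_ite, ← add_assoc, pow_succ]
  ring

theorem threeMean_triple (h4 : q % 4 = 3) (i j k : ThreeRow q) :
    threeMean (threeEntry q i * threeEntry q j * threeEntry q k) = threeTriple q i j k := by
  have hq := three_two_le h4
  have hr : ∀ x : Finset.Icc 1 ((q - 3) / 4), 0 < (x : ℕ) ∧ (x : ℕ) < (q + 1) / 4 := fun x => by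
    have := Finset.mem_Icc.1 x.2
    omega
  have hm : (q + 1) / 2 = (q + 1) / 4 + (q + 1) / 4 := by omega
  have hl : (q - 1) / 2 + 1 = (q + 1) / 2 := by omega
  set H := (q + 1) / 4 with hH
  have hD0 : ∀ x : Finset.Icc 1 ((q - 3) / 4), divInd ((q + 1) / 2) (x : ℕ) = 0 := fun x => by
    have := hr x
    apply divInd_eq_zero <;> omega
  have hDH : ∀ x : Finset.Icc 1 ((q - 3) / 4), divInd ((q + 1) / 2) ((x : ℕ) + H) = 0 := fun x => by
    have := hr x
    apply divInd_eq_zero <;> omega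
  -- Here 2 H = (q + 1)/2 is the full period, so the double shift disappears.
  have hDm : ∀ x : Finset.Icc 1 ((q - 3) / 4), divInd ((q + 1) / 2) ((x : ℕ) + H + H) = 0 :=
    fun x => by
      rw [← hD0 x, add_assoc]
      refine divInd_congr (dvd_add_left ?_)
      rw [hm]
      exact_mod_cast dvd_refl _
  have hP0 : ∀ x : Finset.Icc 1 ((q - 3) / 4), divInd ((q - 1) / 2) (x : ℕ) = 0 := fun x => by
    have := hr x
    apply divInd_eq_zero <;> omega
  have hDa : ∀ x y : Finset.Icc 1 ((q - 3) / 4), divInd ((q + 1) / 2) ((x : ℕ) + (y : ℕ)) = 0 :=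
    fun x y => by
      have := hr x
      have := hr y
      apply divInd_eq_zero <;> omega
  have hPa : ∀ x y : Finset.Icc 1 ((q - 3) / 4), divInd ((q - 1) / 2) ((x : ℕ) + (y : ℕ)) = 0 :=
    fun x y => by
      have := Finset.mem_Icc.1 x.2
      have := Finset.mem_Icc.1 y.2
      apply divInd_eq_zero <;> omega
  have hDs : ∀ x y : Finset.Icc 1 ((q - 3) / 4), divInd ((q + 1) / 2) ((x : ℕ) - (y : ℕ))
      = if x = y then 1 else 0 := fun x y => by
    have := hr x
    have := hr y
    rw [divInd_sub (by omega) (by omega)]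
    simp only [Nat.cast_inj, Subtype.ext_iff]
  have hPs : ∀ x y : Finset.Icc 1 ((q - 3) / 4), divInd ((q - 1) / 2) ((x : ℕ) - (y : ℕ))
      = if x = y then 1 else 0 := fun x y => by
    have := hr x
    have := hr y
    rw [divInd_sub (by omega) (by omega)]
    simp only [Nat.cast_inj, Subtype.ext_iff]
  -- Since 0 < x, y < H, the number x + H + y lies strictly between H and 3 H, so 2 H is the only
  -- multiple of 2 H it can equal.
  have hHa : ∀ x y : Finset.Icc 1 ((q - 3) / 4), divInd ((q + 1) / 2) ((x : ℕ) + H + (y : ℕ))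
      = if (x : ℕ) + (y : ℕ) = H then 1 else 0 := fun x y => by
    have := hr x
    have := hr y
    split_ifs with h
    · exact divInd_of_dvd ⟨1, by omega⟩
    · refine divInd_of_not_dvd fun ⟨c, hc⟩ => ?_
      have h1 : 0 < c := by
        by_contra h1
        have : (((q + 1) / 2 : ℕ) : ℤ) * c ≤ 0 :=
          mul_nonpos_of_nonneg_of_nonpos (by omega) (by omega)
        omega
      have h2 : c < 2 := by
        by_contra h2
        have : (((q + 1) / 2 : ℕ) : ℤ) * 2 ≤ (((q + 1) / 2 : ℕ) : ℤ) * c :=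
          mul_le_mul_of_nonneg_left (by omega) (by omega)
        omega
      obtain rfl : c = 1 := by omega
      omega
  have hHa' : ∀ x y : Finset.Icc 1 ((q - 3) / 4), divInd ((q + 1) / 2) ((x : ℕ) + (y : ℕ) + H)
      = if (x : ℕ) + (y : ℕ) = H then 1 else 0 := fun x y => by
    rw [add_right_comm, hHa]
  have hHs : ∀ x y : Finset.Icc 1 ((q - 3) / 4), divInd ((q + 1) / 2) ((x : ℕ) + H - (y : ℕ)) = 0 :=
    fun x y => by
      have := hr x
      have := hr y
      apply divInd_eq_zero <;> omega
  have hHs' : ∀ x y : Finset.Icc 1 ((q - 3) / 4),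
      divInd ((q + 1) / 2) ((x : ℕ) - (y : ℕ) + H) = 0 := fun x y => by
    have := hr x
    have := hr y
    apply divInd_eq_zero <;> omega
  have hDc : ∀ x y z : Finset.Icc 1 ((q - 3) / 4),
      ((2 - signCount ((q + 1) / 2) (x : ℕ) (y : ℕ) (z : ℕ) : ℕ) : ℂ)
        = 2 - signCount ((q + 1) / 2) (x : ℕ) (y : ℕ) (z : ℕ) :=
    fun x y z => by
      have := hr x
      have := hr y
      have := hr z
      rw [Nat.cast_sub, Nat.cast_ofNat]
      refine le_trans ?_ one_le_two
      apply signCount_le_one <;> omega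
  have t1 := threeMean_one h4
  have t2 := threeMean_threeSt h4
  have t3 := threeMean_threeReg hq
  have t4 := threeMean_threeDisc h4
  have t5 := threeMean_threePrin h4
  have t6 := threeMean_threeReg_mul_threeDisc hq
  have t7 := threeMean_threeReg_mul_threePrin hq
  have t8 := threeMean_threeReg_mul_threeSt hq
  have t9 := threeMean_threeHalf h4
  have u1 := threeMean_threeHalfReg hq
  have u2 := threeMean_threeHalf_mul_threeHalf h4
  have u3 := threeMean_threeHalf_mul_threeHalf_mul_threeHalf h4
  have u4 := threeMean_threeHalf_mul_threeHalf_mul_threeDisc h4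
  have u5 := threeMean_threeHalf_mul_threeHalf_mul_threePrin hq
  have u6 := threeMean_threeHalf_mul_threeHalf_mul_threeSt h4
  have u7 := threeMean_threeHalfReg_mul_threeDisc hq
  have u8 := threeMean_threeHalfReg_mul_threePrin hq
  have u9 := threeMean_threeHalfReg_mul_threeSt hq
  have v1 := threeMean_threeHalfReg_mul_threeHalf hq
  have v2 := threeMean_threeReg_mul_threeHalf hq
  have w1 := threeHalf_mul_threeDisc h4
  have w2 := threeDisc_mul_threeHalf h4
  rw [← hH] at w1 w2
  simp only [← hH] at u4
  rcases i with _ | x | x | _ | x <;> rcases j with _ | y | y | _ | y <;>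
    rcases k with _ | z | z | _ | z <;>
    simp only [threeEntry_one, threeEntry_half, threeEntry_disc h4, threeEntry_st,
      threeEntry_prin h4, one_mul, mul_one, u2, u3, u4, u5, u6,
      threeDisc_mul_threeDisc, threePrin_mul_threePrin, threeDisc_mul_threePrin,
      threePrin_mul_threeDisc, threeDisc_mul_threeSt, threeSt_mul_threeDisc, threePrin_mul_threeSt,
      threeSt_mul_threePrin, threeSt_mul_threeSt, w1, w2, threeHalf_mul_threePrin,
      threePrin_mul_threeHalf, threeHalf_mul_threeSt, threeSt_mul_threeHalf, add_mul, sub_mul,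
      threeMean_add, threeMean_sub, t1, t2, t3, t4, t5, t6, t7, t8, t9, u1, u7, u8, u9, v1, v2,
      threeTriple, hD0, hP0, hDa, hPa, hDs, hPs, hDH, hDm, hHa, hHa', hHs, hHs', hDc,
      neg_one_pow_add_ite', neg_one_pow_three_ite, neg_one_pow_succ_ite, neg_one_pow_succ_ite', ← hH,
      reduceCtorEq, Sum.inl.injEq, Sum.inr.injEq, if_true, if_false, Nat.cast_ite, Nat.cast_add,
      Nat.cast_one, Nat.cast_zero, neg_zero, add_zero, sub_zero, sub_neg_eq_add, zero_add,
      sub_self] <;>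
    (try split_ifs) <;> (try subst_vars) <;> 
    first
    | rfl
    | (norm_num; done)
    | (simp only [signCount]; push_cast; ring)

end Three

end InterpolatedPSL2

/-! ### The case q ≡ 1 mod 4: class functions and their means -/

namespace InterpolatedPSL2

section One

variable {q : ℕ}

/-- The class function with the given values on the groups of columns. -/
def oneFun (q : ℕ) (a : ℂ) (b f g : ℕ → ℂ) : OneCol q → ℂ
  | .inl _ => a
  | .inr (.inl k) => b k
  | .inr (.inr (.inl k)) => f k
  | .inr (.inr (.inr (.inl _))) => f ((q - 1) / 4)
  | .inr (.inr (.inr (.inr k))) => g k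

theorem oneFun_mul (a a' : ℂ) (b f g b' f' g' : ℕ → ℂ) :
    oneFun q a b f g * oneFun q a' b' f' g'
      = oneFun q (a * a') (b * b') (f * f') (g * g') := by
  funext s
  rcases s with _ | _ | _ | _ | _ <;> rfl

theorem oneFun_add (a a' : ℂ) (b f g b' f' g' : ℕ → ℂ) :
    oneFun q a b f g + oneFun q a' b' f' g'
      = oneFun q (a + a') (b + b') (f + f') (g + g') := by
  funext s
  rcases s with _ | _ | _ | _ | _ <;> rfl

theorem oneFun_sub (a a' : ℂ) (b f g b' f' g' : ℕ → ℂ) :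
    oneFun q a b f g - oneFun q a' b' f' g'
      = oneFun q (a - a') (b - b') (f - f') (g - g') := by
  funext s
  rcases s with _ | _ | _ | _ | _ <;> rfl

theorem oneFun_one : (1 : OneCol q → ℂ) = oneFun q 1 1 1 1 := by
  funext s
  rcases s with _ | _ | _ | _ | _ <;> rfl

/-- Inverse orders of the centralizers. -/
noncomputable def oneWeight (q : ℕ) : OneCol q → ℂ
  | .inl _ => 2 / (q * (q ^ 2 - 1))
  | .inr (.inl _) => 1 / q
  | .inr (.inr (.inl _)) => 2 / (q - 1)
  | .inr (.inr (.inr (.inl _))) => 1 / (q - 1)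
  | .inr (.inr (.inr (.inr _))) => 2 / (q + 1)

/-- The multiplicity of the trivial character. -/
noncomputable def oneMean (f : OneCol q → ℂ) : ℂ := ∑ s, oneWeight q s * f s

theorem oneMean_add (f g : OneCol q → ℂ) : oneMean (f + g) = oneMean f + oneMean g := by
  simp [oneMean, mul_add, Finset.sum_add_distrib]

theorem oneMean_sub (f g : OneCol q → ℂ) : oneMean (f - g) = oneMean f - oneMean g := by
  simp [oneMean, mul_sub, Finset.sum_sub_distrib]

theorem oneMean_oneFun (a : ℂ) (b f g : ℕ → ℂ) :
    oneMean (oneFun q a b f g) = 2 * a / (q * (q ^ 2 - 1)) + (b 1 + b 2) / q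
      + (2 * (∑ k ∈ Finset.Icc 1 ((q - 5) / 4), f k) + f ((q - 1) / 4)) / (q - 1)
      + 2 * (∑ k ∈ Finset.Icc 1 ((q - 1) / 4), g k) / (q + 1) := by
  have h : b 1 + b 2 = ∑ k ∈ Finset.Icc 1 2, b k := by
    rw [Finset.sum_Icc_succ_top (by omega), Finset.Icc_self, Finset.sum_singleton]
  rw [h, ← Finset.sum_coe_sort (Finset.Icc 1 2) b,
    ← Finset.sum_coe_sort (Finset.Icc 1 ((q - 5) / 4)) f,
    ← Finset.sum_coe_sort (Finset.Icc 1 ((q - 1) / 4)) g]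
  simp only [oneMean, Fintype.sum_sum_type, oneWeight, oneFun, Finset.univ_unique,
    Finset.sum_const, Finset.card_singleton, one_smul, ← Finset.mul_sum]
  ring

/-- The virtual character of degree `q - 1` with parameter `x`. -/
noncomputable def oneDisc (q : ℕ) (x : ℤ) : OneCol q → ℂ :=
  oneFun q (q - 1) (-1) 0 fun k => -zs ((q + 1) / 2) (k * x)

/-- The virtual character of degree `q + 1` with parameter `x`. -/
noncomputable def onePrin (q : ℕ) (x : ℤ) : OneCol q → ℂ :=
  oneFun q (q + 1) 1 (fun k => zs ((q - 1) / 2) (k * x)) 0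

/-- The Steinberg character. -/
noncomputable def oneSt (q : ℕ) : OneCol q → ℂ := oneFun q q 0 1 (-1)

/-- The sum of the two Gelfand-Graev characters. -/
noncomputable def oneReg (q : ℕ) : OneCol q → ℂ := oneFun q (q ^ 2 - 1) (-1) 0 0

/-- The values of the characters of degree `(q + 1) / 2` on unipotent elements. -/
noncomputable def oneGauss (q c k : ℕ) : ℂ :=
  (1 + (-1) ^ (k + c) * (Real.sqrt q : ℂ)) / 2

/-- The characters of degree `(q + 1) / 2`. -/
noncomputable def oneHalf (q c : ℕ) : OneCol q → ℂ :=
  oneFun q ((q + 1) / 2) (oneGauss q c) (fun k => (-1) ^ k) 0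

/-- The Gelfand-Graev characters. -/
noncomputable def oneHalfReg (q c : ℕ) : OneCol q → ℂ :=
  oneFun q ((q ^ 2 - 1) / 2) (oneGauss q c - 1) 0 0

theorem oneDisc_mul_oneDisc (x y : ℤ) :
    oneDisc q x * oneDisc q y = oneReg q - oneDisc q (x + y) - oneDisc q (x - y) := by
  simp only [oneDisc, oneReg, oneFun_mul, oneFun_sub]
  congr 1
  · ring
  · ring
  · simp
  · funext k
    simp [zs_mul, mul_add, mul_sub]

theorem onePrin_mul_onePrin (x y : ℤ) :
    onePrin q x * onePrin q y = oneReg q + onePrin q (x + y) + onePrin q (x - y) := by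
  simp only [onePrin, oneReg, oneFun_mul, oneFun_add]
  congr 1
  · ring
  · ring
  · funext k
    simp [zs_mul, mul_add, mul_sub]
  · simp

theorem oneDisc_mul_onePrin (x y : ℤ) : oneDisc q x * onePrin q y = oneReg q := by
  simp only [oneDisc, onePrin, oneReg, oneFun_mul]
  congr 1
  · ring
  · ring
  · simp
  · simp

theorem oneSt_mul_oneDisc (x : ℤ) : oneSt q * oneDisc q x = oneReg q - oneDisc q x := by
  simp only [oneDisc, oneSt, oneReg, oneFun_mul, oneFun_sub]
  congr 1
  · ring
  · ring
  · simp
  · funext k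
    simp

theorem oneSt_mul_onePrin (x : ℤ) : oneSt q * onePrin q x = oneReg q + onePrin q x := by
  simp only [onePrin, oneSt, oneReg, oneFun_mul, oneFun_add]
  congr 1
  · ring
  · ring
  · simp
  · simp

theorem oneSt_mul_oneSt : oneSt q * oneSt q = oneReg q + 1 := by
  simp only [oneSt, oneReg, oneFun_mul, oneFun_add, oneFun_one]
  congr 1
  · ring
  · ring
  · simp
  · simp

theorem onePrin_mul_oneDisc (x y : ℤ) : onePrin q x * oneDisc q y = oneReg q := by
  rw [mul_comm, oneDisc_mul_onePrin]

theorem oneDisc_mul_oneSt (x : ℤ) : oneDisc q x * oneSt q = oneReg q - oneDisc q x := by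
  rw [mul_comm, oneSt_mul_oneDisc]

theorem onePrin_mul_oneSt (x : ℤ) : onePrin q x * oneSt q = oneReg q + onePrin q x := by
  rw [mul_comm, oneSt_mul_onePrin]

/-- The mirror image of the case q ≡ 3 mod 4: the sign now lives on the columns of the family of
degree q + 1, so it is that parameter which moves by half a period. -/
theorem oneHalf_mul_onePrin (h4 : q % 4 = 1) (hq : 2 ≤ q) (c : ℕ) (x : ℤ) :
    oneHalf q c * onePrin q x = oneHalfReg q c + onePrin q (x + ((q - 1) / 4 : ℕ)) := by
  simp only [oneHalf, onePrin, oneHalfReg, oneFun_mul, oneFun_add]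
  congr 1
  · ring
  · simp
  · obtain ⟨r, rfl⟩ : ∃ r, q = 4 * r + 5 := ⟨q / 4 - 1, by omega⟩
    funext k
    rw [show (4 * r + 5 - 1) / 2 = 2 * (r + 1) by omega,
      show (4 * r + 5 - 1) / 4 = r + 1 by omega]
    simp only [Pi.mul_apply, Pi.add_apply, Pi.zero_apply]
    rw [mul_add (k : ℤ), zs_add_half]
    ring
  · simp

theorem oneHalf_mul_oneDisc (c : ℕ) (x : ℤ) :
    oneHalf q c * oneDisc q x = oneHalfReg q (c + 1) := by
  simp only [oneHalf, oneDisc, oneHalfReg, oneFun_mul]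
  congr 1
  · ring
  · funext k
    simp only [oneGauss, Pi.mul_apply, Pi.neg_apply, Pi.one_apply, Pi.sub_apply, ← add_assoc,
      pow_succ]
    ring
  · simp
  · simp

theorem oneHalf_mul_oneSt (c : ℕ) :
    oneHalf q c * oneSt q = oneHalfReg q (c + 1) + oneHalf q c := by
  simp only [oneHalf, oneSt, oneHalfReg, oneFun_mul, oneFun_add]
  congr 1
  · ring
  · funext k
    simp only [oneGauss, Pi.mul_apply, Pi.zero_apply, Pi.one_apply, Pi.sub_apply, Pi.add_apply,
      ← add_assoc, pow_succ]
    ring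
  · simp
  · simp

theorem onePrin_mul_oneHalf (h4 : q % 4 = 1) (hq : 2 ≤ q) (c : ℕ) (x : ℤ) :
    onePrin q x * oneHalf q c = oneHalfReg q c + onePrin q (x + ((q - 1) / 4 : ℕ)) := by
  rw [mul_comm, oneHalf_mul_onePrin h4 hq]

theorem oneDisc_mul_oneHalf (c : ℕ) (x : ℤ) :
    oneDisc q x * oneHalf q c = oneHalfReg q (c + 1) := by
  rw [mul_comm, oneHalf_mul_oneDisc]

theorem oneSt_mul_oneHalf (c : ℕ) :
    oneSt q * oneHalf q c = oneHalfReg q (c + 1) + oneHalf q c := by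
  rw [mul_comm, oneHalf_mul_oneSt]

theorem oneMean_oneReg_mul (hq : 2 ≤ q) (a : ℂ) (b f g : ℕ → ℂ) :
    oneMean (oneReg q * oneFun q a b f g) = (2 * a - b 1 - b 2) / q := by
  obtain ⟨h1, -, -, h2⟩ := even_ne_zero hq
  rw [oneReg, oneFun_mul, oneMean_oneFun]
  simp
  field_simp
  ring

theorem oneMean_oneReg_mul_oneDisc (hq : 2 ≤ q) (x : ℤ) :
    oneMean (oneReg q * oneDisc q x) = 2 := by
  rw [oneDisc, oneMean_oneReg_mul hq]
  simp only [Pi.neg_apply, Pi.one_apply]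
  field_simp [(even_ne_zero hq).1]
  ring

theorem oneMean_oneReg_mul_onePrin (hq : 2 ≤ q) (x : ℤ) :
    oneMean (oneReg q * onePrin q x) = 2 := by
  rw [onePrin, oneMean_oneReg_mul hq]
  simp only [Pi.one_apply]
  field_simp [(even_ne_zero hq).1]
  ring

theorem oneMean_oneReg_mul_oneSt (hq : 2 ≤ q) :
    oneMean (oneReg q * oneSt q) = 2 := by
  rw [oneSt, oneMean_oneReg_mul hq]
  simp only [Pi.zero_apply]
  field_simp [(even_ne_zero hq).1]
  ring

theorem oneMean_oneReg_mul_oneHalf (hq : 2 ≤ q) (c : ℕ) :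
    oneMean (oneReg q * oneHalf q c) = 1 := by
  rw [oneHalf, oneMean_oneReg_mul hq]
  simp only [oneGauss, pow_add]
  field_simp [(even_ne_zero hq).1]
  ring

theorem oneMean_oneReg (hq : 2 ≤ q) : oneMean (oneReg q) = 0 := by
  rw [← mul_one (oneReg q), oneFun_one, oneMean_oneReg_mul hq]
  simp only [Pi.one_apply]
  ring

theorem oneMean_oneHalfReg_mul (hq : 2 ≤ q) (c : ℕ) (a : ℂ) (b f g : ℕ → ℂ) :
    oneMean (oneHalfReg q c * oneFun q a b f g)
      = (a + ((oneGauss q c 1 - 1) * b 1 + (oneGauss q c 2 - 1) * b 2)) / q := by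
  obtain ⟨h1, -, -, h2⟩ := even_ne_zero hq
  rw [oneHalfReg, oneFun_mul, oneMean_oneFun]
  simp
  field_simp

theorem oneMean_oneHalfReg_mul_oneDisc (hq : 2 ≤ q) (c : ℕ) (x : ℤ) :
    oneMean (oneHalfReg q c * oneDisc q x) = 1 := by
  rw [oneDisc, oneMean_oneHalfReg_mul hq]
  simp only [oneGauss, Pi.neg_apply, Pi.one_apply, pow_add]
  field_simp [(even_ne_zero hq).1]
  ring

theorem oneMean_oneHalfReg_mul_onePrin (hq : 2 ≤ q) (c : ℕ) (x : ℤ) :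
    oneMean (oneHalfReg q c * onePrin q x) = 1 := by
  rw [onePrin, oneMean_oneHalfReg_mul hq]
  simp only [oneGauss, Pi.one_apply, pow_add]
  field_simp [(even_ne_zero hq).1]
  ring

theorem oneMean_oneHalfReg_mul_oneSt (hq : 2 ≤ q) (c : ℕ) :
    oneMean (oneHalfReg q c * oneSt q) = 1 := by
  rw [oneSt, oneMean_oneHalfReg_mul hq]
  simp only [Pi.zero_apply]
  field_simp [(even_ne_zero hq).1]
  ring

theorem oneMean_oneHalfReg (hq : 2 ≤ q) (c : ℕ) : oneMean (oneHalfReg q c) = 0 := by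
  rw [← mul_one (oneHalfReg q c), oneFun_one, oneMean_oneHalfReg_mul hq]
  simp only [oneGauss, Pi.one_apply, pow_add]
  ring

theorem oneGauss_add (q a : ℕ) : oneGauss q a 1 + oneGauss q a 2 = 1 := by
  simp only [oneGauss, pow_add]
  ring

/-- Odd powers of √q cancel between the two unipotent columns. The Gauss values are real here, so
the sign of q is opposite to that in `threeGauss_mul`, and the rows are self-dual. -/
theorem oneGauss_mul (q a b : ℕ) :
    oneGauss q a 1 * oneGauss q b 1 + oneGauss q a 2 * oneGauss q b 2
      = (1 + (-1) ^ (a + b) * q) / 2 := by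
  have hs := sqrt_natCast_sq q
  simp only [oneGauss, pow_add]
  linear_combination (-1) ^ a * (-1) ^ b / 2 * hs

theorem oneGauss_mul_mul (q a b c : ℕ) :
    oneGauss q a 1 * oneGauss q b 1 * oneGauss q c 1
        + oneGauss q a 2 * oneGauss q b 2 * oneGauss q c 2
      = (1 + ((-1) ^ (a + b) + (-1) ^ (a + c) + (-1) ^ (b + c)) * q) / 4 := by
  have hs := sqrt_natCast_sq q
  simp only [oneGauss, pow_add]
  linear_combination ((-1) ^ a * (-1) ^ b + (-1) ^ a * (-1) ^ c + (-1) ^ b * (-1) ^ c) / 4 * hs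

theorem oneMean_oneHalfReg_mul_oneHalf (hq : 2 ≤ q) (c c' : ℕ) :
    oneMean (oneHalfReg q c * oneHalf q c') = (1 + (-1) ^ (c + c')) / 2 := by
  have h1 := oneGauss_mul q c c'
  have h2 := oneGauss_add q c'
  rw [oneHalf, oneMean_oneHalfReg_mul hq, div_eq_iff (even_ne_zero hq).1]
  linear_combination h1 - h2

theorem two_mul_sum_neg_one_pow_one (h4 : q % 4 = 1) (hq : 2 ≤ q) :
    2 * (∑ k ∈ Finset.Icc 1 ((q - 5) / 4), (-1 : ℂ) ^ k) + (-1) ^ ((q - 1) / 4) = -1 := by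
  have h := two_mul_sum_neg_one_pow ((q - 5) / 4)
  rw [show (q - 1) / 4 = (q - 5) / 4 + 1 by omega]
  simp only [pow_succ, ← Finset.sum_mul] at h ⊢
  linear_combination -h

theorem natCast_sub_one_div_four (h4 : q % 4 = 1) : (((q - 1) / 4 : ℕ) : ℂ) = (q - 1) / 4 := by
  obtain ⟨r, rfl⟩ : ∃ r, q = 4 * r + 1 := ⟨q / 4, by omega⟩
  rw [show (4 * r + 1 - 1) / 4 = r by omega]
  push_cast
  ring

theorem natCast_sub_five_div_four (h4 : q % 4 = 1) (hq : 2 ≤ q) :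
    (((q - 5) / 4 : ℕ) : ℂ) = (q - 5) / 4 := by
  obtain ⟨r, rfl⟩ : ∃ r, q = 4 * r + 5 := ⟨q / 4 - 1, by omega⟩
  rw [show (4 * r + 5 - 5) / 4 = r by omega]
  push_cast
  ring

theorem oneMean_one (h4 : q % 4 = 1) (hq : 2 ≤ q) : oneMean (1 : OneCol q → ℂ) = 1 := by
  obtain ⟨h1, h2, h3, h5⟩ := even_ne_zero (hq)
  rw [oneFun_one, oneMean_oneFun]
  simp [natCast_sub_one_div_four h4, natCast_sub_five_div_four h4 hq]
  rw [show (q : ℂ) ^ 2 - 1 = (q + 1) * (q - 1) by ring]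
  field_simp
  ring

theorem oneMean_oneSt (h4 : q % 4 = 1) (hq : 2 ≤ q) : oneMean (oneSt q) = 0 := by
  obtain ⟨h1, h2, h3, h5⟩ := even_ne_zero (hq)
  rw [oneSt, oneMean_oneFun]
  simp [natCast_sub_one_div_four h4, natCast_sub_five_div_four h4 hq]
  rw [show (q : ℂ) ^ 2 - 1 = (q + 1) * (q - 1) by ring]
  field_simp
  ring

theorem oneMean_oneDisc (h4 : q % 4 = 1) (hq : 2 ≤ q) (x : ℤ) :
    oneMean (oneDisc q x) = -divInd ((q + 1) / 2) x := by
  obtain ⟨h1, h2, h3, h5⟩ := even_ne_zero (hq)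
  have h7 : ∑ k ∈ Finset.Icc 1 ((q - 1) / 4), zs ((q + 1) / 2) (k * x)
      = ((q : ℂ) + 1) / 2 * divInd ((q + 1) / 2) x - 1 := by
    obtain ⟨r, rfl⟩ : ∃ r, q = 4 * r + 1 := ⟨q / 4, by omega⟩
    rw [show (4 * r + 1 - 1) / 4 = r by omega, show (4 * r + 1 + 1) / 2 = 2 * r + 1 by omega,
      sum_zs_odd, divInd]
    push_cast
    ring
  rw [oneDisc, oneMean_oneFun]
  simp only [Finset.sum_neg_distrib, h7, Pi.zero_apply, Pi.neg_apply, Pi.one_apply,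
    Finset.sum_const_zero]
  rw [show (q : ℂ) ^ 2 - 1 = (q + 1) * (q - 1) by ring]
  field_simp
  ring

theorem oneMean_onePrin (h4 : q % 4 = 1) (hq : 2 ≤ q) (x : ℤ) :
    oneMean (onePrin q x) = divInd ((q - 1) / 2) x := by
  obtain ⟨h1, h2, h3, h5⟩ := even_ne_zero (hq)
  have h7 : ∑ k ∈ Finset.Icc 1 ((q - 5) / 4), zs ((q - 1) / 2) (k * x)
      = ((q : ℂ) - 1) / 2 * divInd ((q - 1) / 2) x - 1 - (-1) ^ x := by
    obtain ⟨r, rfl⟩ : ∃ r, q = 4 * r + 5 := ⟨q / 4 - 1, by omega⟩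
    rw [show (4 * r + 5 - 5) / 4 = r by omega, show (4 * r + 5 - 1) / 2 = 2 * (r + 1) by omega,
      sum_zs_even, divInd]
    push_cast
    ring
  have h8 : zs ((q - 1) / 2) (((q - 1) / 4 : ℕ) * x) = 2 * (-1) ^ x := by
    obtain ⟨r, rfl⟩ : ∃ r, q = 4 * r + 5 := ⟨q / 4 - 1, by omega⟩
    rw [show (4 * r + 5 - 1) / 2 = 2 * (r + 1) by omega, show (4 * r + 5 - 1) / 4 = r + 1 by omega,
      zs_half]
  rw [onePrin, oneMean_oneFun]
  simp only [h7, h8, Pi.zero_apply, Pi.one_apply, Finset.sum_const_zero]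
  rw [show (q : ℂ) ^ 2 - 1 = (q + 1) * (q - 1) by ring]
  field_simp
  ring

theorem oneMean_oneHalf (h4 : q % 4 = 1) (hq : 2 ≤ q) (c : ℕ) : oneMean (oneHalf q c) = 0 := by
  obtain ⟨h1, h2, h3, h5⟩ := even_ne_zero (hq)
  rw [oneHalf, oneMean_oneFun, two_mul_sum_neg_one_pow_one h4 hq]
  simp only [oneGauss, pow_add, Pi.zero_apply, Finset.sum_const_zero]
  rw [show (q : ℂ) ^ 2 - 1 = (q + 1) * (q - 1) by ring]
  field_simp
  ring

theorem oneMean_oneHalf_mul_oneHalf (h4 : q % 4 = 1) (hq : 2 ≤ q) (c c' : ℕ) :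
    oneMean (oneHalf q c * oneHalf q c') = (1 + (-1) ^ (c + c')) / 2 := by
  obtain ⟨h1, h2, h3, h5⟩ := even_ne_zero (hq)
  have h7 : ∀ k : ℕ, (-1 : ℂ) ^ k * (-1) ^ k = 1 := fun k => by
    rw [← mul_pow]
    norm_num
  rw [oneHalf, oneHalf, oneFun_mul, oneMean_oneFun]
  simp only [Pi.mul_apply, h7, oneGauss_mul, Pi.zero_apply, Finset.sum_const_zero,
    mul_zero, Finset.sum_const, Nat.card_Icc, nsmul_eq_mul, Nat.add_sub_cancel,
    natCast_sub_five_div_four h4 hq]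
  rw [show (q : ℂ) ^ 2 - 1 = (q + 1) * (q - 1) by ring]
  field_simp
  ring

theorem oneMean_oneHalf_mul_oneHalf_mul_oneHalf (h4 : q % 4 = 1) (hq : 2 ≤ q) (a b c : ℕ) :
    oneMean (oneHalf q a * oneHalf q b * oneHalf q c)
      = (1 + (-1) ^ (a + b) + (-1) ^ (a + c) + (-1) ^ (b + c)) / 4 := by
  obtain ⟨h1, h2, h3, h5⟩ := even_ne_zero (hq)
  have h7 : ∀ k : ℕ, (-1 : ℂ) ^ k * (-1) ^ k * (-1) ^ k = (-1) ^ k :=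
    fun k => by
      rw [← mul_pow]
      norm_num
  rw [oneHalf, oneHalf, oneHalf, oneFun_mul, oneFun_mul, oneMean_oneFun]
  simp only [Pi.mul_apply, h7, two_mul_sum_neg_one_pow_one h4 hq, Pi.zero_apply,
    Finset.sum_const_zero, mul_zero, oneGauss_mul_mul]
  rw [show (q : ℂ) ^ 2 - 1 = (q + 1) * (q - 1) by ring]
  field_simp
  ring

end One

end InterpolatedPSL2

/-! ### The case q ≡ 1 mod 4: the triple multiplicities -/

namespace InterpolatedPSL2

section One

variable {q : ℕ}

/-- The multiplicity of the trivial character in a product of one rows. -/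
def oneTriple (q : ℕ) : OneRow q → OneRow q → OneRow q → ℕ
  | .inl _, j, k => if j = k then 1 else 0
  | i, .inl _, k => if i = k then 1 else 0
  | i, j, .inl _ => if i = j then 1 else 0
  | .inr (.inl a), .inr (.inl b), .inr (.inl c) => if a = b ∧ a = c then 1 else 0
  | .inr (.inl a), .inr (.inl b), .inr (.inr (.inl _)) => if a = b then 0 else 1
  | .inr (.inl a), .inr (.inr (.inl _)), .inr (.inl b) => if a = b then 0 else 1
  | .inr (.inr (.inl _)), .inr (.inl a), .inr (.inl b) => if a = b then 0 else 1
  | .inr (.inl a), .inr (.inl b), .inr (.inr (.inr (.inr _))) => if a = b then 1 else 0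
  | .inr (.inl a), .inr (.inr (.inr (.inr _))), .inr (.inl b) => if a = b then 1 else 0
  | .inr (.inr (.inr (.inr _))), .inr (.inl a), .inr (.inl b) => if a = b then 1 else 0
  | .inr (.inl _), .inr (.inr (.inr (.inr x))), .inr (.inr (.inr (.inr y))) =>
    if (x : ℕ) + (y : ℕ) = (q - 1) / 4 then 2 else 1
  | .inr (.inr (.inr (.inr x))), .inr (.inl _), .inr (.inr (.inr (.inr y))) =>
    if (x : ℕ) + (y : ℕ) = (q - 1) / 4 then 2 else 1
  | .inr (.inr (.inr (.inr x))), .inr (.inr (.inr (.inr y))), .inr (.inl _) =>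
    if (x : ℕ) + (y : ℕ) = (q - 1) / 4 then 2 else 1
  | .inr (.inl _), _, _ => 1
  | _, .inr (.inl _), _ => 1
  | _, _, .inr (.inl _) => 1
  | .inr (.inr (.inl x)), .inr (.inr (.inl y)), .inr (.inr (.inl z)) =>
    2 - signCount ((q + 1) / 2) x y z
  | .inr (.inr (.inr (.inl _))), .inr (.inr (.inl x)), .inr (.inr (.inl y)) => if x = y then 1 else 2
  | .inr (.inr (.inl x)), .inr (.inr (.inr (.inl _))), .inr (.inr (.inl y)) => if x = y then 1 else 2
  | .inr (.inr (.inl x)), .inr (.inr (.inl y)), .inr (.inr (.inr (.inl _))) => if x = y then 1 else 2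
  | .inr (.inr (.inr (.inr x))), .inr (.inr (.inr (.inr y))), .inr (.inr (.inr (.inr z))) =>
    2 + signCount ((q - 1) / 2) x y z
  | .inr (.inr (.inr (.inl _))), .inr (.inr (.inr (.inr x))), .inr (.inr (.inr (.inr y))) =>
    if x = y then 3 else 2
  | .inr (.inr (.inr (.inr x))), .inr (.inr (.inr (.inl _))), .inr (.inr (.inr (.inr y))) =>
    if x = y then 3 else 2
  | .inr (.inr (.inr (.inr x))), .inr (.inr (.inr (.inr y))), .inr (.inr (.inr (.inl _))) =>
    if x = y then 3 else 2
  | _, _, _ => 2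

theorem oneEntry_one (u : Unit) : oneEntry q (.inl u) = 1 := by
  funext s
  rcases s with _ | _ | _ | _ | _ <;> rfl

theorem oneEntry_half (a : Finset.Icc 1 2) : oneEntry q (.inr (.inl a)) = oneHalf q a := by
  funext s
  rcases s with _ | _ | _ | _ | _ <;> simp [oneEntry, oneHalf, oneFun, oneGauss]

theorem oneEntry_disc (h4 : q % 4 = 1) (x : Finset.Icc 1 ((q - 1) / 4)) :
    oneEntry q (.inr (.inr (.inl x))) = oneDisc q (x : ℕ) := by
  funext s
  rcases s with _ | _ | _ | _ | _ <;> simp [oneEntry, oneDisc, oneFun]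
  rw [zetaSum_two_mul_mul (by omega)]

theorem oneEntry_st (u : Unit) : oneEntry q (.inr (.inr (.inr (.inl u)))) = oneSt q := by
  funext s
  rcases s with _ | _ | _ | _ | _ <;> simp [oneEntry, oneSt, oneFun]

theorem oneEntry_prin (h4 : q % 4 = 1) (hq : 2 ≤ q) (x : Finset.Icc 1 ((q - 5) / 4)) :
    oneEntry q (.inr (.inr (.inr (.inr x)))) = onePrin q (x : ℕ) := by
  funext s
  rcases s with _ | _ | _ | _ | _ <;> simp [oneEntry, onePrin, oneFun]
  · rw [zetaSum_two_mul_mul (by omega)]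
  · have := neg_one_pow_eq_zs (n := q - 1) (by omega) (by omega) x
    push_cast at this
    rw [this]

theorem oneMean_oneHalf_mul_oneHalf_mul_oneDisc (hq : 2 ≤ q) (a b : ℕ) (x : ℤ) :
    oneMean (oneHalf q a * oneHalf q b * oneDisc q x) = (1 + (-1) ^ (a + (b + 1))) / 2 := by
  rw [mul_assoc, oneHalf_mul_oneDisc, mul_comm, oneMean_oneHalfReg_mul_oneHalf hq, add_comm a]

theorem oneMean_oneHalf_mul_oneHalf_mul_onePrin (h4 : q % 4 = 1) (hq : 2 ≤ q) (a b : ℕ) (x : ℤ) :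
    oneMean (oneHalf q a * oneHalf q b * onePrin q x)
      = (1 + (-1) ^ (a + b)) / 2
        + divInd ((q - 1) / 2) (x + ((q - 1) / 4 : ℕ) + ((q - 1) / 4 : ℕ)) := by
  rw [mul_assoc, oneHalf_mul_onePrin h4 hq, mul_add, mul_comm _ (oneHalfReg q _),
    oneHalf_mul_onePrin h4 hq, oneMean_add, oneMean_add, oneMean_oneHalfReg_mul_oneHalf hq,
    oneMean_oneHalfReg hq, oneMean_onePrin h4 hq, add_comm b]
  ring

theorem oneMean_oneHalf_mul_oneHalf_mul_oneSt (h4 : q % 4 = 1) (hq : 2 ≤ q) (a b : ℕ) :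
    oneMean (oneHalf q a * oneHalf q b * oneSt q) = 1 := by
  rw [mul_assoc, oneHalf_mul_oneSt, mul_add, mul_comm _ (oneHalfReg q _), oneMean_add,
    oneMean_oneHalfReg_mul_oneHalf hq, oneMean_oneHalf_mul_oneHalf h4 hq, add_right_comm, add_comm b,
    pow_succ]
  ring

theorem neg_one_pow_succ_add_ite (a b : Finset.Icc 1 2) :
    (1 + (-1 : ℂ) ^ ((a : ℕ) + 1 + (b : ℕ))) / 2 = if a = b then 0 else 1 := by
  rw [← neg_one_pow_add_ite', add_right_comm, pow_succ]
  ring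

theorem neg_one_pow_succ_add_ite' (a b : Finset.Icc 1 2) :
    (1 + (-1 : ℂ) ^ ((a : ℕ) + ((b : ℕ) + 1))) / 2 = if a = b then 0 else 1 := by
  rw [← neg_one_pow_add_ite', ← add_assoc, pow_succ]
  ring

theorem oneMean_triple (h4 : q % 4 = 1) (hq : 2 ≤ q) (i j k : OneRow q) :
    oneMean (oneEntry q i * oneEntry q j * oneEntry q k) = oneTriple q i j k := by
  have hr : ∀ x : Finset.Icc 1 ((q - 5) / 4), 0 < (x : ℕ) ∧ (x : ℕ) < (q - 1) / 4 := fun x => by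
    have := Finset.mem_Icc.1 x.2
    omega
  have hs : ∀ x : Finset.Icc 1 ((q - 1) / 4), 0 < (x : ℕ) ∧ 2 * (x : ℕ) < (q + 1) / 2 := fun x => by
    have := Finset.mem_Icc.1 x.2
    omega
  have hm : (q - 1) / 2 = (q - 1) / 4 + (q - 1) / 4 := by omega
  set H := (q - 1) / 4 with hH
  have hP0 : ∀ x : Finset.Icc 1 ((q - 5) / 4), divInd ((q - 1) / 2) (x : ℕ) = 0 := fun x => by
    have := hr x
    apply divInd_eq_zero <;> omega
  have hPH : ∀ x : Finset.Icc 1 ((q - 5) / 4), divInd ((q - 1) / 2) ((x : ℕ) + H) = 0 := fun x => by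
    have := hr x
    apply divInd_eq_zero <;> omega
  have hPm : ∀ x : Finset.Icc 1 ((q - 5) / 4), divInd ((q - 1) / 2) ((x : ℕ) + H + H) = 0 :=
    fun x => by
      rw [← hP0 x, add_assoc]
      refine divInd_congr (dvd_add_left ?_)
      rw [hm]
      exact_mod_cast dvd_refl _
  have hD0 : ∀ x : Finset.Icc 1 ((q - 1) / 4), divInd ((q + 1) / 2) (x : ℕ) = 0 := fun x => by
    have := hs x
    apply divInd_eq_zero <;> omega
  have hPa : ∀ x y : Finset.Icc 1 ((q - 5) / 4), divInd ((q - 1) / 2) ((x : ℕ) + (y : ℕ)) = 0 :=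
    fun x y => by
      have := hr x
      have := hr y
      apply divInd_eq_zero <;> omega
  have hDa : ∀ x y : Finset.Icc 1 ((q - 1) / 4), divInd ((q + 1) / 2) ((x : ℕ) + (y : ℕ)) = 0 :=
    fun x y => by
      have := hs x
      have := hs y
      apply divInd_eq_zero <;> omega
  have hPs : ∀ x y : Finset.Icc 1 ((q - 5) / 4), divInd ((q - 1) / 2) ((x : ℕ) - (y : ℕ))
      = if x = y then 1 else 0 := fun x y => by
    have := hr x
    have := hr y
    rw [divInd_sub (by omega) (by omega)]
    simp only [Nat.cast_inj, Subtype.ext_iff]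
  have hDs : ∀ x y : Finset.Icc 1 ((q - 1) / 4), divInd ((q + 1) / 2) ((x : ℕ) - (y : ℕ))
      = if x = y then 1 else 0 := fun x y => by
    have := hs x
    have := hs y
    rw [divInd_sub (by omega) (by omega)]
    simp only [Nat.cast_inj, Subtype.ext_iff]
  -- Again H < x + H + y < 3 H with modulus 2 H = (q - 1)/2, so divisibility means x + y = H.
  have hHa : ∀ x y : Finset.Icc 1 ((q - 5) / 4), divInd ((q - 1) / 2) ((x : ℕ) + H + (y : ℕ))
      = if (x : ℕ) + (y : ℕ) = H then 1 else 0 := fun x y => by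
    have := hr x
    have := hr y
    split_ifs with h
    · exact divInd_of_dvd ⟨1, by omega⟩
    · refine divInd_of_not_dvd fun ⟨c, hc⟩ => ?_
      have h1 : 0 < c := by
        by_contra h1
        have : (((q - 1) / 2 : ℕ) : ℤ) * c ≤ 0 :=
          mul_nonpos_of_nonneg_of_nonpos (by omega) (by omega)
        omega
      have h2 : c < 2 := by
        by_contra h2
        have : (((q - 1) / 2 : ℕ) : ℤ) * 2 ≤ (((q - 1) / 2 : ℕ) : ℤ) * c :=
          mul_le_mul_of_nonneg_left (by omega) (by omega)
        omega
      obtain rfl : c = 1 := by omega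
      omega
  have hHa' : ∀ x y : Finset.Icc 1 ((q - 5) / 4), divInd ((q - 1) / 2) ((x : ℕ) + (y : ℕ) + H)
      = if (x : ℕ) + (y : ℕ) = H then 1 else 0 := fun x y => by
    rw [add_right_comm, hHa]
  have hHs : ∀ x y : Finset.Icc 1 ((q - 5) / 4), divInd ((q - 1) / 2) ((x : ℕ) + H - (y : ℕ)) = 0 :=
    fun x y => by
      have := hr x
      have := hr y
      apply divInd_eq_zero <;> omega
  have hHs' : ∀ x y : Finset.Icc 1 ((q - 5) / 4),
      divInd ((q - 1) / 2) ((x : ℕ) - (y : ℕ) + H) = 0 := fun x y => by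
    have := hr x
    have := hr y
    apply divInd_eq_zero <;> omega
  have hDc : ∀ x y z : Finset.Icc 1 ((q - 1) / 4),
      ((2 - signCount ((q + 1) / 2) (x : ℕ) (y : ℕ) (z : ℕ) : ℕ) : ℂ)
        = 2 - signCount ((q + 1) / 2) (x : ℕ) (y : ℕ) (z : ℕ) :=
    fun x y z => by
      have := hs x
      have := hs y
      have := hs z
      rw [Nat.cast_sub, Nat.cast_ofNat]
      refine le_trans ?_ one_le_two
      apply signCount_le_one <;> omega
  have t1 := oneMean_one h4 hq
  have t2 := oneMean_oneSt h4 hq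
  have t3 := oneMean_oneReg hq
  have t4 := oneMean_oneDisc h4 hq
  have t5 := oneMean_onePrin h4 hq
  have t6 := oneMean_oneReg_mul_oneDisc hq
  have t7 := oneMean_oneReg_mul_onePrin hq
  have t8 := oneMean_oneReg_mul_oneSt hq
  have t9 := oneMean_oneHalf h4 hq
  have u1 := oneMean_oneHalfReg hq
  have u2 := oneMean_oneHalf_mul_oneHalf h4 hq
  have u3 := oneMean_oneHalf_mul_oneHalf_mul_oneHalf h4 hq
  have u4 := oneMean_oneHalf_mul_oneHalf_mul_oneDisc hq
  have u5 := oneMean_oneHalf_mul_oneHalf_mul_onePrin h4 hq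
  have u6 := oneMean_oneHalf_mul_oneHalf_mul_oneSt h4 hq
  have u7 := oneMean_oneHalfReg_mul_oneDisc hq
  have u8 := oneMean_oneHalfReg_mul_onePrin hq
  have u9 := oneMean_oneHalfReg_mul_oneSt hq
  have v1 := oneMean_oneHalfReg_mul_oneHalf hq
  have v2 := oneMean_oneReg_mul_oneHalf hq
  have w1 := oneHalf_mul_onePrin h4 hq
  have w2 := onePrin_mul_oneHalf h4 hq
  rw [← hH] at w1 w2
  simp only [← hH] at u5
  rcases i with _ | x | x | _ | x <;> rcases j with _ | y | y | _ | y <;>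
    rcases k with _ | z | z | _ | z <;>
    simp only [oneEntry_one, oneEntry_half, oneEntry_disc h4, oneEntry_st,
      oneEntry_prin h4 hq, one_mul, mul_one, u2, u3, u4, u5, u6,
      oneDisc_mul_oneDisc, onePrin_mul_onePrin, oneDisc_mul_onePrin,
      onePrin_mul_oneDisc, oneDisc_mul_oneSt, oneSt_mul_oneDisc, onePrin_mul_oneSt,
      oneSt_mul_onePrin, oneSt_mul_oneSt, w1, w2, oneHalf_mul_oneDisc,
      oneDisc_mul_oneHalf, oneHalf_mul_oneSt, oneSt_mul_oneHalf, add_mul, sub_mul,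
      oneMean_add, oneMean_sub, t1, t2, t3, t4, t5, t6, t7, t8, t9, u1, u7, u8, u9, v1, v2,
      oneTriple, hD0, hP0, hDa, hPa, hDs, hPs, hPH, hPm, hHa, hHa', hHs, hHs', hDc,
      neg_one_pow_add_ite, neg_one_pow_three_ite, neg_one_pow_succ_add_ite, neg_one_pow_succ_add_ite', ← hH,
      reduceCtorEq, Sum.inl.injEq, Sum.inr.injEq, if_true, if_false, Nat.cast_ite, Nat.cast_add,
      Nat.cast_one, Nat.cast_zero, neg_zero, add_zero, sub_zero, sub_neg_eq_add, zero_add,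
      sub_self] <;>
    (try split_ifs) <;> (try subst_vars) <;> 
    first
    | rfl
    | (norm_num; done)
    | (simp only [signCount]; push_cast; ring)

end One

end InterpolatedPSL2

/-! ### The criterion for large odd q -/

namespace InterpolatedPSL2

theorem two_le_sum {ι : Type*} [Fintype ι] {f : ι → ℕ} {x y : ι} (hxy : x ≠ y) (hx : 1 ≤ f x)
    (hy : 1 ≤ f y) : 2 ≤ ∑ k, f k := by
  classical
  have h := Finset.sum_le_sum_of_subset (f := f) (Finset.subset_univ {x, y})
  rw [Finset.sum_pair hxy] at h
  omega

theorem one_le_mul_mul {a b c : ℕ} (ha : 1 ≤ a) (hb : 1 ≤ b) (hc : 1 ≤ c) : 1 ≤ a * b * c :=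
  Nat.mul_pos (Nat.mul_pos ha hb) hc

section Three

variable {q : ℕ}

theorem three_sub_inj (i j : Finset.Icc 1 2) : 3 - (i : ℕ) = 3 - (j : ℕ) ↔ i = j := by
  have hi := Finset.mem_Icc.1 i.2
  have hj := Finset.mem_Icc.1 j.2
  rw [Subtype.ext_iff]
  omega

theorem threeTriple_one (i j : ThreeRow q) (u : Unit) :
    threeTriple q i j (.inl u) = if threeDual q i = j then 1 else 0 := by
  rcases i with _ | i | _ | _ | _ <;> rcases j with _ | j | _ | _ | _ <;>
    simp only [threeTriple, threeDual, reduceCtorEq, if_true, if_false, Sum.inl.injEq,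
      Sum.inr.injEq]
  have hi := Finset.mem_Icc.1 i.2
  have hj := Finset.mem_Icc.1 j.2
  simp only [Subtype.ext_iff]
  split_ifs <;> omega

theorem threeTriple_dual (i j k : ThreeRow q) :
    threeTriple q (threeDual q i) (threeDual q j) (threeDual q k) = threeTriple q i j k := by
  rcases i with _ | i | _ | _ | _ <;> rcases j with _ | j | _ | _ | _ <;>
    rcases k with _ | k | _ | _ | _ <;>
    simp only [threeTriple, threeDual, three_sub_inj, Subtype.mk.injEq, reduceCtorEq, if_true,
      if_false, Sum.inl.injEq, Sum.inr.injEq]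

noncomputable def threeData (h4 : q % 4 = 3) :
    TripleData (threeEntry q) (threeTriple q) (.inl ()) (threeDual q) where
  weight := threeWeight q
  card_eq := by
    simp only [Fintype.card_sum, Fintype.card_unit]
    omega
  row_one s := congrFun (threeEntry_one ()) s
  triple := threeMean_triple h4
  pairing i j := by
    rw [threeTriple_one]
    simp only [eq_comm]
  dual_triple := threeTriple_dual

/-- The rows are equal of degree `(q - 1) / 2`. -/
def ThreeSame (i j : ThreeRow q) : Prop := ∃ a, i = .inr (.inl a) ∧ j = .inr (.inl a)

/-- The rows are different of degree `(q - 1) / 2`. -/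
def ThreeDiff (i j : ThreeRow q) : Prop :=
  ∃ a b, a ≠ b ∧ i = .inr (.inl a) ∧ j = .inr (.inl b)

theorem threeTriple_prin_pos {i j : ThreeRow q} (hi : i ≠ .inl ()) (hj : j ≠ .inl ())
    (h : ¬ ThreeSame i j) (x : Finset.Icc 1 ((q - 3) / 4)) :
    1 ≤ threeTriple q i j (.inr (.inr (.inr (.inr x)))) := by
  rcases i with _ | a | a | _ | a <;> rcases j with _ | b | b | _ | b <;>
    first
    | exact absurd rfl hi
    | exact absurd rfl hj
    | (simp only [threeTriple]; omega)
    | (simp only [threeTriple]; split_ifs <;> omega)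
    | skip
  by_cases hab : a = b
  · exact absurd ⟨a, rfl, by rw [hab]⟩ h
  · simp [threeTriple, hab]

theorem threeTriple_same_disc (a : Finset.Icc 1 2) (x : Finset.Icc 1 ((q - 3) / 4)) :
    threeTriple q (.inr (.inl a)) (.inr (.inl a)) (.inr (.inr (.inl x))) = 1 := by
  simp [threeTriple]

/-- The supports are disjoint: two equal rows of half degree reach only a row of half degree and the
rows of degree q - 1, two different ones only the trivial row and those of degree q + 1. -/
theorem threeTriple_same_mul_diff (a b c : Finset.Icc 1 2) (h : b ≠ c) (k : ThreeRow q) :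
    threeTriple q (.inr (.inl a)) (.inr (.inl a)) k * threeTriple q (.inr (.inl b)) (.inr (.inl c)) k
      = 0 := by
  rcases k with _ | k | _ | _ | _ <;> simp [threeTriple, h]

/-- At most one row of degree q - 1 is missed. A miss occurs only for a row of half degree times a
row of degree q - 1 with parameter b, at the parameter (q + 1)/4 - b. The value z = 0 stands for no
exception, since parameters start at 1. -/
theorem threeTriple_disc_pos {i j : ThreeRow q} (hi : i ≠ .inl ()) (hj : j ≠ .inl ())
    (h : ¬ ThreeDiff i j) : ∃ z : ℕ, ∀ x : Finset.Icc 1 ((q - 3) / 4), (x : ℕ) ≠ z →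
      1 ≤ threeTriple q i j (.inr (.inr (.inl x))) := by
  have hr : ∀ x : Finset.Icc 1 ((q - 3) / 4), 0 < (x : ℕ) ∧ (x : ℕ) < (q + 1) / 4 := fun x => by
    have := Finset.mem_Icc.1 x.2
    omega
  rcases i with _ | a | a | _ | a <;> rcases j with _ | b | b | _ | b <;>
    first
    | exact absurd rfl hi
    | exact absurd rfl hj
    | (refine ⟨0, fun x _ => ?_⟩; simp only [threeTriple]; omega)
    | (refine ⟨0, fun x _ => ?_⟩; simp only [threeTriple]; split_ifs <;> omega)
    | skip
  · refine ⟨0, fun x _ => ?_⟩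
    by_cases hab : a = b
    · simp [threeTriple, hab]
    · exact absurd ⟨a, b, hab, rfl, rfl⟩ h
  · refine ⟨(q + 1) / 4 - b, fun x hx => ?_⟩
    have := hr b
    simp only [threeTriple]
    rw [if_neg (by omega)]
  · refine ⟨(q + 1) / 4 - a, fun x hx => ?_⟩
    have := hr a
    simp only [threeTriple]
    rw [if_neg (by omega)]
  · refine ⟨0, fun x _ => ?_⟩
    have := hr a
    have := hr b
    have := hr x
    have := signCount_le_one (n := (q + 1) / 2) (x := (a : ℕ)) (y := (b : ℕ)) (z := (x : ℕ))
      (by omega) (by omega) (by omega) (by omega) (by omega) (by omega)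
    simp only [threeTriple]
    omega

theorem threeTriple_sum_ne_one_of_same (hq : 19 ≤ q) {a₀ a₁ b₀ b₁ c₀ c₁ : ThreeRow q}
    (ha : ThreeSame a₀ a₁) (hb₀ : b₀ ≠ .inl ()) (hb₁ : b₁ ≠ .inl ()) (hc₀ : c₀ ≠ .inl ())
    (hc₁ : c₁ ≠ .inl ()) :
    ∑ k, threeTriple q a₀ a₁ k * threeTriple q b₀ b₁ k * threeTriple q c₀ c₁ k ≠ 1 := by
  obtain ⟨a, rfl, rfl⟩ := ha
  by_cases hb : ThreeDiff b₀ b₁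
  · obtain ⟨b, b', hbb, rfl, rfl⟩ := hb
    simp [threeTriple_same_mul_diff a b b' hbb]
  by_cases hc : ThreeDiff c₀ c₁
  · obtain ⟨c, c', hcc, rfl, rfl⟩ := hc
    simp [mul_right_comm _ (threeTriple q b₀ b₁ _), threeTriple_same_mul_diff a c c' hcc]
  obtain ⟨y, hy⟩ := threeTriple_disc_pos hb₀ hb₁ hb
  obtain ⟨z, hz⟩ := threeTriple_disc_pos hc₀ hc₁ hc
  -- Each of the two other products misses at most one row of degree q - 1. Since q ≥ 19 provides
  -- four of them, two common ones remain.
  obtain ⟨u, v, hu, hu', hv, hv', huv, huy, huz, hvy, hvz⟩ : ∃ u v : ℕ, 1 ≤ u ∧ u ≤ 4 ∧ 1 ≤ v ∧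
      v ≤ 4 ∧ u ≠ v ∧ u ≠ y ∧ u ≠ z ∧ v ≠ y ∧ v ≠ z := by
    have hcard : 1 < (Finset.Icc 1 4 \ {y, z}).card := by
      have h1 := Finset.le_card_sdiff {y, z} (Finset.Icc 1 4)
      have h2 := Finset.card_le_two (a := y) (b := z)
      simp only [Nat.card_Icc] at h1
      omega
    obtain ⟨u, hu, v, hv, huv⟩ := Finset.one_lt_card.1 hcard
    simp only [Finset.mem_sdiff, Finset.mem_Icc, Finset.mem_insert, Finset.mem_singleton,
      not_or] at hu hv
    exact ⟨u, v, hu.1.1, hu.1.2, hv.1.1, hv.1.2, huv, hu.2.1, hu.2.2, hv.2.1, hv.2.2⟩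
  have h : 2 ≤ ∑ k, threeTriple q (.inr (.inl a)) (.inr (.inl a)) k * threeTriple q b₀ b₁ k *
      threeTriple q c₀ c₁ k :=
    two_le_sum (x := .inr (.inr (.inl ⟨u, by simp; omega⟩)))
      (y := .inr (.inr (.inl ⟨v, by simp; omega⟩))) (by simpa using huv)
      (one_le_mul_mul (threeTriple_same_disc _ _).ge (hy _ huy) (hz _ huz))
      (one_le_mul_mul (threeTriple_same_disc _ _).ge (hy _ hvy) (hz _ hvz))
  omega

/-- Without a square of a row of half degree, all three products contain every row of degree q + 1,
and q ≥ 11 provides two of these. -/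
theorem threeTriple_same_of_sum_eq_one (hq : 11 ≤ q) {a₀ a₁ b₀ b₁ c₀ c₁ : ThreeRow q}
    (ha₀ : a₀ ≠ .inl ()) (ha₁ : a₁ ≠ .inl ()) (hb₀ : b₀ ≠ .inl ()) (hb₁ : b₁ ≠ .inl ())
    (hc₀ : c₀ ≠ .inl ()) (hc₁ : c₁ ≠ .inl ())
    (h : ∑ k, threeTriple q a₀ a₁ k * threeTriple q b₀ b₁ k * threeTriple q c₀ c₁ k = 1) :
    ThreeSame a₀ a₁ ∨ ThreeSame b₀ b₁ ∨ ThreeSame c₀ c₁ := by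
  by_contra! hne
  obtain ⟨ha, hb, hc⟩ := hne
  have hx := fun x => one_le_mul_mul (threeTriple_prin_pos ha₀ ha₁ ha x)
    (threeTriple_prin_pos hb₀ hb₁ hb x) (threeTriple_prin_pos hc₀ hc₁ hc x)
  have := two_le_sum (f := fun k => threeTriple q a₀ a₁ k * threeTriple q b₀ b₁ k *
      threeTriple q c₀ c₁ k) (x := .inr (.inr (.inr (.inr ⟨1, by simp; omega⟩))))
      (y := .inr (.inr (.inr (.inr ⟨2, by simp; omega⟩)))) (by simp) (hx _) (hx _)
  omega

/-- The sum in the one spectrum criterion, in terms of the triple multiplicities. -/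
theorem three_sum_eq {h4 : q % 4 = 3} {i₀ i₁ i₂ i₃ i₄ i₅ i₆ i₇ i₈ i₉ : ThreeRow q}
    (h : (threeData h4).toFusionRing.OneSpectrumSystem i₀ i₁ i₂ i₃ i₄ i₅ i₆ i₇ i₈ i₉) :
    ∑ k, threeTriple q i₄ i₇ k * threeTriple q (threeDual q i₅) i₈ k *
      threeTriple q i₆ (threeDual q i₉) k = 1 := by
  -- The structure constants carry a dual on the summation index, removed by reindexing.
  refine Eq.trans ?_ h.2.1
  exact Finset.sum_nbij' (threeDual q) (threeDual q) (by simp) (by simp)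
    (by simp [(threeData h4).dual_dual]) (by simp [(threeData h4).dual_dual])
    fun k _ => by simp [TripleData.toFusionRing, (threeData h4).dual_dual]

theorem three_ne_one {h4 : q % 4 = 3} {i₀ i₁ i₂ i₃ i₄ i₅ i₆ i₇ i₈ i₉ : ThreeRow q}
    (h : (threeData h4).toFusionRing.OneSpectrumSystem i₀ i₁ i₂ i₃ i₄ i₅ i₆ i₇ i₈ i₉) :
    i₄ ≠ .inl () ∧ i₇ ≠ .inl () ∧ threeDual q i₅ ≠ .inl () ∧ i₈ ≠ .inl () ∧ i₆ ≠ .inl () ∧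
      threeDual q i₉ ≠ .inl () := by
  obtain ⟨g4, g5, g6, g7, g8, g9⟩ := h.ne_one
  have hd : ∀ i : ThreeRow q, i ≠ .inl () → threeDual q i ≠ .inl () := fun i hi => by
    rcases i with _ | _ | _ | _ | _ <;> simp_all [threeDual]
  exact ⟨g4, g7, hd _ g5, g8, g6, hd _ g9⟩

theorem three_same_or {h4 : q % 4 = 3} (hq : 11 ≤ q) {i₀ i₁ i₂ i₃ i₄ i₅ i₆ i₇ i₈ i₉ : ThreeRow q}
    (h : (threeData h4).toFusionRing.OneSpectrumSystem i₀ i₁ i₂ i₃ i₄ i₅ i₆ i₇ i₈ i₉) :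
    ThreeSame i₄ i₇ ∨ ThreeSame (threeDual q i₅) i₈ ∨ ThreeSame i₆ (threeDual q i₉) := by
  obtain ⟨g4, g7, g5, g8, g6, g9⟩ := three_ne_one h
  exact threeTriple_same_of_sum_eq_one hq g4 g7 g5 g8 g6 g9 (three_sum_eq h)

theorem three_passes (h4 : q % 4 = 3) (hq : 19 ≤ q) :
    (threeData h4).toFusionRing.PassesOneSpectrumCriterion := by
  intro i₀ i₁ i₂ i₃ i₄ i₅ i₆ i₇ i₈ i₉ h
  obtain ⟨g4, g7, g5, g8, g6, g9⟩ := three_ne_one h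
  have hs := three_sum_eq h
  rcases three_same_or (by omega) h with h1 | h1 | h1
  · exact threeTriple_sum_ne_one_of_same hq h1 g5 g8 g6 g9 hs
  · simp only [mul_comm (threeTriple q i₄ i₇ _)] at hs
    exact threeTriple_sum_ne_one_of_same hq h1 g4 g7 g6 g9 hs
  · simp only [mul_comm _ (threeTriple q i₆ _ _), ← mul_assoc] at hs
    exact threeTriple_sum_ne_one_of_same hq h1 g4 g7 g5 g8 hs

end Three

/-! ### The criterion for q ≡ 1 mod 4: forcing the Steinberg row -/

section One

variable {q : ℕ}

theorem oneTriple_one (i j : OneRow q) (u : Unit) :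
    oneTriple q i j (.inl u) = if i = j then 1 else 0 := by
  rcases i with _ | i | _ | _ | _ <;> rcases j with _ | j | _ | _ | _ <;>
    simp only [oneTriple, reduceCtorEq, if_true, if_false, Sum.inl.injEq, Sum.inr.injEq]

theorem eq_of_oneTriple_one {i j : OneRow q} {u : Unit} (h : oneTriple q i j (.inl u) ≠ 0) :
    i = j := by
  rw [oneTriple_one] at h
  by_contra hne
  exact h (if_neg hne)

noncomputable def oneData (h4 : q % 4 = 1) (hq : 2 ≤ q) :
    TripleData (oneEntry q) (oneTriple q) (.inl ()) id where
  weight := oneWeight q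
  card_eq := by
    simp only [Fintype.card_sum, Fintype.card_unit]
    omega
  row_one s := congrFun (oneEntry_one ()) s
  triple := oneMean_triple h4 hq
  pairing i j := by
    rw [oneTriple_one]
    simp only [eq_comm, id]
  dual_triple _ _ _ := rfl

/-- The rows are equal of degree `(q + 1) / 2`. -/
def OneSame (i j : OneRow q) : Prop := ∃ a, i = .inr (.inl a) ∧ j = .inr (.inl a)

/-- The rows are different of degree `(q + 1) / 2`. -/
def OneDiff (i j : OneRow q) : Prop :=
  ∃ a b, a ≠ b ∧ i = .inr (.inl a) ∧ j = .inr (.inl b)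

theorem oneTriple_prin_pos {i j : OneRow q} (hi : i ≠ .inl ()) (hj : j ≠ .inl ())
    (h : ¬ OneDiff i j) (x : Finset.Icc 1 ((q - 5) / 4)) :
    1 ≤ oneTriple q i j (.inr (.inr (.inr (.inr x)))) := by
  rcases i with _ | a | a | _ | a <;> rcases j with _ | b | b | _ | b <;>
    first
    | exact absurd rfl hi
    | exact absurd rfl hj
    | (simp only [oneTriple]; omega)
    | (simp only [oneTriple]; split_ifs <;> omega)
    | skip
  by_cases hab : a = b
  · simp [oneTriple, hab]
  · exact absurd ⟨a, b, hab, rfl, rfl⟩ h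

theorem oneTriple_disc_pos {i j : OneRow q} (hi : i ≠ .inl ()) (hj : j ≠ .inl ())
    (h : ¬ OneSame i j) (x : Finset.Icc 1 ((q - 1) / 4)) :
    1 ≤ oneTriple q i j (.inr (.inr (.inl x))) := by
  rcases i with _ | a | a | _ | a <;> rcases j with _ | b | b | _ | b <;>
    first
    | exact absurd rfl hi
    | exact absurd rfl hj
    | (simp only [oneTriple]; omega)
    | (simp only [oneTriple]; split_ifs <;> omega)
    | skip
  · by_cases hab : a = b
    · exact absurd ⟨a, rfl, by rw [hab]⟩ h
    · simp [oneTriple, hab]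
  have ha := Finset.mem_Icc.1 a.2
  have hb := Finset.mem_Icc.1 b.2
  have hx := Finset.mem_Icc.1 x.2
  have := signCount_le_one (n := (q + 1) / 2) (x := (a : ℕ)) (y := (b : ℕ)) (z := (x : ℕ))
    (by omega) (by omega) (by omega) (by omega) (by omega) (by omega)
  simp only [oneTriple]
  omega

theorem oneTriple_st_pos {i j : OneRow q} (hi : i ≠ .inl ()) (hj : j ≠ .inl ()) :
    1 ≤ oneTriple q i j (.inr (.inr (.inr (.inl ())))) := by
  rcases i with _ | a | a | _ | a <;> rcases j with _ | b | b | _ | b <;>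
    first
    | exact absurd rfl hi
    | exact absurd rfl hj
    | (simp only [oneTriple]; omega)
    | (simp only [oneTriple]; split_ifs <;> omega)

/-- Equal rows of half degree reach no row of degree q - 1; different ones reach neither the trivial
row, nor one of half degree, nor one of degree q + 1. Only Steinberg is common. -/
theorem oneTriple_eq_st {a b c : Finset.Icc 1 2} {k : OneRow q} (h : b ≠ c)
    (h1 : oneTriple q (.inr (.inl a)) (.inr (.inl a)) k ≠ 0)
    (h2 : oneTriple q (.inr (.inl b)) (.inr (.inl c)) k ≠ 0) : k = .inr (.inr (.inr (.inl ()))) := by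
  rcases k with _ | k | _ | _ | _ <;> simp_all [oneTriple]

/-- Of two pairs of rows of degree `(q + 1) / 2`, exactly one has equal members. -/
def OneOpposite (a₀ a₁ b₀ b₁ : OneRow q) : Prop :=
  (OneSame a₀ a₁ ∧ OneDiff b₀ b₁) ∨ (OneDiff a₀ a₁ ∧ OneSame b₀ b₁)

theorem OneOpposite.eq_st {a₀ a₁ b₀ b₁ k : OneRow q} (h : OneOpposite a₀ a₁ b₀ b₁)
    (h0 : oneTriple q a₀ b₀ k ≠ 0) (h1 : oneTriple q a₁ b₁ k ≠ 0) :
    k = .inr (.inr (.inr (.inl ()))) := by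
  -- There are only two rows of half degree. So if one pair is constant and the other is not,
  -- exactly one of the cross pairs (a₀, b₀), (a₁, b₁) has equal members.
  have two : ∀ a b c : Finset.Icc 1 2, b ≠ c → a ≠ b → a = c := fun a b c h h' => by
    have ha := Finset.mem_Icc.1 a.2
    have hb := Finset.mem_Icc.1 b.2
    have hc := Finset.mem_Icc.1 c.2
    rw [Ne, Subtype.ext_iff] at h h'
    rw [Subtype.ext_iff]
    omega
  rcases h with ⟨⟨a, rfl, rfl⟩, b, c, hbc, rfl, rfl⟩ | ⟨⟨b, c, hbc, rfl, rfl⟩, a, rfl, rfl⟩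
  · by_cases hab : a = b
    · subst hab
      exact oneTriple_eq_st hbc h0 h1
    · obtain rfl := two a b c hbc hab
      exact oneTriple_eq_st hab h1 h0
  · by_cases hab : a = b
    · subst hab
      exact oneTriple_eq_st hbc.symm h0 h1
    · obtain rfl := two a b c hbc hab
      exact oneTriple_eq_st hbc h1 h0

theorem OneOpposite.symm {a₀ a₁ b₀ b₁ : OneRow q} (h : OneOpposite a₀ a₁ b₀ b₁) :
    OneOpposite b₀ b₁ a₀ a₁ := by
  rcases h with h | h
  · exact .inr h.symm
  · exact .inl h.symm

/-- The link k between the opposite pairs is Steinberg, and Steinberg occurs in every product of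
nontrivial rows. If l or m is trivial, the third pair coincides with one of the opposite ones, so
the remaining link is Steinberg as well. -/
theorem OneOpposite.triple_ne_zero (h4 : q % 4 = 1) (hq : 2 ≤ q)
    {a₀ a₁ b₀ b₁ c₀ c₁ k l m : OneRow q} (h : OneOpposite a₀ a₁ b₀ b₁)
    (k0 : oneTriple q a₀ b₀ k ≠ 0) (k1 : oneTriple q a₁ b₁ k ≠ 0)
    (l0 : oneTriple q a₀ c₀ l ≠ 0) (l1 : oneTriple q a₁ c₁ l ≠ 0)
    (m0 : oneTriple q b₀ c₀ m ≠ 0) (m1 : oneTriple q b₁ c₁ m ≠ 0) : oneTriple q k l m ≠ 0 := by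
  have d := oneData h4 hq
  rw [h.eq_st k0 k1, d.comm, d.comm_right]
  by_cases hl : l = .inl ()
  · subst hl
    obtain rfl := eq_of_oneTriple_one l0
    obtain rfl := eq_of_oneTriple_one l1
    rw [h.symm.eq_st m0 m1]
    simp [oneTriple]
  by_cases hm : m = .inl ()
  · subst hm
    obtain rfl := eq_of_oneTriple_one m0
    obtain rfl := eq_of_oneTriple_one m1
    rw [h.eq_st l0 l1]
    simp [oneTriple]
  exact Nat.one_le_iff_ne_zero.1 (oneTriple_st_pos hl hm)

/-- The pairs (i₄, i₇), (i₅, i₈), (i₆, i₉) are linked by i₂ (first and second), i₁ (first and third)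
and i₃ (second and third). Steinberg always contributes to the sum, so a sum of 1 excludes all rows
of degrees q - 1 and q + 1; this forces an equal pair and a different pair of half degree, and the
links then have nonzero multiplicity. -/
theorem one_passes (h4 : q % 4 = 1) (hq : 9 ≤ q) :
    (oneData h4 (by omega)).toFusionRing.PassesOneSpectrumCriterion := by
  intro i₀ i₁ i₂ i₃ i₄ i₅ i₆ i₇ i₈ i₉ h
  have hq2 : 2 ≤ q := by omega
  have d := oneData h4 hq2
  obtain ⟨g4, g5, g6, g7, g8, g9⟩ := h.ne_one
  obtain ⟨⟨h1, h2, h3, h5, h6, h7⟩, hs, -, h0, -⟩ := h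
  change oneTriple q _ _ _ ≠ 0 at h1 h2 h3 h5 h6 h7
  change oneTriple q i₂ i₁ i₃ = 0 at h0
  change ∑ k, oneTriple q i₄ i₇ k * oneTriple q i₅ i₈ k * oneTriple q i₆ i₉ k = 1 at hs
  have hst := one_le_mul_mul (oneTriple_st_pos g4 g7) (oneTriple_st_pos g5 g8)
    (oneTriple_st_pos g6 g9)
  have hsame : OneSame i₄ i₇ ∨ OneSame i₅ i₈ ∨ OneSame i₆ i₉ := by
    by_contra! hne
    obtain ⟨ha, hb, hc⟩ := hne
    have := two_le_sum (f := fun k => oneTriple q i₄ i₇ k * oneTriple q i₅ i₈ k *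
      oneTriple q i₆ i₉ k) (x := .inr (.inr (.inr (.inl ()))))
      (y := .inr (.inr (.inl ⟨1, by simp; omega⟩))) (by simp) hst
      (one_le_mul_mul (oneTriple_disc_pos g4 g7 ha _) (oneTriple_disc_pos g5 g8 hb _)
        (oneTriple_disc_pos g6 g9 hc _))
    omega
  have hdiff : OneDiff i₄ i₇ ∨ OneDiff i₅ i₈ ∨ OneDiff i₆ i₉ := by
    by_contra! hne
    obtain ⟨ha, hb, hc⟩ := hne
    have := two_le_sum (f := fun k => oneTriple q i₄ i₇ k * oneTriple q i₅ i₈ k *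
      oneTriple q i₆ i₉ k) (x := .inr (.inr (.inr (.inl ()))))
      (y := .inr (.inr (.inr (.inr ⟨1, by simp; omega⟩)))) (by simp) hst
      (one_le_mul_mul (oneTriple_prin_pos g4 g7 ha _) (oneTriple_prin_pos g5 g8 hb _)
        (oneTriple_prin_pos g6 g9 hc _))
    omega
  have hnot : ∀ i j : OneRow q, OneSame i j → OneDiff i j → False := by
    rintro i j ⟨a, rfl, rfl⟩ ⟨b, c, hbc, hb, hc⟩
    simp only [Sum.inr.injEq, Sum.inl.injEq] at hb hc
    exact hbc (hb ▸ hc)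
  have h1' : oneTriple q i₄ i₆ i₁ ≠ 0 := by rwa [d.comm_right]
  have h2' : oneTriple q i₄ i₅ i₂ ≠ 0 := by rwa [d.comm]
  have h6' : oneTriple q i₇ i₈ i₂ ≠ 0 := by rwa [d.comm_right, d.comm]
  have hab : ¬ OneOpposite i₄ i₇ i₅ i₈ := fun h => by
    exact h.triple_ne_zero h4 hq2 h2' h6' h1' h5 h3 h7 h0
  have hac : ¬ OneOpposite i₄ i₇ i₆ i₉ := fun h => by
    refine h.triple_ne_zero h4 hq2 h1' h5 h2' h6' ?_ ?_ ((d.comm _ _ _).trans h0)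
    · rwa [d.comm]
    · rwa [d.comm]
  have hbc : ¬ OneOpposite i₅ i₈ i₆ i₉ := fun h => by
    refine h.triple_ne_zero h4 hq2 (c₀ := i₄) (c₁ := i₇) (l := i₂) (m := i₁) h3 h7 h2 ?_ ?_ ?_ ?_
    · rwa [d.comm]
    · rwa [d.comm]
    · rwa [d.comm]
    · rwa [d.comm, d.comm_right]
  rcases hsame with hx | hx | hx <;> rcases hdiff with hy | hy | hy <;>
    first
    | exact hnot _ _ hx hy
    | exact hab (.inl ⟨hx, hy⟩)
    | exact hab (.inr ⟨hy, hx⟩)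
    | exact hac (.inl ⟨hx, hy⟩)
    | exact hac (.inr ⟨hy, hx⟩)
    | exact hbc (.inl ⟨hx, hy⟩)
    | exact hbc (.inr ⟨hy, hx⟩)

end One

end InterpolatedPSL2

/-! The definitions of this section are evaluated by the kernel: they use the functions on `ℕ` which
it implements directly. -/

/-- The `n`-bit block with index `(i, j)` in a table of bits. -/
def bitBlock (n t i j : ℕ) : ℕ :=
  Nat.mod (Nat.shiftRight t (Nat.mul n (Nat.add (Nat.mul n i) j))) (Nat.pow 2 n)

theorem beq_eq_false {m n : ℕ} (h : m ≠ n) : Nat.beq m n = false :=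
  Bool.eq_false_iff.2 fun h' => h (Nat.eq_of_beq_eq_true h')

/-- Exactly one bit is set. -/
def oneBit (x : ℕ) : Bool := cond (Nat.beq x 0) false (Nat.beq (Nat.land x (Nat.sub x 1)) 0)

/-- Subtracting 1 replaces the single set bit by the bits below it. Only this direction is needed:
the search may reject too little, never too much. -/
theorem oneBit_two_pow (k : ℕ) : oneBit (2 ^ k) = true := by
  have h : Nat.land (2 ^ k) (Nat.sub (2 ^ k) 1) = 0 := by
    change 2 ^ k &&& (2 ^ k - 1) = 0
    simp [Nat.and_two_pow_sub_one_eq_mod]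
  have h0 : Nat.beq (2 ^ k) 0 = false := beq_eq_false (by positivity)
  rw [oneBit, h, h0]
  rfl

/-- The bit of `x` with number `i`. -/
def bitAt (x i : ℕ) : Bool := Nat.beq (Nat.land 1 (Nat.shiftRight x i)) 1

theorem bitAt_eq_testBit (x i : ℕ) : bitAt x i = x.testBit i := by
  change Nat.beq (1 &&& (x >>> i)) 1 = (1 &&& (x >>> i) != 0)
  rw [Nat.one_and_eq_mod_two]
  rcases Nat.mod_two_eq_zero_or_one (x >>> i) with h | h <;> rw [h] <;> rfl

theorem land_eq_and (x y : ℕ) : Nat.land x y = x &&& y := rfl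

/-- `f x`, with `x` evaluated first. -/
def evalFirst (x : ℕ) (f : ℕ → Bool) : Bool := Nat.rec (f 0) (fun m _ => f (Nat.succ m)) x

theorem evalFirst_eq (x : ℕ) (f : ℕ → Bool) : evalFirst x f = f x := by
  cases x <;> rfl

/-- `p i` holds for all `i < n`. -/
def allBelow (n : ℕ) (p : ℕ → Bool) : Bool := Nat.rec true (fun i h => cond (p i) h false) n

theorem of_allBelow {n : ℕ} {p : ℕ → Bool} (h : allBelow n p = true) {i : ℕ} (hi : i < n) :
    p i = true := by
  induction n with
  | zero => omega
  | succ n ih =>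
    change cond (p n) (allBelow n p) false = true at h
    rcases hp : p n
    · simp [hp] at h
    · rw [hp, cond_true] at h
      rcases Nat.lt_succ_iff_lt_or_eq.1 hi with hi | rfl
      exacts [ih h hi, hp]

/-- `p i j` holds for all `0 < i, j ≤ n`. -/
def allPos (n : ℕ) (p : ℕ → ℕ → Bool) : Bool :=
  allBelow n fun i => allBelow n fun j => p (Nat.succ i) (Nat.succ j)

/-- The one spectrum system has no solution for the ring whose products have supports `S` and sets
of multiplicity-one constituents `O`. Here `qa`, `qb`, `qc` quantify over the pairs `(i₄, i₇)`,
`(i₅, i₈)`, `(i₆, i₉)`. -/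
def maskCheck (n : ℕ) (S O : ℕ → ℕ → ℕ) (d : ℕ → ℕ) (qa qb qc : (ℕ → ℕ → Bool) → Bool) : Bool :=
  qa fun i₄ i₇ =>
  evalFirst (S i₄ i₇) fun A =>
  qb fun i₅ i₈ =>
  evalFirst (S (d i₅) i₈) fun B => evalFirst (Nat.land A B) fun AB =>
  qc fun i₆ i₉ =>
  evalFirst (S i₆ (d i₉)) fun C => evalFirst (Nat.land AB C) fun ABC =>
  cond (oneBit ABC) (
  allBelow n fun i₀ => cond (bitAt ABC i₀) (
  cond (bitAt (Nat.land (Nat.land (O i₄ i₇) (O (d i₅) i₈)) (O i₆ (d i₉))) i₀) (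
  allBelow n fun i₁ => cond (bitAt (S i₄ i₁) i₆) (cond (bitAt (S i₇ i₉) i₁) (
  cond (oneBit (Nat.land A C) || (oneBit (Nat.land (S i₀ (d i₇)) (S i₆ (d i₁)))
    || oneBit (Nat.land (S (d i₄) i₀) (S i₁ (d i₉))))) (
  allBelow n fun i₂ => cond (bitAt (S i₅ i₄) i₂) (cond (bitAt (S i₂ i₇) i₈) (
  cond (oneBit (Nat.land (S i₅ i₄) (S i₈ (d i₇))) ||
    (oneBit (Nat.land (S i₂ (d i₄)) (S i₈ (d i₀)))
    || oneBit (Nat.land (S (d i₅) i₂) (S i₀ (d i₇))))) (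
  allBelow n fun i₃ => cond (bitAt (S i₅ i₆) i₃) (cond (bitAt (S i₈ i₉) i₃) (
  cond (bitAt (S i₂ i₁) i₃) true
    (!(oneBit (Nat.land (S i₅ i₀) (S i₃ (d i₉))) ||
      (oneBit (Nat.land (S i₈ (d i₀)) (S i₃ (d i₆)))
      || oneBit (Nat.land B C)))))
  true) true) true) true) true) true) true) true) true) true) true

/-! ### Soundness of the bit-mask search -/

namespace FusionRing

variable {ι : Type*} [Fintype ι] [DecidableEq ι]

/-- Supports and multiplicity-one constituents of all products, as bit masks with respect to a
numbering `e` of the basis. -/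
structure Masks (R : FusionRing ι) (n : ℕ) (S O : ℕ → ℕ → ℕ) (d : ℕ → ℕ) (e : ι → ℕ) : Prop where
  lt : ∀ i, e i < n
  inj : ∀ i j, e i = e j → i = j
  surj : ∀ b < n, ∃ i, e i = b
  dual : ∀ i, e (R.dual i) = d (e i)
  support_lt : ∀ i j, S (e i) (e j) < 2 ^ n
  support : ∀ i j k, (S (e i) (e j)).testBit (e k) = decide (R.N i j k ≠ 0)
  ones : ∀ i j k, (O (e i) (e j)).testBit (e k) = decide (R.N i j k = 1)

variable {R : FusionRing ι} {n : ℕ} {S O : ℕ → ℕ → ℕ} {d : ℕ → ℕ} {e : ι → ℕ}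

/-- A sum of natural numbers equal to 1 has exactly one nonzero term. The bound on x excludes stray
bits that number no basis element. -/
theorem eq_two_pow_of_sum_eq_one (hlt : ∀ i, e i < n) (inj : ∀ i j, e i = e j → i = j)
    (surj : ∀ b < n, ∃ i, e i = b) {x : ℕ} (hx : x < 2 ^ n) {f : ι → ℕ}
    (hf : ∀ k, x.testBit (e k) = decide (f k ≠ 0)) (hs : ∑ k, f k = 1) :
    ∃ k, f k ≠ 0 ∧ x = 2 ^ e k := by
  obtain ⟨k, -, hk⟩ := Finset.exists_ne_zero_of_sum_ne_zero (hs ▸ one_ne_zero)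
  refine ⟨k, hk, Nat.eq_of_testBit_eq fun b => ?_⟩
  rw [Nat.testBit_two_pow]
  by_cases hb : b < n
  · obtain ⟨l, rfl⟩ := surj b hb
    rw [hf]
    by_cases hkl : k = l
    · simp [hkl ▸ hk, hkl]
    · have h0 : f l = 0 := by
        by_contra hl
        have := InterpolatedPSL2.two_le_sum hkl (Nat.one_le_iff_ne_zero.2 hk)
          (Nat.one_le_iff_ne_zero.2 hl)
        omega
      have : e k ≠ e l := fun h => hkl (inj _ _ h)
      simp [h0, this]
  · have := hlt k
    rw [Nat.testBit_lt_two_pow (hx.trans_le (Nat.pow_le_pow_right two_pos (by omega)))]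
    simp
    omega

theorem Masks.oneBit_pairSum (m : R.Masks n S O d e) {a b a' b' : ι}
    (h : R.pairSum a b a' b' = 1) : oneBit (S (e a) (e b) &&& S (e a') (e b')) = true := by
  obtain ⟨k, -, hk⟩ := eq_two_pow_of_sum_eq_one m.lt m.inj m.surj
    (x := S (e a) (e b) &&& S (e a') (e b')) (Nat.and_lt_two_pow _ (m.support_lt _ _))
    (fun k => by simp [m.support]) h
  rw [hk, oneBit_two_pow]

theorem Masks.oneBit_tripleSum (m : R.Masks n S O d e) {a b a' b' a'' b'' : ι}
    (h : ∑ k, R.N a b k * R.N a' b' k * R.N a'' b'' k = 1) :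
    oneBit (S (e a) (e b) &&& S (e a') (e b') &&& S (e a'') (e b'')) = true := by
  obtain ⟨k, -, hk⟩ := eq_two_pow_of_sum_eq_one m.lt m.inj m.surj
    (x := S (e a) (e b) &&& S (e a') (e b') &&& S (e a'') (e b''))
    (Nat.and_lt_two_pow _ (m.support_lt _ _))
    (fun k => by simp [m.support, and_assoc, Bool.and_assoc]) h
  rw [hk, oneBit_two_pow]

theorem Masks.testBit (m : R.Masks n S O d e) {i j k : ι} (h : R.N i j k ≠ 0) :
    (S (e i) (e j)).testBit (e k) = true := by
  rw [m.support, decide_eq_true h]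

/-- The neutral element has number 0, so nontrivial rows have the positive numbers over which
`allPos` ranges. -/
theorem Masks.of_allPos (m : R.Masks (n + 1) S O d e) (h1 : e R.one = 0) {i j : ι}
    (hi : i ≠ R.one) (hj : j ≠ R.one) (p : ℕ → ℕ → Bool) (h : allPos n p = true) :
    p (e i) (e j) = true := by
  have hpos : ∀ i, i ≠ R.one → e i ≠ 0 := fun i hi h => hi (m.inj _ _ (h.trans h1.symm))
  obtain ⟨a, ha⟩ := Nat.exists_eq_succ_of_ne_zero (hpos i hi)
  obtain ⟨b, hb⟩ := Nat.exists_eq_succ_of_ne_zero (hpos j hj)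
  have h2 := m.lt i
  have h3 := m.lt j
  rw [ha, hb]
  exact of_allBelow (of_allBelow h (by omega : a < n)) (by omega : b < n)

/-- The search tests a relaxation: each condition that a sum equals 1 is weakened to a support with
exactly one element. Absence of solutions of the relaxed system is enough. -/
theorem Masks.not_system (m : R.Masks n S O d e) {qa qb qc : (ℕ → ℕ → Bool) → Bool}
    (hc : maskCheck n S O d qa qb qc = true) {i₀ i₁ i₂ i₃ i₄ i₅ i₆ i₇ i₈ i₉ : ι}
    (ha : ∀ p, qa p = true → p (e i₄) (e i₇) = true)
    (hb : ∀ p, qb p = true → p (e i₅) (e i₈) = true)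
    (hcc : ∀ p, qc p = true → p (e i₆) (e i₉) = true) :
    ¬ R.OneSpectrumSystem i₀ i₁ i₂ i₃ i₄ i₅ i₆ i₇ i₈ i₉ := by
  rintro ⟨⟨h1, h2, h3, h4, h5, h6⟩, hs, ⟨o1, o2, o3⟩, h0, c1, c2, c3⟩
  have hX := m.oneBit_tripleSum hs
  have hone : ∀ {x y z : Prop} {a b c : Bool}, (x → a = true) → (y → b = true) → (z → c = true) →
      x ∨ y ∨ z → (a || (b || c)) = true := by
    intro x y z a b c ha hb hc h
    rcases h with h | h | h
    · simp [ha h]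
    · simp [hb h]
    · simp [hc h]
  have c1' := hone m.oneBit_pairSum m.oneBit_pairSum m.oneBit_pairSum c1
  have c2' := hone m.oneBit_pairSum m.oneBit_pairSum m.oneBit_pairSum c2
  have c3' := hone m.oneBit_pairSum m.oneBit_pairSum m.oneBit_pairSum c3
  simp only [maskCheck, evalFirst_eq, bitAt_eq_testBit, land_eq_and] at hc
  have key := hcc _ (hb _ (ha _ hc))
  simp only [← m.dual] at key
  rw [hX, cond_true] at key
  -- The nested conditions are discharged in the order of the search; at the innermost leaf N i₂ i₁
  -- i₃ = 0 selects the branch that denies `c2'`.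
  replace key := of_allBelow key (m.lt i₀)
  rw [show (S (e i₄) (e i₇) &&& S (e (R.dual i₅)) (e i₈) &&& S (e i₆) (e (R.dual i₉))).testBit
      (e i₀) = true by simp [m.support, o1, o2, o3], cond_true,
    show (O (e i₄) (e i₇) &&& O (e (R.dual i₅)) (e i₈) &&& O (e i₆) (e (R.dual i₉))).testBit
      (e i₀) = true by simp [m.ones, o1, o2, o3], cond_true] at key
  replace key := of_allBelow key (m.lt i₁)
  simp only [← m.dual] at key
  rw [m.testBit h1, m.testBit h4, cond_true, cond_true, c3', cond_true] at key
  replace key := of_allBelow key (m.lt i₂)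
  rw [m.testBit h2, m.testBit h5, cond_true, cond_true, c1', cond_true] at key
  replace key := of_allBelow key (m.lt i₃)
  rw [m.testBit h3, m.testBit h6, cond_true, cond_true, m.support, decide_eq_false (by simp [h0]),
    cond_false, c2'] at key
  exact Bool.noConfusion key

theorem Masks.passes (m : R.Masks (n + 1) S O d e) (h1 : e R.one = 0)
    (hc : maskCheck (n + 1) S O d (allPos n) (allPos n) (allPos n) = true) :
    R.PassesOneSpectrumCriterion := by
  intro i₀ i₁ i₂ i₃ i₄ i₅ i₆ i₇ i₈ i₉ h
  obtain ⟨h4, h5, h6, h7, h8, h9⟩ := h.ne_one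
  exact m.not_system hc (m.of_allPos h1 h4 h7) (m.of_allPos h1 h5 h8) (m.of_allPos h1 h6 h9) h

end FusionRing

/-! ### The small values of q -/

namespace InterpolatedPSL2

/-- The position of a row in the table, for `q` even. -/
def evenIndex (q : ℕ) : EvenRow q → ℕ
  | .inl _ => 0
  | .inr (.inl c) => c
  | .inr (.inr (.inl _)) => 1 + q / 2
  | .inr (.inr (.inr c)) => 1 + q / 2 + c

/-- The position of a row in the table, for `q ≡ 1 mod 4`. -/
def oneIndex (q : ℕ) : OneRow q → ℕ
  | .inl _ => 0
  | .inr (.inl c) => c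
  | .inr (.inr (.inl c)) => 2 + c
  | .inr (.inr (.inr (.inl _))) => 3 + (q - 1) / 4
  | .inr (.inr (.inr (.inr c))) => 3 + (q - 1) / 4 + c

/-- The position of a row in the table, for `q ≡ -1 mod 4`. -/
def threeIndex (q : ℕ) : ThreeRow q → ℕ
  | .inl _ => 0
  | .inr (.inl c) => c
  | .inr (.inr (.inl c)) => 2 + c
  | .inr (.inr (.inr (.inl _))) => 3 + (q - 3) / 4
  | .inr (.inr (.inr (.inr c))) => 3 + (q - 3) / 4 + c

/-- Exchange of `1` and `2`. -/
def swapOneTwo (i : ℕ) : ℕ := cond (Nat.beq i 1) 2 (cond (Nat.beq i 2) 1 i)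

/-- Supports of the products for `q = 2`. -/
def twoSupport : ℕ → ℕ → ℕ := bitBlock 3
  0x7921511

/-- Constituents of multiplicity one of the products for `q = 2`. -/
def twoOnes : ℕ → ℕ → ℕ := bitBlock 3
  0x7921511

theorem masks_two : (evenData (q := 2) (by norm_num) (by norm_num)).toFusionRing.Masks 3
    twoSupport twoOnes id (evenIndex 2) where
  lt := by decide +kernel
  inj := by decide +kernel
  surj := by decide +kernel
  dual := by
    change ∀ i, evenIndex 2 (i) = id (evenIndex 2 i)
    decide +kernel
  support_lt := by decide +kernel
  support := by
    -- Restated through `evenTriple`, the statement involves only natural numbers and finite types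
    -- and can be decided by evaluation.
    change ∀ i j k, (twoSupport (evenIndex 2 i) (evenIndex 2 j)).testBit (evenIndex 2 k) =
      decide (evenTriple 2 i j k ≠ 0)
    decide +kernel
  ones := by
    change ∀ i j k, (twoOnes (evenIndex 2 i) (evenIndex 2 j)).testBit (evenIndex 2 k) =
      decide (evenTriple 2 i j k = 1)
    decide +kernel

theorem passes_two : (evenData (q := 2) (by norm_num) (by norm_num)).toFusionRing.PassesOneSpectrumCriterion :=
  masks_two.passes rfl (by decide +kernel)

/-- Supports of the products for `q = 4`. -/
def fourSupport : ℕ → ℕ → ℕ := bitBlock 5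
  0x1ff7bd0f7f5c47b55c13dcc4c5041041

/-- Constituents of multiplicity one of the products for `q = 4`. -/
def fourOnes : ℕ → ℕ → ℕ := bitBlock 5
  0x777bd077f5c47b55c13dcc4c5041041

theorem masks_four : (evenData (q := 4) (by norm_num) (by norm_num)).toFusionRing.Masks 5
    fourSupport fourOnes id (evenIndex 4) where
  lt := by decide +kernel
  inj := by decide +kernel
  surj := by decide +kernel
  dual := by
    change ∀ i, evenIndex 4 (i) = id (evenIndex 4 i)
    decide +kernel
  support_lt := by decide +kernel
  support := by
    change ∀ i j k, (fourSupport (evenIndex 4 i) (evenIndex 4 j)).testBit (evenIndex 4 k) =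
      decide (evenTriple 4 i j k ≠ 0)
    decide +kernel
  ones := by
    change ∀ i j k, (fourOnes (evenIndex 4 i) (evenIndex 4 j)).testBit (evenIndex 4 k) =
      decide (evenTriple 4 i j k = 1)
    decide +kernel

theorem passes_four : (evenData (q := 4) (by norm_num) (by norm_num)).toFusionRing.PassesOneSpectrumCriterion :=
  masks_four.passes rfl (by decide +kernel)

/-- Supports of the products for `q = 5`. -/
def fiveSupport : ℕ → ℕ → ℕ := bitBlock 5
  0x1ff7bd0f7f5c47b55c13dcc4c5041041

/-- Constituents of multiplicity one of the products for `q = 5`. -/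
def fiveOnes : ℕ → ℕ → ℕ := bitBlock 5
  0x777bd077f5c47b55c13dcc4c5041041

/-- The masks agree with those for q = 4, reflecting the isomorphism of PSL(2,4) and PSL(2,5). -/
theorem masks_five : (oneData (q := 5) (by norm_num) (by norm_num)).toFusionRing.Masks 5
    fiveSupport fiveOnes id (oneIndex 5) where
  lt := by decide +kernel
  inj := by decide +kernel
  surj := by decide +kernel
  dual := by
    change ∀ i, oneIndex 5 (i) = id (oneIndex 5 i)
    decide +kernel
  support_lt := by decide +kernel
  support := by
    change ∀ i j k, (fiveSupport (oneIndex 5 i) (oneIndex 5 j)).testBit (oneIndex 5 k) =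
      decide (oneTriple 5 i j k ≠ 0)
    decide +kernel
  ones := by
    change ∀ i j k, (fiveOnes (oneIndex 5 i) (oneIndex 5 j)).testBit (oneIndex 5 k) =
      decide (oneTriple 5 i j k = 1)
    decide +kernel

theorem passes_five : (oneData (q := 5) (by norm_num) (by norm_num)).toFusionRing.PassesOneSpectrumCriterion :=
  masks_five.passes rfl (by decide +kernel)

/-- Supports of the products for `q = 3`. -/
def threeSupport : ℕ → ℕ → ℕ := bitBlock 4
  0xf888821481428421

/-- Constituents of multiplicity one of the products for `q = 3`. -/
def threeOnes : ℕ → ℕ → ℕ := bitBlock 4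
  0x7888821481428421

theorem masks_three : (threeData (q := 3) (by norm_num)).toFusionRing.Masks 4
    threeSupport threeOnes swapOneTwo (threeIndex 3) where
  lt := by decide +kernel
  inj := by decide +kernel
  surj := by decide +kernel
  dual := by
    change ∀ i, threeIndex 3 (threeDual 3 i) = swapOneTwo (threeIndex 3 i)
    decide +kernel
  support_lt := by decide +kernel
  support := by
    change ∀ i j k, (threeSupport (threeIndex 3 i) (threeIndex 3 j)).testBit (threeIndex 3 k) =
      decide (threeTriple 3 i j (threeDual 3 k) ≠ 0)
    decide +kernel
  ones := by
    change ∀ i j k, (threeOnes (threeIndex 3 i) (threeIndex 3 j)).testBit (threeIndex 3 k) =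
      decide (threeTriple 3 i j (threeDual 3 k) = 1)
    decide +kernel

theorem passes_three : (threeData (q := 3) (by norm_num)).toFusionRing.PassesOneSpectrumCriterion :=
  masks_three.passes rfl (by decide +kernel)

/-- Supports of the products for `q = 7`. -/
def sevenSupport : ℕ → ℕ → ℕ := bitBlock 6
  0xffefbcea0fbffb8e10fbee72d08f38c8a844eb8d21302810204081

/-- Constituents of multiplicity one of the products for `q = 7`. -/
def sevenOnes : ℕ → ℕ → ℕ := bitBlock 6
  0x1c61bcea01873b8e1018e472d08f38c8a844eb8d21302810204081

theorem masks_seven : (threeData (q := 7) (by norm_num)).toFusionRing.Masks 6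
    sevenSupport sevenOnes swapOneTwo (threeIndex 7) where
  lt := by decide +kernel
  inj := by decide +kernel
  surj := by decide +kernel
  dual := by
    change ∀ i, threeIndex 7 (threeDual 7 i) = swapOneTwo (threeIndex 7 i)
    decide +kernel
  support_lt := by decide +kernel
  support := by
    change ∀ i j k, (sevenSupport (threeIndex 7 i) (threeIndex 7 j)).testBit (threeIndex 7 k) =
      decide (threeTriple 7 i j (threeDual 7 k) ≠ 0)
    decide +kernel
  ones := by
    change ∀ i j k, (sevenOnes (threeIndex 7 i) (threeIndex 7 j)).testBit (threeIndex 7 k) =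
      decide (threeTriple 7 i j (threeDual 7 k) = 1)
    decide +kernel

theorem passes_seven : (threeData (q := 7) (by norm_num)).toFusionRing.PassesOneSpectrumCriterion :=
  masks_seven.passes rfl (by decide +kernel)

/-- Supports of the products for `q = 11`. -/
def elevenSupport : ℕ → ℕ → ℕ := bitBlock 8
  0xfffefefefefcfa80fefffefefefcfa40fefefffefef8f820fefefefff8f2f410fefefef8ffeaec08fcfcf8f2ea1ac104fafaf8f4ecc11c028040201008040201

/-- Constituents of multiplicity one of the products for `q = 11`. -/
def elevenOnes : ℕ → ℕ → ℕ := bitBlock 8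
  0x706060606fcfa800607060606fcfa40060607160ef8f8200606163708f2f41006060e0837eaec08fcfcf8f2ea1ac104fafaf8f4ecc11c028040201008040201

theorem masks_eleven : (threeData (q := 11) (by norm_num)).toFusionRing.Masks 8
    elevenSupport elevenOnes swapOneTwo (threeIndex 11) where
  lt := by decide +kernel
  inj := by decide +kernel
  surj := by decide +kernel
  dual := by
    change ∀ i, threeIndex 11 (threeDual 11 i) = swapOneTwo (threeIndex 11 i)
    decide +kernel
  support_lt := by decide +kernel
  support := by
    change ∀ i j k, (elevenSupport (threeIndex 11 i) (threeIndex 11 j)).testBit (threeIndex 11 k) =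
      decide (threeTriple 11 i j (threeDual 11 k) ≠ 0)
    decide +kernel
  ones := by
    change ∀ i j k, (elevenOnes (threeIndex 11 i) (threeIndex 11 j)).testBit (threeIndex 11 k) =
      decide (threeTriple 11 i j (threeDual 11 k) = 1)
    decide +kernel

/-- Supports of the products for `q = 15`. -/
def fifteenSupport : ℕ → ℕ → ℕ := bitBlock 10
  0xffffeffbfeffbfeffbfcfea00ffbffffbfeffbfeffbfcfe900ffbfeffffeffbfeffbfcfe880ffbfeffbffffbfeffbf8fe040ffbfeffbfeffffefe3f2fd020ffbfeffbfeffbf9ffbeafb010ffbfeffbfefe3fefffdaf7008ff3fcff3f8fcbeaf683ae0404febfafebf8fd3ecf73810f0028010020040080100200400801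

/-- Constituents of multiplicity one of the products for `q = 15`. -/
def fifteenOnes : ℕ → ℕ → ℕ := bitBlock 10
  0x1c06018060180601bfcfea0001807018060180601bfcfe9000180601c060180601bfcfe88001806018070981603bf8fe040018060182615c2e043f2fd02001806018160b8410bbeafb010018060180e0402e15fdaf7008ff3fcff3f8fcbeaf683ae0404febfafebf8fd3ecf73810f0028010020040080100200400801

theorem masks_fifteen : (threeData (q := 15) (by norm_num)).toFusionRing.Masks 10
    fifteenSupport fifteenOnes swapOneTwo (threeIndex 15) where
  lt := by decide +kernel
  inj := by decide +kernel
  surj := by decide +kernel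
  dual := by
    change ∀ i, threeIndex 15 (threeDual 15 i) = swapOneTwo (threeIndex 15 i)
    decide +kernel
  support_lt := by decide +kernel
  support := by
    change ∀ i j k, (fifteenSupport (threeIndex 15 i) (threeIndex 15 j)).testBit (threeIndex 15 k) =
      decide (threeTriple 15 i j (threeDual 15 k) ≠ 0)
    decide +kernel
  ones := by
    change ∀ i j k, (fifteenOnes (threeIndex 15 i) (threeIndex 15 j)).testBit (threeIndex 15 k) =
      decide (threeTriple 15 i j (threeDual 15 k) = 1)
    decide +kernel

theorem threeIndex_half {q : ℕ} (a : Finset.Icc 1 2) :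
    threeIndex q (.inr (.inl a)) = 1 ∧ threeIndex q (threeDual q (.inr (.inl a))) = 2 ∨
      threeIndex q (.inr (.inl a)) = 2 ∧ threeIndex q (threeDual q (.inr (.inl a))) = 1 := by
  have := Finset.mem_Icc.1 a.2
  simp only [threeIndex, threeDual]
  omega

/-- The condition on the two pairs of numbers of a row of degree `(q - 1) / 2` with itself. -/
def onSameHalf (p : ℕ → ℕ → Bool) : Bool := cond (p 1 1) (p 2 2) false

/-- The condition on the two pairs of numbers of different rows of degree `(q - 1) / 2`. -/
def onDiffHalf (p : ℕ → ℕ → Bool) : Bool := cond (p 1 2) (p 2 1) false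

theorem of_onSameHalf {q : ℕ} {i j : ThreeRow q} (h : ThreeSame i j) (p : ℕ → ℕ → Bool)
    (hp : onSameHalf p = true) : p (threeIndex q i) (threeIndex q j) = true := by
  obtain ⟨a, rfl, rfl⟩ := h
  cases h1 : p 1 1 <;> rw [onSameHalf, h1] at hp
  · exact absurd hp (by simp)
  · rcases threeIndex_half (q := q) a with h | h <;> rw [h.1]
    exacts [h1, hp]

theorem of_onDiffHalf {q : ℕ} {h4 : q % 4 = 3} {i j : ThreeRow q}
    (h : ThreeSame i (threeDual q j)) (p : ℕ → ℕ → Bool) (hp : onDiffHalf p = true) :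
    p (threeIndex q i) (threeIndex q j) = true ∧ p (threeIndex q j) (threeIndex q i) = true := by
  obtain ⟨a, rfl, hj⟩ := h
  obtain rfl : threeDual q (.inr (.inl a)) = j := by rw [← hj, (threeData h4).dual_dual]
  cases h1 : p 1 2 <;> rw [onDiffHalf, h1] at hp
  · exact absurd hp (by simp)
  · rcases threeIndex_half (q := q) a with h | h <;> rw [h.1, h.2]
    exacts [⟨h1, hp⟩, ⟨hp, h1⟩]

/-- By `three_same_or` one of the three pairs is a pair of equal rows of half degree, up to a dual.
Three searches, each with one pair restricted to two choices, replace the search over all six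
indices. For the second and third pairs the dual turns equal rows into different ones, hence
`onDiffHalf`. -/
theorem three_passes_of_masks {q n : ℕ} {h4 : q % 4 = 3} (hq : 11 ≤ q) {S O : ℕ → ℕ → ℕ}
    {d : ℕ → ℕ} (m : (threeData h4).toFusionRing.Masks (n + 1) S O d (threeIndex q))
    (ha : maskCheck (n + 1) S O d onSameHalf (allPos n) (allPos n) = true)
    (hb : maskCheck (n + 1) S O d (allPos n) onDiffHalf (allPos n) = true)
    (hc : maskCheck (n + 1) S O d (allPos n) (allPos n) onDiffHalf = true) :
    (threeData h4).toFusionRing.PassesOneSpectrumCriterion := by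
  intro i₀ i₁ i₂ i₃ i₄ i₅ i₆ i₇ i₈ i₉ h
  obtain ⟨g4, g5, g6, g7, g8, g9⟩ := h.ne_one
  have ha' := fun p => m.of_allPos rfl g4 g7 p
  have hb' := fun p => m.of_allPos rfl g5 g8 p
  have hc' := fun p => m.of_allPos rfl g6 g9 p
  rcases three_same_or hq h with h1 | h1 | h1
  · exact m.not_system ha (of_onSameHalf h1) hb' hc' h
  · obtain ⟨a, h5, h8⟩ := h1
    have h1 : ThreeSame i₈ (threeDual q i₅) := ⟨a, h8, h5⟩
    exact m.not_system hb ha' (fun p hp => (of_onDiffHalf (h4 := h4) h1 p hp).2) hc' h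
  · exact m.not_system hc ha' hb' (fun p hp => (of_onDiffHalf (h4 := h4) h1 p hp).1) h

theorem passes_eleven :
    (threeData (q := 11) (by norm_num)).toFusionRing.PassesOneSpectrumCriterion :=
  three_passes_of_masks (by norm_num) masks_eleven (by decide +kernel) (by decide +kernel)
    (by decide +kernel)

theorem passes_fifteen :
    (threeData (q := 15) (by norm_num)).toFusionRing.PassesOneSpectrumCriterion :=
  three_passes_of_masks (by norm_num) masks_fifteen (by decide +kernel) (by decide +kernel)
    (by decide +kernel)

end InterpolatedPSL2

/-! ### Assembly of the three congruence cases -/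

namespace InterpolatedPSL2

/-- There is exactly one fusion ring whose eigentable is the given table, and it passes the one
spectrum criterion. -/
def UniquePassing (T : FormalTable) : Prop :=
  (∃! R : FusionRing T.Row, R.IsEigentable T.entry) ∧
    ∀ R : FusionRing T.Row, R.IsEigentable T.entry → R.PassesOneSpectrumCriterion

theorem TripleData.uniquePassing {T : FormalTable} {M : T.Row → T.Row → T.Row → ℕ} {one : T.Row}
    {dual : T.Row → T.Row} (d : TripleData T.entry M one dual)
    (h : d.toFusionRing.PassesOneSpectrumCriterion) : UniquePassing T :=
  ⟨d.existsUnique, fun _ hR => d.eq_toFusionRing hR ▸ h⟩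

theorem uniquePassing_evenTable {q : ℕ} (hq : 2 ≤ q) (h2 : q % 2 = 0) :
    UniquePassing (evenTable q) := by
  refine TripleData.uniquePassing (T := evenTable q) (evenData hq h2) ?_
  by_cases h6 : 6 ≤ q
  · exact even_passes h6 h2 (evenData hq h2).isEigentable
  · obtain rfl | rfl : q = 2 ∨ q = 4 := by omega
    exacts [passes_two, passes_four]

theorem uniquePassing_threeTable {q : ℕ} (h4 : q % 4 = 3) : UniquePassing (threeTable q) := by
  refine TripleData.uniquePassing (T := threeTable q) (threeData h4) ?_
  by_cases h19 : 19 ≤ q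
  · exact three_passes h4 h19
  · obtain rfl | rfl | rfl | rfl : q = 3 ∨ q = 7 ∨ q = 11 ∨ q = 15 := by omega
    exacts [passes_three, passes_seven, passes_eleven, passes_fifteen]

theorem uniquePassing_oneTable {q : ℕ} (hq : 2 ≤ q) (h4 : q % 4 = 1) :
    UniquePassing (oneTable q) := by
  refine TripleData.uniquePassing (T := oneTable q) (oneData h4 hq) ?_
  by_cases h9 : 9 ≤ q
  · exact one_passes h4 h9
  · obtain rfl : q = 5 := by omega
    exact passes_five

theorem uniquePassing_table {q : ℕ} (hq : 2 ≤ q) : UniquePassing (table q) := by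
  unfold table
  split_ifs with h2 h4
  · exact uniquePassing_evenTable hq h2
  · exact uniquePassing_threeTable h4
  · exact uniquePassing_oneTable hq (by omega)

end InterpolatedPSL2

/-- For every integer `q ≥ 2` the interpolated fusion ring `R_q` exists, is unique, and passes the
one spectrum criterion. -/
theorem proposition7p15 (q : ℕ) (hq : 2 ≤ q) :
    (∃! R : FusionRing (InterpolatedPSL2.table q).Row,
      InterpolatedPSL2.IsInterpolatedFusionRing q R) ∧
    ∀ R : FusionRing (InterpolatedPSL2.table q).Row,
      InterpolatedPSL2.IsInterpolatedFusionRing q R → R.PassesOneSpectrumCriterion :=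
  InterpolatedPSL2.uniquePassing_table hq
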